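/- **Setting.** Let $n,d>0$ be integers, let $q=2^t$ ($t\ge 1$) and $V=\mathbb F_q^n$. "Degree-$d$" means degree at most $d$; a degree-$d$ polynomial on $V$ is a function $g:V\to\mathbb F_q$ given by an $n$-variate polynomial of total degree at most $d$. A *line* is a set $\{u+c v: c\in\mathbb F_q\}\subseteq V$ ($v=0$ allowed), and a degree-$d$ function on it is a degree-$d$ polynomial in $c$. For $u \in V$ let $\tau^Z_u=|u\rangle\langle u|$ on $(\mathbb C^q)^{\otimes n}$, and let $\tau^X_u$ be the projector onto $q^{-n/2}\sum_{v}(-1)^{\mathrm{tr}[u\cdot v]}|v\rangle$; let $|\mathrm{EPR}_q^n\rangle=q^{-n/2}\sum_u|u\rangle|u\rangle$. **Register strategies.** A question consists of basis queries $(W_1,W_2)\in\{X,Z,H,\bot\}^2$ and a second block; an answer consists of $(o_1,o_2)$, $o_i\in V\cup\{\varnothing\}$, and a second block. A *register strategy* (for two registers) consists of a state $|\mathrm{EPR}_q^n\rangle_1\otimes|\mathrm{EPR}_q^n\rangle_2\otimes|\mathrm{aux}\rangle$ shared by the two players, where $|\mathrm{aux}\rangle$ is a finite-dimensional bipartite pure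 state of norm one that is invariant under exchanging the players, and, for every question $x$, a POVM $\{M^x_a\}_a$ that both players use, such that (i) the marginal of $M^x$ on $(o_1,o_2)$ is $\tau^{W_1}_{o_1}\otimes\tau^{W_2}_{o_2}\otimes I_{\mathrm{aux}}$, where for $W\in\{H,\bot\}$ the only possible outcome is $\varnothing$ and $\tau^W_\varnothing=I$; (ii) $M^x_a$ acts as the identity on every register with $W_i=H$. It is *projective* if all $M^x_a$ are projectors. It is a *real commuting EPR strategy* for a game if it is projective, all $M^x_a$ have real entries, the whole shared state is a tensor product of maximally entangled states $|\mathrm{EPR}_{q_j}\rangle$ with each $q_j$ a power of two, and $M^{x}_{a}$ commutes with $M^{x'}_{a'}$ for every question pair $(x,x')$ that the game asks and all $a,a'$. **The game $\mathscr G$ (introspective intersecting lines test).** For $c\in\{1,2\}$, copy $c$ uses register $c$ as *point register* and the other register as *slope register*. Its questions (with basis queries listed as (point register, slope register), all tagged with the copy $c$) and expected answers are: * $\mathsf{Lines}_c=(\bot,Z,\text{surface})$: answer $(\varnothing,v;s,f)$, where $s$ is a line and $f:s\to\mathbb F_q$ is a degree-$d$ function; * $\mathsf{Lines}^Z_c=(Z,Z,\text{surface})$: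 answer $(u,v;s,f)$; * $\mathsf{Lines}^X_c=(\bot,Z,\text{surface},\{X\})$: answer $(\varnothing,v;s,f,e)$ with $e\in\mathbb F_q$; * $\mathsf{Basis}_c=(X,Z,\varnothing)$: answer $(u,v;\varnothing)$; * $\mathsf{Dot}_c=(\bot,Z,\bot,\{X\})$: answer $(\varnothing,v;e)$ with $e\in\mathbb F_q$; * $\mathsf{Points}_c=(Z,H,\text{point})$: answer $(u,\varnothing;\nu)$ with $\nu\in\mathbb F_q$. Answers that do not have the expected format are rejected. With probability $\frac14$ each, the verifier plays the low-degree test $\mathscr G_1$, the low-degree test $\mathscr G_2$, the intersecting lines round, or the consistency round. In each round a fair coin decides which player takes the first role. * Low-degree test $\mathscr G_c$: with probability $\frac12$ the cross-check, otherwise one of the four rounds (1)–(4), with probability $\frac14$ each. - Cross-check: $\mathsf{Lines}_c$ answers $(\varnothing,v;s,f)$ and $\mathsf{Points}_c$ answers $(u,\varnothing;\nu)$; accept iff $u\in s$ and $f(u)=\nu$. - (1) $\mathsf{Lines}_c$ and $\mathsf{Lines}^Z_c$: accept iff they give the same $v$ and the same $(s,f)$, and $s=\{u+\lambda v:\lambda\in\mathbb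 F_q\}$. - (2) $\mathsf{Lines}_c$ and $\mathsf{Lines}^X_c$: accept iff they give the same $v$ and the same $(s,f)$. - (3) $\mathsf{Basis}_c$ and $\mathsf{Dot}_c$: accept iff they give the same $v$ and $e=v\cdot u$. - (4) $\mathsf{Lines}^X_c$ and $\mathsf{Dot}_c$: accept iff they give the same $e$. * Intersecting lines: $\mathsf{Lines}_1$ answers $(\ell,v,f)$ and $\mathsf{Lines}_2$ answers $(\ell',u,f')$; accept iff $u+v\in\ell\cap\ell'$ and $f(u+v)=f'(u+v)$. * Consistency: both players get $\mathsf{Points}_1$; accept iff they give the same $\nu$. Write $A_{u,\nu}$ and $B_{v,\nu}$ for the measurements of $\mathsf{Points}_1$ and $\mathsf{Points}_2$. **Theorem.** 1. *Completeness.* For every degree-$d$ polynomial $g:V\to\mathbb F_q$ and every auxiliary state $|\mathrm{aux}\rangle$ that is a tensor product of maximally entangled states of power-of-two dimensions, there is a real commuting EPR register strategy with auxiliary state $|\mathrm{aux}\rangle$ that passes $\mathscr G$ with probability $1$ and has $$A_{u,\nu}=\tau^Z_u\otimes I_2\otimes I_{\mathrm{aux}}\cdot\mathbf 1[\nu=g(u)],\qquad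 B_{v,\nu}=I_1\otimes\tau^Z_v\otimes I_{\mathrm{aux}}\cdot\mathbf 1[\nu=g(v)].$$ 2. *Soundness.* There is a function $\delta(\varepsilon)=\mathrm{poly}(\varepsilon,d/q)$, i.e. $\delta\le C(\varepsilon^{\kappa}+(d/q)^{\kappa})$ with universal constants $C,\kappa>0$, such that the following holds. Let $\mathcal S$ be a projective register strategy that passes $\mathscr G$ with probability at least $1-\varepsilon$, $\varepsilon\ge0$, and let $\{G_g\}$ be a projective measurement on the auxiliary register, with outcomes the degree-$d$ polynomials $g:V\to\mathbb F_q$, such that $A_{u,\nu}=\tau^Z_u\otimes I_2\otimes G_{[g(u)=\nu]}$ for all $u,\nu$, where $G_{[g(u)=\nu]}=\sum_{g:g(u)=\nu}G_g$. Then, for the shared state $\psi$, $$\sum_{v,\nu}\Big\|\big(B_{v,\nu}-I_1\otimes\tau^Z_v\otimes G_{[g(v)=\nu]}\big)_{\mathrm{Alice}}\otimes I_{\mathrm{Bob}}\,|\psi\rangle\Big\|^2\le\delta(\varepsilon).$$ 3. *Complexity.* Encode an element of $\mathbb F_q$ by its $t=\log_2 q$ coordinates in a basis over $\mathbb F_2$,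 a line by its lexicographically least point and its normalized direction, and a function on it by $d+1$ coefficients. Then questions have bit length $O(1)$, and answers have bit length $O(n\log q+d\log q)$. On input $n,t,d$ together with the multiplication table of the basis, a randomized Turing machine samples the questions in time $O(1)$, and a deterministic Turing machine, which is also given the two questions and the two answers, decides in time $\mathrm{poly}(n\log q,d\log q)$ whether the verifier accepts. The machines and all implied constants are universal. -/

import Mathlib

open scoped ComplexOrder Kronecker

namespace IntroLines

noncomputable section

/-! ### Measurements, states and strategies on quantum registers -/

/-- A positive operator-valued measurement with outcomes in `A`. -/
def IsPOVM {A ι : Type} [Fintype A] [Fintype ι] [DecidableEq ι] (M : A → Matrix ι ι ℂ) : Prop :=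
  (∀ a, (M a).PosSemidef) ∧ ∑ a, M a = 1

/-- A projective measurement: a measurement all of whose elements are orthogonal projectors. -/
def IsProjMeas {A ι : Type} [Fintype A] [Fintype ι] [DecidableEq ι]
    (M : A → Matrix ι ι ℂ) : Prop :=
  IsPOVM M ∧ ∀ a, M a * M a = M a

open Classical in
/-- The marginalized measurement `M_[p(a) = b]`, the sum of `M a` over all `a` with `p a = b`. -/
def marginal {A B ι : Type} [Fintype A] (M : A → Matrix ι ι ℂ) (p : A → B) (b : B) :
    Matrix ι ι ℂ :=
  ∑ a, if p a = b then M a else 0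

/-- The probability that the local measurement elements `P` (for Alice) and `Q` (for Bob) are both
obtained on the bipartite pure state `ψ`. -/
def jointProb {ι : Type} [Fintype ι] (ψ : ι × ι → ℂ) (P Q : Matrix ι ι ℂ) : ℝ :=
  (star ψ ⬝ᵥ ((P ⊗ₖ Q).mulVec ψ)).re

/-- `∑ₐ ‖((Q a)_Alice ⊗ I_Bob - (R a)_Alice ⊗ I_Bob) ψ‖²`, the squared state-dependent distance
between two families of operators on Alice's space. -/
def stateDist {A ι : Type} [Fintype A] [Fintype ι] [DecidableEq ι] (ψ : ι × ι → ℂ)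
    (Q R : A → Matrix ι ι ℂ) : ℝ :=
  ∑ a, ∑ h, ‖(((Q a - R a) ⊗ₖ (1 : Matrix ι ι ℂ)).mulVec ψ) h‖ ^ 2

/-- `ψ` is, up to naming the basis vectors of the local spaces, a tensor product
`EPR_{q₁} ⊗ ⋯ ⊗ EPR_{qₖ}` of maximally entangled states whose dimensions are powers of two. -/
def IsEPRState {ι : Type} (ψ : ι × ι → ℂ) : Prop :=
  ∃ (k : ℕ) (t : Fin k → ℕ) (e : ι ≃ ((i : Fin k) → Fin (2 ^ t i))),
    ∀ a b, ψ (a, b) = ∏ i, if e a i = e b i then ((1 / √(2 ^ t i) : ℝ) : ℂ) else 0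

/-- The basis queries that can be made to a register: `X`, `Z`, "hide" and "no-op". -/
inductive PauliQuery where
  | X
  | Z
  | H
  | bot
  deriving DecidableEq

section Registers

variable {F : Type} [Field F] [Fintype F] [DecidableEq F] [Algebra (ZMod 2) F] {n k : ℕ}

/-- The state `EPR_q^n`, as a vector indexed by pairs of points of `F^n`. -/
def epr (u v : Fin n → F) : ℂ :=
  ∏ j, if u j = v j then ((1 / √(Fintype.card F : ℝ) : ℝ) : ℂ) else 0

/-- The `Z`-basis vector `|u⟩`. -/
def ketZ (u : Fin n → F) : (Fin n → F) → ℂ := Pi.single u 1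

/-- The `X`-basis vector `q^{-n/2} ∑ᵥ ω^{-tr[u·v]} |v⟩`; in characteristic two, `ω = -1`. -/
def ketX (u : Fin n → F) : (Fin n → F) → ℂ := fun v =>
  ((1 / √((Fintype.card F : ℝ) ^ n) : ℝ) : ℂ) * (-1) ^ (Algebra.trace (ZMod 2) F (u ⬝ᵥ v)).val

/-- The projector `τ^Z_u`. -/
def tauZ (u : Fin n → F) : Matrix (Fin n → F) (Fin n → F) ℂ :=
  Matrix.vecMulVec (ketZ u) (star (ketZ u))

/-- The projector `τ^X_u`. -/
def tauX (u : Fin n → F) : Matrix (Fin n → F) (Fin n → F) ℂ :=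
  Matrix.vecMulVec (ketX u) (star (ketX u))

/-- The operator on one register for a basis query and an answer in `F^n ∪ {∅}`. -/
def pauliProj : PauliQuery → Option (Fin n → F) → Matrix (Fin n → F) (Fin n → F) ℂ
  | .X, some u => tauX u
  | .Z, some u => tauZ u
  | .H, none => 1
  | .bot, none => 1
  | _, _ => 0

/-- `P 0 ⊗ ⋯ ⊗ P (k-1) ⊗ Q`, acting on `k` registers and the auxiliary space. -/
def tensor {aux : Type} (P : Fin k → Matrix (Fin n → F) (Fin n → F) ℂ) (Q : Matrix aux aux ℂ) :
    Matrix ((Fin k → Fin n → F) × aux) ((Fin k → Fin n → F) × aux) ℂ :=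
  Matrix.of fun x y => (∏ i, P i (x.1 i) (y.1 i)) * Q x.2 y.2

open Classical in
/-- `M` is of the form `I ⊗ N`, where `I` is the identity on the registers in `S` and `N` acts on
the other registers and the auxiliary space. -/
def HidesRegisters {aux : Type} (S : Fin k → Prop)
    (M : Matrix ((Fin k → Fin n → F) × aux) ((Fin k → Fin n → F) × aux) ℂ) : Prop :=
  ∃ N : Matrix (({i // ¬ S i} → Fin n → F) × aux) (({i // ¬ S i} → Fin n → F) × aux) ℂ,
    ∀ x y, M x y = if ∀ i, S i → x.1 i = y.1 i
      then N (fun i => x.1 i, x.2) (fun i => y.1 i, y.2) else 0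

end Registers

/-- A question of a register game: `k` basis queries and a second block. -/
abbrev Question (k : ℕ) (X₂ : Type) : Type := (Fin k → PauliQuery) × X₂

/-- An answer of a register game: `k` elements of `F^n ∪ {∅}` and a second block. -/
abbrev Answer (k : ℕ) (F : Type) (n : ℕ) (A₂ : Type) : Type := (Fin k → Option (Fin n → F)) × A₂

/-- A two-player game with `k` registers, each made of `n` qudits indexed by `F`. The verifier
draws a uniformly random seed, which determines the two questions, and decides from the questions
and the answers. -/
structure RegisterGame (k : ℕ) (F : Type) (n : ℕ) (X₂ A₂ : Type) where
  Seed : Type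
  [seedFintype : Fintype Seed]
  ask : Seed → Question k X₂ × Question k X₂
  accepts : Question k X₂ → Question k X₂ → Answer k F n A₂ → Answer k F n A₂ → Prop

attribute [instance] RegisterGame.seedFintype

section Strategies

variable {F : Type} [Field F] [Fintype F] [DecidableEq F] [Algebra (ZMod 2) F] {n k : ℕ}
  {X₂ A₂ aux : Type} [Fintype A₂] [Fintype aux] [DecidableEq aux]

/-- A (symmetric) register strategy: the players share `EPR_q^n` in each register together with a
symmetric auxiliary state, honestly answer `X` and `Z` queries by measuring the register, and do
not touch the registers that have been hidden. -/
structure RegisterStrategy (k : ℕ) (F : Type) [Field F] [Fintype F] [DecidableEq F]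
    [Algebra (ZMod 2) F] (n : ℕ) (X₂ A₂ aux : Type) [Fintype A₂] [Fintype aux]
    [DecidableEq aux] where
  auxState : aux × aux → ℂ
  auxState_symm : ∀ a b, auxState (a, b) = auxState (b, a)
  auxState_norm : ∑ p, ‖auxState p‖ ^ 2 = 1
  M : Question k X₂ → Answer k F n A₂ →
    Matrix ((Fin k → Fin n → F) × aux) ((Fin k → Fin n → F) × aux) ℂ
  povm : ∀ x, IsPOVM (M x)
  pauli : ∀ x o, ∑ r, M x (o, r) = tensor (fun i => pauliProj (x.1 i) (o i)) 1
  hidden : ∀ x a, HidesRegisters (fun i => x.1 i = PauliQuery.H) (M x a)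

namespace RegisterStrategy

/-- The shared state: `EPR_q^n` in each register, tensored with the auxiliary state. -/
def state (S : RegisterStrategy k F n X₂ A₂ aux) :
    ((Fin k → Fin n → F) × aux) × ((Fin k → Fin n → F) × aux) → ℂ :=
  fun p => (∏ i, epr (p.1.1 i) (p.2.1 i)) * S.auxState (p.1.2, p.2.2)

/-- All measurements are projective. -/
def IsProjective (S : RegisterStrategy k F n X₂ A₂ aux) : Prop :=
  ∀ x, IsProjMeas (S.M x)

open Classical in
/-- The probability that the strategy is accepted in the game. -/
def value (S : RegisterStrategy k F n X₂ A₂ aux) (G : RegisterGame k F n X₂ A₂) : ℝ :=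
  (∑ s : G.Seed, ∑ a₀, ∑ a₁,
    if G.accepts (G.ask s).1 (G.ask s).2 a₀ a₁
      then jointProb S.state (S.M (G.ask s).1 a₀) (S.M (G.ask s).2 a₁) else 0) /
    Fintype.card G.Seed

/-- The strategy is a real commuting EPR strategy with respect to the game: the shared state is a
product of EPR states, all measurements are projective with real entries, and the measurements for
the two questions of every pair that the verifier may ask commute. -/
def IsRealCommutingEPR (S : RegisterStrategy k F n X₂ A₂ aux) (G : RegisterGame k F n X₂ A₂) :
    Prop :=
  IsEPRState S.state ∧ S.IsProjective ∧ (∀ x a i j, (S.M x a i j).im = 0) ∧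
    ∀ s a₀ a₁, Commute (S.M (G.ask s).1 a₀) (S.M (G.ask s).2 a₁)

end RegisterStrategy

end Strategies

/-! ### Polynomials, lines and polynomials on lines -/

section Polynomials

variable (F : Type) [Field F] (n d : ℕ)

/-- The functions `g : F^n → F` that are given by a polynomial of total degree at most `d`. -/
def PolyFn : Type :=
  {g : (Fin n → F) → F //
    ∃ p : MvPolynomial (Fin n) F, p.totalDegree ≤ d ∧ ∀ x, MvPolynomial.eval x p = g x}

variable {F n}

/-- The line `{u + c v : c ∈ F}`, a single point if `v = 0`. -/
def lineThrough (u v : Fin n → F) : Set (Fin n → F) := Set.range fun c : F => u + c • v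

variable (F n)

/-- The pairs `(s, f)` of a (possibly degenerate) line `s` of `F^n` and a function `f : s → F` that
is a polynomial of degree at most `d` in a parameter of the line. -/
def LineFn : Type :=
  {a : Σ s : Set (Fin n → F), (s → F) //
    ∃ (u v : Fin n → F) (p : Polynomial F), p.natDegree ≤ d ∧ a.1 = lineThrough u v ∧
      ∀ (x : a.1) (c : F), x.1 = u + c • v → a.2 x = p.eval c}

variable {F n d}

/-- The line of a pair `(s, f)`. -/
def LineFn.line (a : LineFn F n d) : Set (Fin n → F) := a.1.1

/-- The point `x` lies on the line and the function takes the value `ν` there. -/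
def LineFn.HasValue (a : LineFn F n d) (x : Fin n → F) (ν : F) : Prop :=
  ∃ h : x ∈ a.line, a.1.2 ⟨x, h⟩ = ν

instance [Finite F] : Finite (PolyFn F n d) := by unfold PolyFn; infer_instance

instance [Finite F] : Finite (LineFn F n d) := by unfold LineFn; infer_instance

instance [Finite F] : Fintype (PolyFn F n d) := Fintype.ofFinite _

end Polynomials

/-! ### The introspective intersecting lines test -/

/-- The auxiliary queries: `"surface"`, `"surface"` with `{X}`, no query, `⊥` with `{X}`, and
`"point"`. -/
inductive AuxQuery where
  | surface
  | surfaceX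
  | empty
  | botX
  | point
  deriving DecidableEq

/-- The second block of an answer: a line with a function on it, possibly with a dot product; no
answer; a dot product; or the value at a point. -/
inductive Reply (F : Type) [Field F] (n d : ℕ) where
  | line (f : LineFn F n d)
  | lineDot (f : LineFn F n d) (e : F)
  | empty
  | dot (e : F)
  | value (ν : F)

instance {F : Type} [Field F] [Finite F] {n d : ℕ} : Finite (Reply F n d) := by
  refine Finite.of_injective
    (β := LineFn F n d ⊕ (LineFn F n d × F) ⊕ Unit ⊕ F ⊕ F)
    (fun r => match r with
      | .line f => .inl f
      | .lineDot f e => .inr (.inl (f, e))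
      | .empty => .inr (.inr (.inl ()))
      | .dot e => .inr (.inr (.inr (.inl e)))
      | .value ν => .inr (.inr (.inr (.inr ν)))) ?_
  intro a b h
  cases a <;> cases b <;> simp_all

instance {F : Type} [Field F] [Finite F] {n d : ℕ} : Fintype (Reply F n d) := Fintype.ofFinite _

/-- The test has two registers and two copies of the low-degree test. The two registers are
numbered `0` and `1`, and so are the copies; copy `c` uses register `c` as its point register and
the other register as its slope register. `place c p s` puts `p` on the point register of copy `c`
and `s` on the slope register. -/
def place {T : Type} (c : Fin 2) (p s : T) : Fin 2 → T := fun i => if i = c then p else s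

/-- The questions of the test: two basis queries, the copy of the low-degree test that the question
belongs to, and the auxiliary query. -/
abbrev Q : Type := Question 2 (Fin 2 × AuxQuery)

/-- The answers of the test. -/
abbrev A (F : Type) [Field F] (n d : ℕ) : Type := Answer 2 F n (Reply F n d)

/-- The question to the lines prover of copy `c`. -/
def linesQ (c : Fin 2) : Q := (place c .bot .Z, c, .surface)

/-- The question to the points prover of copy `c`. -/
def pointsQ (c : Fin 2) : Q := (place c .Z .H, c, .point)

/-- The `"surface"` question with a `Z` query to the point register. -/
def linesZQ (c : Fin 2) : Q := (place c .Z .Z, c, .surface)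

/-- The `"surface"` question that also asks for a dot product in the `X` basis. -/
def linesXQ (c : Fin 2) : Q := (place c .bot .Z, c, .surfaceX)

/-- The question asking to measure the point register in the `X` basis. -/
def basisXQ (c : Fin 2) : Q := (place c .X .Z, c, .empty)

/-- The question asking for a dot product in the `X` basis only. -/
def dotXQ (c : Fin 2) : Q := (place c .bot .Z, c, .botX)

/-- The elementary rounds of the test: the four tests of the introspected partial data-hiding game
of each copy, the cross-check of each copy, the intersecting lines test and the consistency
test. -/
inductive Round where
  | hideSurface (c : Fin 2)
  | hideAnswer (c : Fin 2)
  | hideBasis (c : Fin 2)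
  | hideDot (c : Fin 2)
  | cross (c : Fin 2)
  | intersect
  | consistency

/-- The questions to the first and the second role of a round. -/
def Round.questions : Round → Q × Q
  | hideSurface c => (linesQ c, linesZQ c)
  | hideAnswer c => (linesQ c, linesXQ c)
  | hideBasis c => (basisXQ c, dotXQ c)
  | hideDot c => (linesXQ c, dotXQ c)
  | cross c => (linesQ c, pointsQ c)
  | intersect => (linesQ 0, linesQ 1)
  | consistency => (pointsQ 0, pointsQ 0)

/-- The winning condition of a round on the answers of the first and the second role. An answer
whose format does not fit the question is rejected. -/
def Round.check {F : Type} [Field F] {n d : ℕ} : Round → A F n d → A F n d → Prop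
  -- the same line with the same function, and the line is the one through `u` in direction `v`
  | hideSurface c, a, b => ∃ u v f,
      a = (place c none (some v), .line f) ∧ b = (place c (some u) (some v), .line f) ∧
        f.line = lineThrough u v
  | hideAnswer c, a, b => ∃ v f e,
      a = (place c none (some v), .line f) ∧ b = (place c none (some v), .lineDot f e)
  | hideBasis c, a, b => ∃ u v,
      a = (place c (some u) (some v), .empty) ∧ b = (place c none (some v), .dot (v ⬝ᵥ u))
  | hideDot c, a, b => ∃ v v' f e,
      a = (place c none (some v), .lineDot f e) ∧ b = (place c none (some v'), .dot e)
  | cross c, a, b => ∃ u v f ν,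
      a = (place c none (some v), .line f) ∧ b = (place c (some u) none, .value ν) ∧
        f.HasValue u ν
  | intersect, a, b => ∃ u v f f' ν,
      a = (place 0 none (some v), .line f) ∧ b = (place 1 none (some u), .line f') ∧
        f.HasValue (u + v) ν ∧ f'.HasValue (u + v) ν
  | consistency, a, b => ∃ u u' ν,
      a = (place 0 (some u) none, .value ν) ∧ b = (place 0 (some u') none, .value ν)

/-- The surface sampler of copy `c` plays one of four rounds, each with probability `1/4`. -/
def samplerRound (c : Fin 2) : Fin 4 → Round
  | 0 => .hideSurface c
  | 1 => .hideAnswer c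
  | 2 => .hideBasis c
  | 3 => .hideDot c

/-- The introspective low-degree test of copy `c` plays the surface sampler or the cross-check,
each with probability `1/2`. -/
def lowDegRound (c : Fin 2) (h : Bool) (i : Fin 4) : Round :=
  if h then samplerRound c i else .cross c

/-- The four parts of the intersecting lines test, each with probability `1/4`. -/
def drawRound : Fin 4 → Bool → Fin 4 → Round
  | 0, h, i => lowDegRound 0 h i
  | 1, h, i => lowDegRound 1 h i
  | 2, _, _ => .intersect
  | 3, _, _ => .consistency

/-- The introspective intersecting lines test. The last component of the seed is the coin that
decides which player takes the first role of the round. The round can be read off from the pair of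
questions. -/
def introIntersect (F : Type) [Field F] (n d : ℕ) :
    RegisterGame 2 F n (Fin 2 × AuxQuery) (Reply F n d) where
  Seed := Fin 4 × Bool × Fin 4 × Bool
  ask s :=
    let x := (drawRound s.1 s.2.1 s.2.2.1).questions
    if s.2.2.2 then x else x.swap
  accepts x₀ x₁ a₀ a₁ :=
    ∃ r : Round, (r.questions = (x₀, x₁) ∧ r.check a₀ a₁) ∨ (r.questions = (x₁, x₀) ∧ r.check a₁ a₀)

/-- The measurement of the points prover of copy `c`, with outcomes `(u, ν)`. -/
def pointsMeas {F : Type} [Field F] [Fintype F] [DecidableEq F] [Algebra (ZMod 2) F] {n d : ℕ}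
    {aux : Type} [Fintype aux] [DecidableEq aux]
    (S : RegisterStrategy 2 F n (Fin 2 × AuxQuery) (Reply F n d) aux) (c : Fin 2)
    (o : (Fin n → F) × F) :
    Matrix ((Fin 2 → Fin n → F) × aux) ((Fin 2 → Fin n → F) × aux) ℂ :=
  S.M (pointsQ c) (place c (some o.1) none, .value o.2)

/-- `δ(x, y) = poly(x, y)`: for nonnegative arguments, `δ` is bounded by a constant times
`x^c + y^c`, with a positive exponent `c`. -/
def IsPolySmall (δ : ℝ → ℝ → ℝ) : Prop :=
  ∃ C c : ℝ, 0 < C ∧ 0 < c ∧ ∀ x y, 0 ≤ x → 0 ≤ y → δ x y ≤ C * (x ^ c + y ^ c)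

/-! ### Encodings by bit strings -/

section Encodings

/-- The code of a basis query. -/
def PauliQuery.bits : PauliQuery → List Bool
  | .X => [false, false]
  | .Z => [false, true]
  | .H => [true, false]
  | .bot => [true, true]

/-- The code of an auxiliary query. -/
def AuxQuery.bits : AuxQuery → List Bool
  | .surface => [false, false, false]
  | .surfaceX => [false, false, true]
  | .empty => [false, true, false]
  | .botX => [false, true, true]
  | .point => [true, false, false]

/-- The code of a question. -/
def questionBits (x : Q) : List Bool :=
  (x.1 0).bits ++ (x.1 1).bits ++ [decide (x.2.1 = 1)] ++ x.2.2.bits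

variable {F : Type} [Field F]

/-- The canonical representation of a line with a function on it: the point `u` and the direction
`w` are such that either `w = 0`, or the first nonzero coordinate of `w` is `1` and `u` vanishes in
this coordinate (which makes `u` the lexicographically least point of the line, when `0` is the
least element of `F`), and the function is given by the `d + 1` coefficients of a polynomial in the
parameter of the line. -/
def LineFn.IsCode {n d : ℕ} (a : LineFn F n d)
    (z : (Fin n → F) × (Fin n → F) × (Fin (d + 1) → F)) : Prop :=
  (z.2.1 = 0 ∨ ∃ j, z.2.1 j = 1 ∧ (∀ i < j, z.2.1 i = 0) ∧ z.1 j = 0) ∧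
    a.line = lineThrough z.1 z.2.1 ∧
      ∀ (x : a.1.1) (c : F), x.1 = z.1 + c • z.2.1 → a.1.2 x = ∑ i, z.2.2 i * c ^ (i : ℕ)

theorem LineFn.exists_isCode {n d : ℕ} (a : LineFn F n d) : ∃ z, a.IsCode z := by
  classical
  obtain ⟨⟨s, f⟩, u, v, p, hp, hs, hf⟩ := a
  simp only at hs hf
  subst hs
  have hsum : ∀ (r : Polynomial F), r.natDegree ≤ d → ∀ c : F,
      r.eval c = ∑ i : Fin (d + 1), r.coeff i * c ^ (i : ℕ) := by
    intro r hr c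
    rw [Polynomial.eval_eq_sum_range' (Nat.lt_succ_of_le hr) c,
      Finset.sum_range (fun i => r.coeff i * c ^ i)]
  by_cases hv : v = 0
  · exact ⟨(u, v, fun i => p.coeff i), Or.inl hv, rfl, fun x c hx => (hf x c hx).trans (hsum p hp c)⟩
  · obtain ⟨j, hj, hmin⟩ : ∃ j, v j ≠ 0 ∧ ∀ i < j, v i = 0 := by
      have hne : (Finset.univ.filter fun i => v i ≠ 0).Nonempty := by
        obtain ⟨i, hi⟩ := Function.ne_iff.mp hv
        exact ⟨i, by simpa using hi⟩
      refine ⟨_, (Finset.mem_filter.mp (Finset.min'_mem _ hne)).2, fun i hi => ?_⟩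
      by_contra h
      exact absurd (Finset.min'_le _ i (Finset.mem_filter.mpr ⟨Finset.mem_univ _, h⟩))
        (not_le.mpr hi)
    have key : ∀ c : F, (u - (u j) • ((v j)⁻¹ • v)) + c • ((v j)⁻¹ • v)
        = u + ((v j)⁻¹ * (c - u j)) • v := by
      intro c
      ext i
      simp only [Pi.add_apply, Pi.sub_apply, Pi.smul_apply, smul_eq_mul]
      ring
    let r : Polynomial F :=
      p.comp (Polynomial.C (v j)⁻¹ * (Polynomial.X - Polynomial.C (u j)))
    have hr : r.natDegree ≤ d := by
      have h1 : (Polynomial.C (v j)⁻¹ * (Polynomial.X - Polynomial.C (u j))).natDegree ≤ 1 :=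
        (Polynomial.natDegree_C_mul_le _ _).trans (Polynomial.natDegree_X_sub_C_le _)
      calc r.natDegree ≤ _ := Polynomial.natDegree_comp_le
        _ ≤ p.natDegree * 1 := Nat.mul_le_mul_left _ h1
        _ ≤ d := by simpa using hp
    refine ⟨(u - (u j) • ((v j)⁻¹ • v), (v j)⁻¹ • v, fun i => r.coeff i),
      Or.inr ⟨j, ?_, ?_, ?_⟩, ?_, ?_⟩
    · simp [hj]
    · intro i hi
      simp [hmin i hi]
    · simp [hj]
    · ext x
      constructor
      · rintro ⟨c, rfl⟩
        refine ⟨v j * c + u j, ?_⟩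
        simp only [key]
        congr 2
        field_simp
        ring
      · rintro ⟨c, rfl⟩
        exact ⟨(v j)⁻¹ * (c - u j), (key c).symm⟩
    · intro x c hx
      refine (hf x ((v j)⁻¹ * (c - u j)) (hx.trans (key c))).trans ?_
      rw [← hsum r hr c]
      simp [r, Polynomial.eval_comp]

/-- The code of a line with a function on it. -/
def LineFn.code {n d : ℕ} (a : LineFn F n d) :
    (Fin n → F) × (Fin n → F) × (Fin (d + 1) → F) :=
  a.exists_isCode.choose

variable [Algebra (ZMod 2) F] {t n d : ℕ} (b : Module.Basis (Fin t) (ZMod 2) F)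

/-- The coordinates of an element of the field with `2^t` elements in a basis over `ZMod 2`. -/
def fieldBits (x : F) : List Bool := List.ofFn fun i => decide (b.repr x i = 1)

/-- The code of a vector over the field. -/
def vecBits {m : ℕ} (u : Fin m → F) : List Bool := (List.ofFn fun i => fieldBits b (u i)).flatten

/-- The code of a line with a function on it. -/
def lineFnBits (a : LineFn F n d) : List Bool :=
  vecBits b a.code.1 ++ vecBits b a.code.2.1 ++ vecBits b a.code.2.2

/-- The code of the answer to a basis query. -/
def optionBits : Option (Fin n → F) → List Bool
  | none => [false]
  | some u => true :: vecBits b u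

/-- The code of the second block of an answer. -/
def replyBits : Reply F n d → List Bool
  | .line f => [false, false, false] ++ lineFnBits b f
  | .lineDot f e => [false, false, true] ++ lineFnBits b f ++ fieldBits b e
  | .empty => [false, true, false]
  | .dot e => [false, true, true] ++ fieldBits b e
  | .value ν => [true, false, false] ++ fieldBits b ν

/-- The code of an answer. -/
def answerBits (a : A F n d) : List Bool :=
  optionBits b (a.1 0) ++ optionBits b (a.1 1) ++ replyBits b a.2

/-- Several bit strings as one string, with `none` as the separator. -/
def joinStrings (l : List (List Bool)) : List (Option Bool) :=
  ((l.map (List.map some)).intersperse [none]).flatten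

/-- The input of the game family, as a list of bit strings: the numbers `n`, `t` and `d` in unary,
and the field with `2^t` elements, presented by the multiplication table of a basis. -/
def inputStrings (n d : ℕ) : List (List Bool) :=
  [List.replicate n true, List.replicate t true, List.replicate d true,
    (List.ofFn fun i => (List.ofFn fun j => fieldBits b (b i * b j)).flatten).flatten]

end Encodings

/-! ### Running times of multi-stack Turing machines -/

open Turing

/-- Started in the configuration `c`, the machine halts after at most `T` steps, with `out` on its
output stack. -/
def HaltsWithin (tm : FinTM2) (c : tm.Cfg) (out : List (tm.Γ tm.k₁)) (T : ℕ) : Prop :=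
  ∃ c' : TM2.Cfg tm.Γ tm.Λ tm.σ, c'.l = none ∧ c'.stk tm.k₁ = out ∧
    Nonempty (StateTransition.EvalsToInTime tm.step c (some c') T)

/-- The initial configuration with a string on the input stack and coins on the stack `kc`. -/
def initCoins (tm : FinTM2) (kc : tm.K) (inp : List (tm.Γ tm.k₀)) (coins : List (tm.Γ kc)) :
    tm.Cfg :=
  (⟨some tm.main, tm.initialState,
    Function.update (Function.update (fun _ => []) tm.k₀ inp) kc coins⟩ :
      TM2.Cfg tm.Γ tm.Λ tm.σ)

/-- A randomized machine: a machine with a further stack, different from the input stack, which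
initially holds random bits. -/
structure CoinMachine (Γ₀ Γ₁ : Type) extends TM2ComputableAux Γ₀ Γ₁ where
  kc : tm.K
  kc_ne : kc ≠ tm.k₀
  coinAlphabet : tm.Γ kc ≃ Bool

/-- On the given input, with `T` fair coins, the randomized machine always halts within `T` steps,
and its output has the distribution of the code of the pair of questions of the game. -/
def CoinMachine.Samples (R : CoinMachine (Option Bool) (Option Bool)) (inp : List (Option Bool))
    (T : ℕ) {F : Type} [Field F] {n d : ℕ}
    (G : RegisterGame 2 F n (Fin 2 × AuxQuery) (Reply F n d)) : Prop :=
  ∃ ask : (Fin T → Bool) → Q × Q,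
    (∀ r, HaltsWithin R.tm
      (initCoins R.tm R.kc (inp.map R.inputAlphabet.symm)
        ((List.ofFn r).map R.coinAlphabet.symm))
      ((joinStrings [questionBits (ask r).1, questionBits (ask r).2]).map R.outputAlphabet.symm)
      T) ∧
    ∀ x : Q × Q, (Nat.card {r // ask r = x} : ℝ) / 2 ^ T =
      (Nat.card {s // G.ask s = x} : ℝ) / Fintype.card G.Seed

open Classical in
/-- On the input of the game family, a pair of questions and a pair of answers, the machine halts
within `T` steps, and it outputs the verdict of the game. -/
def Decides (D : TM2ComputableAux (Option Bool) Bool) {F : Type} [Field F] [Algebra (ZMod 2) F]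
    {t n d : ℕ} (b : Module.Basis (Fin t) (ZMod 2) F) (T : ℕ)
    (G : RegisterGame 2 F n (Fin 2 × AuxQuery) (Reply F n d)) : Prop :=
  ∀ (x₀ x₁ : Q) (a₀ a₁ : A F n d), HaltsWithin D.tm
    (initList D.tm ((joinStrings (inputStrings b n d ++
      [questionBits x₀, questionBits x₁, answerBits b a₀, answerBits b a₁])).map
        D.inputAlphabet.symm))
    [D.outputAlphabet.symm (decide (G.accepts x₀ x₁ a₀ a₁))] T

end

end IntroLines

open scoped ComplexOrder Kronecker

namespace IntroLines

open Turing Function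

/-! Soundness. The shared state is read as a matrix Ψ: Alice's operators act from the left and the
transposes of Bob's from the right, so probabilities and state-dependent distances become Frobenius
norms (`kronecker_mulVec_apply`, `jointProb_eq`). Because the registers hold EPR pairs, Ψ is a
multiple of the identity tensored with the auxiliary state (`stateMat_state`), and every operator on
the registers alone commutes with Ψ. The key identity is `obs_basis`: if u is the `X` outcome on the
point register and v the `Z` outcome on the slope register, then the observable with sign tr[v·u] is
exactly the permutation |u, v⟩ ↦ |u + v, v⟩. The hiding rounds therefore force Bob's measurement of
(s, f) to commute approximately with this shift (`sum_fr_bobLines_commutator_le`). Through `dotXQ`,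
the shift is close on Ψ to the observable of the dot product in `linesXQ`; that observable commutes
exactly with the pair (s, f) measured jointly with it, and this pair agrees with the one of
`linesQ`. Hence, if f agrees with a value that Alice measures at u, it also agrees with the value
measured at u + v (`bad_shift_le`). The proof chains these facts. The cross-check of the first copy
says that f agrees with G at u; by the shift it agrees at u + v; by the intersecting lines round, f'
agrees with G at u + v (`bad_intersect_le`, where the consistency round supplies that the two
players' G agree); by the shift of the second copy, f' agrees with G at (u + v) + u = v, in
characteristic two; and by the cross-check of the second copy, f' agrees with B at v. Two
measurements of Alice that agree with one measurement of Bob are close (`sum_fr_sub_part_le`).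
Functions are only ever compared at a single point, never through the number of zeros of a
polynomial, so the loss is linear in ε.

Completeness. The honest players measure the line through u in direction v and restrict g to it. The
dot product v·u in the `X` basis can be measured jointly with the line, since its projectors only
connect points on a common line in direction v (`part_tauX_apply`, `lineMeas_commute`). All honest
operators are real symmetric tensors that commute with Ψ, so a pair of answers has weight zero as
soon as the product of the two operators vanishes (`value_honest`).

Complexity. Stack programs are compiled to multi-stack machines step for step (`steps_of_run`). The
string functions computed by them in polynomial time (`PT`) are closed under composition, case
distinction and folds of controlled growth, and the verdict is an explicit expression in such
functions (`decideS`). For the sampler there are only 64 equally likely seeds, so six coins and a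
finite table suffice. -/

/-! ### Stack programs and their compilation to multi-stack Turing machines -/

/-- The stack alphabet. -/
abbrev Sym : Type := Option Bool

/-- The content of a stack. -/
abbrev Str : Type := List Sym

/-- Programs acting on stacks numbered by `ℕ`. -/
inductive Prog where
  | skip
  | push (k : ℕ) (x : Sym)
  | case (k : ℕ) (pe : Prog) (p : Sym → Prog)
  | seq (p q : Prog)
  | loop (k : ℕ) (p : Sym → Prog)

namespace Prog

/-- `Run p s s' T`: started with stacks `s`, the program `p` ends with stacks `s'` after `T`
steps. -/
inductive Run : Prog → (ℕ → Str) → (ℕ → Str) → ℕ → Prop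
  | skip (s) : Run .skip s s 1
  | push (k x s) : Run (.push k x) s (update s k (x :: s k)) 1
  | case_nil {k pe p s s' T} : s k = [] → Run pe s s' T → Run (.case k pe p) s s' (T + 1)
  | case_cons {k pe p s s' T x l} : s k = x :: l → Run (p x) (update s k l) s' T →
      Run (.case k pe p) s s' (T + 1)
  | seq {p q s s' s'' T T'} : Run p s s' T → Run q s' s'' T' → Run (.seq p q) s s'' (T + T')
  | loop_nil {k p s} : s k = [] → Run (.loop k p) s s 1
  | loop_cons {k p s s' s'' T T' x l} : s k = x :: l → Run (p x) (update s k l) s' T →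
      Run (.loop k p) s' s'' T' → Run (.loop k p) s s'' (T + T' + 1)

/-- The control positions of a program. -/
def Pos : Prog → Type
  | .skip => Unit
  | .push _ _ => Unit
  | .case _ pe p => Option (Pos pe ⊕ (Σ x, Pos (p x)))
  | .seq p q => Pos p ⊕ Pos q
  | .loop _ p => Option (Σ x, Pos (p x))

theorem finite_pos : ∀ p : Prog, Finite (Pos p)
  | .skip => inferInstanceAs (Finite Unit)
  | .push _ _ => inferInstanceAs (Finite Unit)
  | .case _ pe p => by
      have := finite_pos pe
      have := fun x => finite_pos (p x)
      exact inferInstanceAs (Finite (Option (Pos pe ⊕ (Σ x, Pos (p x)))))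
  | .seq p q => by
      have := finite_pos p
      have := finite_pos q
      exact inferInstanceAs (Finite (Pos p ⊕ Pos q))
  | .loop _ p => by
      have := fun x => finite_pos (p x)
      exact inferInstanceAs (Finite (Option (Σ x, Pos (p x))))

/-- The position where a program starts. -/
def entry : (p : Prog) → Pos p
  | .skip => ()
  | .push _ _ => ()
  | .case _ _ _ => none
  | .seq p _ => Sum.inl (entry p)
  | .loop _ _ => none

/-- The largest stack number that occurs in a program. -/
def bound : Prog → ℕ
  | .skip => 0
  | .push k _ => k
  | .case k pe p => max k (max (bound pe) (Finset.univ.sup fun x => bound (p x)))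
  | .seq p q => max (bound p) (bound q)
  | .loop k p => max k (Finset.univ.sup fun x => bound (p x))

/-- The alphabets of the compiled machine: the stack `none` is reserved for the output bit. -/
abbrev Alph (N : ℕ) : Option (Fin (N + 1)) → Type
  | none => Bool
  | some _ => Sym

/-- The code of the compiled machine, for a program whose positions are embedded into the labels,
and which jumps to the label `exit` in the end. -/
def code (N : ℕ) {Λ : Type} : (p : Prog) → (Pos p → Λ) → Λ → Pos p →
    TM2.Stmt (Alph N) Λ (Option Sym)
  | .skip, _, exit, _ => .goto fun _ => exit
  | .push k x, _, exit, _ => .push (some (Fin.ofNat (N + 1) k)) (fun _ => x) (.goto fun _ => exit)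
  | .case k pe p, emb, exit, q =>
      match q with
      | none => .pop (some (Fin.ofNat (N + 1) k)) (fun _ h => h) (.goto fun v =>
          match v with
          | none => emb (some (Sum.inl (entry pe)))
          | some x => emb (some (Sum.inr ⟨x, entry (p x)⟩)))
      | some (Sum.inl q) => code N pe (fun q => emb (some (Sum.inl q))) exit q
      | some (Sum.inr ⟨x, q⟩) => code N (p x) (fun q => emb (some (Sum.inr ⟨x, q⟩))) exit q
  | .seq p q, emb, exit, r =>
      match r with
      | Sum.inl r => code N p (fun r => emb (Sum.inl r)) (emb (Sum.inr (entry q))) r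
      | Sum.inr r => code N q (fun r => emb (Sum.inr r)) exit r
  | .loop k p, emb, exit, q =>
      match q with
      | none => .pop (some (Fin.ofNat (N + 1) k)) (fun _ h => h) (.goto fun v =>
          match v with
          | none => exit
          | some x => emb (some ⟨x, entry (p x)⟩))
      | some ⟨x, q⟩ => code N (p x) (fun q => emb (some ⟨x, q⟩)) (emb none) q

/-- The stacks of the compiled machine. -/
def toStk (N : ℕ) (s : ℕ → Str) : (k : Option (Fin (N + 1))) → List (Alph N k)
  | none => []
  | some i => s i

/-- `code` reduces stack numbers modulo N + 1; the bound on k is what keeps distinct stacks of the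
program distinct in the machine. -/
theorem toStk_ofNat {N k : ℕ} (h : k ≤ N) (s : ℕ → Str) :
    toStk N s (some (Fin.ofNat (N + 1) k)) = s k := by
  simp [toStk, Nat.mod_eq_of_lt (Nat.lt_succ_of_le h)]

theorem update_toStk {N k : ℕ} (h : k ≤ N) (s : ℕ → Str) (l : Str) :
    update (toStk N s) (some (Fin.ofNat (N + 1) k)) l = toStk N (update s k l) := by
  funext j
  cases j with
  | none => simp [toStk]
  | some i =>
    by_cases hi : i = Fin.ofNat (N + 1) k
    · subst hi
      simp [toStk, Nat.mod_eq_of_lt (Nat.lt_succ_of_le h)]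
    · have hi' : (i : ℕ) ≠ k := by
        rintro rfl
        exact hi (by simp)
      rw [update_of_ne (by simpa using hi)]
      simp [toStk, hi']

/-- The configuration `c'` is reached from `c` in exactly `T` steps. -/
def StepsTo {σ : Type} (f : σ → Option σ) (c c' : σ) (T : ℕ) : Prop :=
  (flip bind f)^[T] (some c) = some c'

theorem StepsTo.trans {σ : Type} {f : σ → Option σ} {a b c : σ} {m n : ℕ}
    (h : StepsTo f a b m) (h' : StepsTo f b c n) : StepsTo f a c (m + n) := by
  unfold StepsTo at *
  rw [Nat.add_comm, Function.iterate_add_apply, h, h']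

theorem StepsTo.single {σ : Type} {f : σ → Option σ} {a b : σ} (h : f a = some b) :
    StepsTo f a b 1 := h

theorem step_pos {N : ℕ} {Λ : Type} {M : Λ → TM2.Stmt (Alph N) Λ (Option Sym)} {l : Λ}
    {c : TM2.Stmt (Alph N) Λ (Option Sym)} (h : M l = c) (v : Option Sym) (S) :
    TM2.step M ⟨some l, v, S⟩ = some (TM2.stepAux c v S) := by
  subst h; rfl

theorem update_tail_of_nil {s : ℕ → Str} {k : ℕ} (h : s k = []) :
    update s k (s k).tail = s := by
  rw [h, List.tail_nil, ← h, update_eq_self]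

/-- Induction on the derivation of `Run`. The embedding of positions and the exit label have to
vary, because a subprogram sits inside a larger one and continues at the next part of it. `Run`
charges one unit exactly when the machine visits a label, so the step counts agree without overhead.
-/
theorem steps_of_run (N : ℕ) {p : Prog} {s s' : ℕ → Str} {T : ℕ} (h : Run p s s' T)
    (hN : bound p ≤ N) {Λ : Type} (M : Λ → TM2.Stmt (Alph N) Λ (Option Sym))
    (emb : Pos p → Λ) (exit : Λ) (hM : ∀ q, M (emb q) = code N p emb exit q) (v : Option Sym) :
    ∃ v', StepsTo (TM2.step M) ⟨some (emb (entry p)), v, toStk N s⟩ ⟨some exit, v', toStk N s'⟩ T := by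
  induction h generalizing v exit with
  | skip s => exact ⟨v, StepsTo.single (step_pos (hM ()) v _)⟩
  | push k x s =>
    refine ⟨v, StepsTo.single ((step_pos (hM ()) v _).trans ?_)⟩
    simp only [code, TM2.stepAux, toStk_ofNat (show k ≤ N from hN)]
    rw [update_toStk (show k ≤ N from hN)]
  | @case_nil k pe p s s' T hk _ ih =>
    simp only [bound, max_le_iff] at hN
    obtain ⟨v', hv⟩ := ih hN.2.1 (fun q => emb (some (Sum.inl q))) exit
      (fun q => hM (some (Sum.inl q))) none
    refine ⟨v', ?_⟩
    rw [Nat.add_comm T 1]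
    refine StepsTo.trans (StepsTo.single ((step_pos (hM none) v _).trans ?_)) hv
    simp only [code, TM2.stepAux, toStk_ofNat hN.1]
    rw [update_toStk hN.1, update_tail_of_nil hk, hk]
    rfl
  | @case_cons k pe p s s' T x l hk _ ih =>
    simp only [bound, max_le_iff, Finset.sup_le_iff] at hN
    obtain ⟨v', hv⟩ := ih (hN.2.2 x (Finset.mem_univ _)) (fun q => emb (some (Sum.inr ⟨x, q⟩))) exit
      (fun q => hM (some (Sum.inr ⟨x, q⟩))) (some x)
    refine ⟨v', ?_⟩
    rw [Nat.add_comm T 1]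
    refine StepsTo.trans (StepsTo.single ((step_pos (hM none) v _).trans ?_)) hv
    simp only [code, TM2.stepAux, toStk_ofNat hN.1]
    rw [update_toStk hN.1, hk]
    rfl
  | @seq p q s s' s'' T T' _ _ ih₁ ih₂ =>
    simp only [bound, max_le_iff] at hN
    obtain ⟨v', hv⟩ := ih₁ hN.1 (fun r => emb (Sum.inl r)) (emb (Sum.inr (entry q)))
      (fun r => hM (Sum.inl r)) v
    obtain ⟨v'', hv'⟩ := ih₂ hN.2 (fun r => emb (Sum.inr r)) exit (fun r => hM (Sum.inr r)) v'
    exact ⟨v'', hv.trans hv'⟩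
  | @loop_nil k p s hk =>
    simp only [bound, max_le_iff] at hN
    refine ⟨none, StepsTo.single ((step_pos (hM none) v _).trans ?_)⟩
    simp only [code, TM2.stepAux, toStk_ofNat hN.1]
    rw [update_toStk hN.1, update_tail_of_nil hk, hk]
    rfl
  | @loop_cons k p s s' s'' T T' x l hk _ _ ih₁ ih₂ =>
    have hN' := hN
    simp only [bound, max_le_iff, Finset.sup_le_iff] at hN'
    obtain ⟨v', hv⟩ := ih₁ (hN'.2 x (Finset.mem_univ _)) (fun q => emb (some ⟨x, q⟩)) (emb none)
      (fun q => hM (some ⟨x, q⟩)) (some x)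
    obtain ⟨v'', hv'⟩ := ih₂ hN emb exit hM v'
    refine ⟨v'', ?_⟩
    rw [Nat.add_comm (T + T') 1, ← Nat.add_assoc]
    refine (StepsTo.trans (StepsTo.single ((step_pos (hM none) v _).trans ?_)) hv).trans hv'
    simp only [code, TM2.stepAux, toStk_ofNat hN'.1]
    rw [update_toStk hN'.1, hk]
    rfl

instance (p : Prog) : Finite (Pos p) := finite_pos p

/-- The machine that runs a program with the input on stack `0` and outputs whether stack `1`
has `some true` on top in the end. -/
noncomputable def machine (p : Prog) : FinTM2 :=
  letI : Fintype (Pos p) := Fintype.ofFinite _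
  -- The bound is raised by one so that stack 1, from which the verdict is read, exists even if the
  -- program never mentions it.
  { K := Option (Fin (bound p + 1 + 1))
    k₀ := some 0
    k₁ := none
    Γ := Alph (bound p + 1)
    Λ := Option (Pos p)
    main := some (entry p)
    σ := Option Sym
    initialState := none
    Γk₀Fin := inferInstanceAs (Fintype Sym)
    m := fun l => match l with
      | some q => code (bound p + 1) p some none q
      | none => .pop (some 1) (fun _ h => h)
          (.push none (fun v => decide (v = some (some true))) .halt) }

/-- The machine that runs a program, with its alphabets. -/
noncomputable def decider (p : Prog) : TM2ComputableAux (Option Bool) Bool where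
  tm := machine p
  inputAlphabet := Equiv.refl _
  outputAlphabet := Equiv.refl _

theorem output_stk (N : ℕ) (Λ : Type) (s : ℕ → Str) (v : Option Sym) :
    (TM2.stepAux (.pop (some 1) (fun _ h => h) (.push none
      (fun v => decide (v = some (some true))) .halt) : TM2.Stmt (Alph (N + 1)) Λ (Option Sym)) v
      (toStk (N + 1) s)).stk none = [decide ((s 1).head? = some (some true))] := by
  simp only [TM2.stepAux, update_self]
  rfl

/-- The additional step is the final label, which pops stack 1 and writes the verdict on the output
stack. -/
theorem haltsWithin_decider {p : Prog} {inp : Str} {s' : ℕ → Str} {T : ℕ}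
    (h : Run p (update (fun _ => []) 0 inp) s' T) :
    HaltsWithin (decider p).tm (initList (decider p).tm (inp.map (decider p).inputAlphabet.symm))
      [(decider p).outputAlphabet.symm (decide ((s' 1).head? = some (some true)))] (T + 1) := by
  obtain ⟨v, hv⟩ := steps_of_run (bound p + 1) h (Nat.le_succ _) (machine p).m some none
    (fun _ => rfl) none
  have hinit : initList (decider p).tm (inp.map (decider p).inputAlphabet.symm) =
      (⟨some (some (entry p)), none, toStk (bound p + 1) (update (fun _ => []) 0 inp)⟩ :
        TM2.Cfg (Alph (bound p + 1)) (Option (Pos p)) (Option Sym)) := by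
    unfold initList
    congr 1
    funext k
    match k with
    | none => rfl
    | some i =>
      by_cases hi : i = 0
      · subst hi
        refine (dif_pos rfl).trans ?_
        exact List.map_id _
      · refine (dif_neg (fun h => hi (Option.some.inj h))).trans ?_
        have : (i : ℕ) ≠ 0 := fun h => hi (Fin.ext h)
        simp [toStk, this]
        rfl
  rw [hinit]
  have hlast := hv.trans (StepsTo.single (step_pos (M := (machine p).m) (l := none) rfl v _))
  refine ⟨_, ?_, ?_, ⟨⟨⟨T + 1, hlast⟩, le_rfl⟩⟩⟩
  · rfl
  · exact output_stk (bound p) (Option (Pos p)) s' v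

end Prog

/-! ### Polynomial-time string functions -/

theorem eval_mono (P : Polynomial ℕ) {a b : ℕ} (h : a ≤ b) : P.eval a ≤ P.eval b := by
  induction P using Polynomial.induction_on' with
  | add p q hp hq => simpa using Nat.add_le_add hp hq
  | monomial n c => simpa using Nat.mul_le_mul_left c (Nat.pow_le_pow_left h n)

theorem update_of_nil {s : ℕ → Str} {o : ℕ} (h : s o = []) : update s o [] = s := by
  rw [← h, update_eq_self]

namespace Prog

/-- Each unit of time pushes at most one symbol. This turns time bounds into length bounds, so the
sizes of intermediate results never have to be tracked separately. -/
theorem Run.length_le {p : Prog} {s s' : ℕ → Str} {T : ℕ} (h : Run p s s' T) (j : ℕ) :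
    (s' j).length ≤ (s j).length + T := by
  have hup : ∀ (s : ℕ → Str) k x l, s k = x :: l →
      (update s k l j).length ≤ (s j).length := by
    intro s k x l hk
    by_cases hj : j = k
    · subst hj; simp [hk]
    · simp [hj]
  induction h with
  | skip s => omega
  | push k x s =>
    by_cases hj : j = k
    · subst hj; simp
    · simp [hj]
  | case_nil hk _ ih => omega
  | case_cons hk _ ih => have := hup _ _ _ _ hk; omega
  | seq _ _ ih₁ ih₂ => omega
  | loop_nil hk => omega
  | loop_cons hk _ _ ih₁ ih₂ => have := hup _ _ _ _ hk; omega

/-- Empties stack `k`. -/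
def clear (k : ℕ) : Prog := .loop k fun _ => .skip

/-- Moves the content of stack `k` to stack `k'`, reversing it. -/
def move (k k' : ℕ) : Prog := .loop k fun x => .push k' x

/-- Moves the content of stack `k` to the stacks `k'` and `k''`, reversing it. -/
def fork (k k' k'' : ℕ) : Prog := .loop k fun x => .seq (.push k' x) (.push k'' x)

theorem Run.congr {p : Prog} {s s' s'' : ℕ → Str} {T T' : ℕ} (h : Run p s s' T) (hs : s' = s'')
    (hT : T = T') : Run p s s'' T' := hs ▸ hT ▸ h

theorem run_clear (k : ℕ) (s : ℕ → Str) :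
    Run (clear k) s (update s k []) (2 * (s k).length + 1) := by
  generalize hl : s k = l
  induction l generalizing s with
  | nil => exact (Run.loop_nil hl).congr (by rw [← hl, update_eq_self]) rfl
  | cons x l ih =>
    exact (Run.loop_cons hl (.skip _) (ih (update s k l) (by simp))).congr (by simp)
      (by simp; ring)

theorem run_move {k k' : ℕ} (hk : k ≠ k') (s : ℕ → Str) :
    Run (move k k') s (update (update s k []) k' ((s k).reverse ++ s k'))
      (2 * (s k).length + 1) := by
  generalize hl : s k = l
  induction l generalizing s with
  | nil => exact (Run.loop_nil hl).congr (by rw [update_of_nil hl]; simp) rfl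
  | cons x l ih =>
    refine (Run.loop_cons hl (.push _ _ _) (ih _ (by simp [hk]))).congr ?_
      (by simp; ring)
    funext j
    simp only [update_apply, List.reverse_cons, List.append_assoc, List.singleton_append]
    grind

theorem run_fork {k k' k'' : ℕ} (hk : k ≠ k') (hk' : k ≠ k'') (hk'' : k' ≠ k'') (s : ℕ → Str) :
    Run (fork k k' k'') s (update (update (update s k []) k' ((s k).reverse ++ s k')) k''
      ((s k).reverse ++ s k'')) (3 * (s k).length + 1) := by
  generalize hl : s k = l
  induction l generalizing s with
  | nil => exact (Run.loop_nil hl).congr (by rw [update_of_nil hl]; simp) rfl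
  | cons x l ih =>
    refine (Run.loop_cons hl (.seq (.push _ _ _) (.push _ _ _)) (ih _ (by simp [hk, hk']))).congr ?_
      (by simp; ring)
    funext j
    simp only [update_apply, List.reverse_cons, List.append_assoc, List.singleton_append]
    grind

end Prog

open Prog

/-- `f` is computed by stack programs in polynomial time: a program finds the arguments on any
given stacks `a i` below `b`, leaves them unchanged, and puts the value on any given other stack
`o` below `b`; it uses the stacks from `b` on as work space and leaves them empty. -/
def PT {m : ℕ} (f : (Fin m → Str) → Str) : Prop :=
  ∀ (a : Fin m → ℕ) (o b : ℕ), (∀ i, a i < b) → o < b → (∀ i, a i ≠ o) →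
    ∃ (p : Prog) (P : Polynomial ℕ), ∀ s : ℕ → Str, s o = [] → (∀ k, b ≤ k → s k = []) →
      ∃ T, Run p s (update s o (f fun i => s (a i))) T ∧ T ≤ P.eval (∑ i, (s (a i)).length)

namespace PT

variable {m : ℕ}

/-- The value is written within the running time on a stack that was empty. Under composition this
bounds the lengths of the arguments of the outer function. -/
theorem length_le {f : (Fin m → Str) → Str} (hf : PT f) :
    ∃ P : Polynomial ℕ, ∀ v, (f v).length ≤ P.eval (∑ i, (v i).length) := by
  obtain ⟨p, P, h⟩ := hf (fun i => i) m (m + 1) (fun i => by omega) (by omega) (fun i => by omega)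
  refine ⟨P, fun v => ?_⟩
  obtain ⟨T, hT, hT'⟩ := h (fun k => if h : k < m then v ⟨k, h⟩ else []) (by simp)
    (fun k hk => by simp; omega)
  have := hT.length_le m
  simp only [Fin.is_lt, ↓reduceDIte, Fin.eta, update_self, lt_self_iff_false, List.length_nil,
    zero_add] at this hT'
  exact this.trans hT'

theorem nil : PT (fun _ : Fin m → Str => []) := fun a o b _ _ _ =>
  ⟨.skip, 1, fun s ho _ => ⟨1, (Run.skip s).congr (update_of_nil ho).symm rfl, by simp⟩⟩

theorem cons (x : Sym) {f : (Fin m → Str) → Str} (hf : PT f) : PT fun v => x :: f v := by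
  intro a o b ha ho hao
  obtain ⟨p, P, h⟩ := hf a o b ha ho hao
  refine ⟨.seq p (.push o x), P + 1, fun s hs hb => ?_⟩
  obtain ⟨T, hT, hT'⟩ := h s hs hb
  exact ⟨_, (hT.seq (.push _ _ _)).congr (by simp) rfl, by simpa using hT'⟩

theorem const (l : Str) : PT (fun _ : Fin m → Str => l) := by
  induction l with
  | nil => exact nil
  | cons x l ih => exact ih.cons x

theorem tail {f : (Fin m → Str) → Str} (hf : PT f) : PT fun v => (f v).tail := by
  intro a o b ha ho hao
  obtain ⟨p, P, h⟩ := hf a o b ha ho hao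
  refine ⟨.seq p (.case o .skip fun _ => .skip), P + 2, fun s hs hb => ?_⟩
  obtain ⟨T, hT, hT'⟩ := h s hs hb
  refine ⟨_, hT.seq (T' := 2) ?_, by simpa using hT'⟩
  cases hv : f fun i => s (a i) with
  | nil => exact (Run.case_nil (by simp) (.skip _)).congr (by simp [hv]) rfl
  | cons x l => exact (Run.case_cons (x := x) (l := l) (by simp) (.skip _)).congr (by simp [hv]) rfl

theorem proj (i : Fin m) : PT fun v => v i := by
  intro a o b ha ho hao
  -- The detour over the scratch stack reverses the string twice, so the argument is restored and
  -- the copy has the right order.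
  refine ⟨.seq (move (a i) b) (fork b (a i) o), 5 * Polynomial.X + 2, fun s hs hb => ?_⟩
  have h1 : a i ≠ b := (ha i).ne
  have h2 : a i ≠ o := hao i
  have h3 : o ≠ b := ho.ne
  refine ⟨_, ((run_move h1 s).seq (run_fork h1.symm h3.symm h2 _)).congr ?_ rfl, ?_⟩
  · funext j
    simp only [update_apply, hb b le_rfl, List.append_nil]
    grind
  · have := Finset.single_le_sum (f := fun i => (s (a i)).length) (fun _ _ => Nat.zero_le _)
      (Finset.mem_univ i)
    simp [hb b le_rfl] at this ⊢
    omega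

/-- Case distinction on the first symbol of a string. -/
def _root_.IntroLines.caseHead {α : Type} (l : Str) (e : α) (h : Sym → α) : α :=
  match l with
  | [] => e
  | x :: _ => h x

theorem caseHead {g e : (Fin m → Str) → Str} {h : Sym → (Fin m → Str) → Str} (hg : PT g)
    (he : PT e) (hh : ∀ x, PT (h x)) :
    PT fun v => IntroLines.caseHead (g v) (e v) fun x => h x v := by
  intro a o b ha ho hao
  have ha' : ∀ i, a i < b + 1 := fun i => (ha i).trans (Nat.lt_succ_self _)
  obtain ⟨pg, Pg, hpg⟩ := hg a b (b + 1) ha' (by omega) (fun i => (ha i).ne)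
  obtain ⟨pe, Pe, hpe⟩ := he a o b ha ho hao
  choose ph Ph hph using fun x => hh x a o b ha ho hao
  -- The string that decides the case sits on stack b, which belongs to the work space of the
  -- branches; what is left of it is cleared before a branch runs.
  refine ⟨.seq pg (.case b pe fun x => .seq (clear b) (ph x)),
    Pg + (2 * Pg + 2 + Pe + ∑ x, Ph x), fun s hs hb => ?_⟩
  obtain ⟨T, hT, hT'⟩ := hpg s (hb b le_rfl) (fun k hk => hb k (by omega))
  have hlen : (g fun i => s (a i)).length ≤ T := by
    simpa [hb b le_rfl] using hT.length_le b
  cases hv : g fun i => s (a i) with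
  | nil =>
    rw [hv, update_of_nil (hb b le_rfl)] at hT
    obtain ⟨T₂, hT₂, hT₂'⟩ := hpe s hs hb
    refine ⟨_, (hT.seq (.case_nil (hb b le_rfl) hT₂)).congr (by simp only [hv]; rfl) rfl, ?_⟩
    simp only [Polynomial.eval_add, Polynomial.eval_mul, Polynomial.eval_ofNat,
      Polynomial.eval_finsetSum]
    omega
  | cons x l =>
    obtain ⟨T₂, hT₂, hT₂'⟩ := hph x s hs hb
    have hx : (Ph x).eval (∑ i, (s (a i)).length) ≤ ∑ x, (Ph x).eval (∑ i, (s (a i)).length) :=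
      Finset.single_le_sum (f := fun x => (Ph x).eval (∑ i, (s (a i)).length))
        (fun _ _ => Nat.zero_le _) (Finset.mem_univ x)
    rw [hv] at hT hlen
    have hT₂'' : Run (ph x) (update (update (update s b (x :: l)) b l) b [])
        (update s o (h x fun i => s (a i))) T₂ := by
      simpa [update_of_nil (hb b le_rfl)] using hT₂
    refine ⟨_, (hT.seq (.case_cons (x := x) (l := l) (by simp)
      (.seq (run_clear b _) hT₂''))).congr (by simp only [hv]; rfl) rfl, ?_⟩
    · simp only [Polynomial.eval_add, Polynomial.eval_mul, Polynomial.eval_ofNat,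
        Polynomial.eval_finsetSum, update_self]
      simp only [List.length_cons] at hlen
      omega

/-- Clears the `r` stacks from `c` on. -/
def _root_.IntroLines.Prog.clearMany (c : ℕ) : ℕ → Prog
  | 0 => .skip
  | r + 1 => .seq (clearMany c r) (clear (c + r))

theorem _root_.IntroLines.Prog.run_clearMany (c r : ℕ) (s : ℕ → Str) :
    Run (clearMany c r) s (fun k => if c ≤ k ∧ k < c + r then [] else s k)
      (2 * ∑ i : Fin r, (s (c + i)).length + r + 1) := by
  induction r with
  | zero => exact (Run.skip s).congr (by funext k; grind) rfl
  | succ r ih =>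
    refine (ih.seq (run_clear (c + r) _)).congr ?_ ?_
    · funext k
      simp only [update_apply]
      grind
    · rw [Fin.sum_univ_castSucc]
      simp
      ring

/-- Prepares composition: the values are computed one after the other on consecutive stacks, each
with its work space above its own value, so that earlier values survive. -/
theorem many {r : ℕ} (g : Fin r → (Fin m → Str) → Str) (hg : ∀ j, PT (g j)) (a : Fin m → ℕ)
    (c : ℕ) (ha : ∀ i, a i < c) :
    ∃ (p : Prog) (P : Polynomial ℕ), ∀ s : ℕ → Str, (∀ k, c ≤ k → s k = []) →
      ∃ T, Run p s (fun k => if h : c ≤ k ∧ k < c + r then g ⟨k - c, by omega⟩ fun i => s (a i)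
        else s k) T ∧ T ≤ P.eval (∑ i, (s (a i)).length) := by
  induction r with
  | zero =>
    refine ⟨.skip, 1, fun s hs => ⟨1, (Run.skip s).congr ?_ rfl, by simp⟩⟩
    funext k
    rw [dif_neg (by omega)]
  | succ r ih =>
    obtain ⟨p, P, hp⟩ := ih (fun j => g j.castSucc) (fun j => hg _)
    obtain ⟨q, Q, hq⟩ := hg (Fin.last r) a (c + r) (c + r + 1) (fun i => by have := ha i; omega)
      (by omega) (fun i => by have := ha i; omega)
    refine ⟨.seq p q, P + Q, fun s hs => ?_⟩
    obtain ⟨T, hT, hT'⟩ := hp s hs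
    obtain ⟨T₂, hT₂, hT₂'⟩ := hq (fun k => if h : c ≤ k ∧ k < c + r then
      g (Fin.castSucc ⟨k - c, by omega⟩) fun i => s (a i) else s k)
      (by rw [dif_neg (by omega)]; exact hs _ (by omega))
      (fun k hk => by rw [dif_neg (by omega)]; exact hs _ (by omega))
    have hsa : (fun i => (if h : c ≤ a i ∧ a i < c + r then
      g (Fin.castSucc ⟨a i - c, by omega⟩) fun i => s (a i) else s (a i))) = fun i => s (a i) := by
      funext i
      rw [dif_neg (by have := ha i; omega)]
    have hsa' := fun i => congrFun hsa i
    simp only [hsa'] at hT₂ hT₂'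
    refine ⟨_, (hT.seq hT₂).congr ?_ rfl, by simp; omega⟩
    funext k
    simp only [update_apply]
    by_cases hk : k = c + r
    · subst hk
      rw [if_pos rfl, dif_pos (by omega)]
      congr 1
      ext
      simp
    · rw [if_neg hk]
      by_cases hk' : c ≤ k ∧ k < c + r
      · rw [dif_pos hk', dif_pos (by omega)]
        rfl
      · rw [dif_neg hk', dif_neg (by omega)]

/-- The inner values go on k scratch stacks, the outer program runs on them, and the scratch stacks
are cleared. Its time is polynomial in the lengths of the inner values, and these are polynomial in
the input by `length_le`. -/
theorem comp {k : ℕ} {f : (Fin k → Str) → Str} (hf : PT f) {g : Fin k → (Fin m → Str) → Str}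
    (hg : ∀ j, PT (g j)) : PT fun v => f fun j => g j v := by
  intro a o b ha ho hao
  obtain ⟨p, P, hp⟩ := many g hg a b ha
  obtain ⟨q, Q, hq⟩ := hf (fun j => b + j) o (b + k) (fun i => by omega) (by omega)
    (fun i => by omega)
  choose R hR using fun j => (hg j).length_le
  refine ⟨.seq p (.seq q (clearMany b k)),
    P + (Q.comp (∑ j, R j) + (2 * ∑ j, R j + (k : Polynomial ℕ) + 1)), fun s hs hb => ?_⟩
  obtain ⟨T, hT, hT'⟩ := hp s hb
  obtain ⟨T₂, hT₂, hT₂'⟩ := hq (fun j => if h : b ≤ j ∧ j < b + k then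
    g ⟨j - b, by omega⟩ fun i => s (a i) else s j)
    (by rw [dif_neg (by omega)]; exact hs)
    (fun j hj => by rw [dif_neg (by omega)]; exact hb _ (by omega))
  have hsa : ∀ j : Fin k, (if h : b ≤ b + (j : ℕ) ∧ b + (j : ℕ) < b + k then
      g ⟨b + (j : ℕ) - b, by omega⟩ fun i => s (a i) else s (b + j)) = g j fun i => s (a i) := by
    intro j
    rw [dif_pos (by omega)]
    congr 1
    ext
    simp
  simp only [hsa] at hT₂ hT₂'
  have hlen : ∑ j, (g j fun i => s (a i)).length ≤ (∑ j, R j).eval (∑ i, (s (a i)).length) := by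
    rw [Polynomial.eval_finsetSum]
    exact Finset.sum_le_sum fun j _ => hR j _
  refine ⟨_, (hT.seq (hT₂.seq (run_clearMany b k _))).congr ?_ rfl, ?_⟩
  · funext j
    simp only [update_apply]
    by_cases hj : b ≤ j ∧ j < b + k
    · rw [if_pos hj, if_neg (by omega), hb j hj.1]
    · rw [if_neg hj, dif_neg hj]
  · have h1 : ∀ j : Fin k, update (fun j => if h : b ≤ j ∧ j < b + k then
        g ⟨j - b, by omega⟩ fun i => s (a i) else s j) o (f fun j => g j fun i => s (a i)) (b + j)
        = g j fun i => s (a i) := by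
      intro j
      rw [update_of_ne (by omega)]
      exact hsa j
    simp only [h1, Polynomial.eval_add, Polynomial.eval_mul, Polynomial.eval_comp,
      Polynomial.eval_ofNat, Polynomial.eval_natCast, Polynomial.eval_one]
    have := hT₂'.trans (eval_mono Q hlen)
    simp only [Nat.cast_id]
    omega

/-- A left fold over a string, whose intermediate values have polynomially bounded length. -/
theorem foldl {l init : (Fin m → Str) → Str} {step : Sym → Str → (Fin m → Str) → Str}
    (hl : PT l) (hi : PT init)
    (hs : ∀ x, PT fun w : Fin (m + 1) → Str => step x (w 0) fun i => w i.succ)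
    (hb : ∃ P : Polynomial ℕ, ∀ v l', l' <+: l v →
      (l'.foldl (fun acc x => step x acc v) (init v)).length ≤ P.eval (∑ i, (v i).length)) :
    PT fun v => (l v).foldl (fun acc x => step x acc v) (init v) := by
  intro a o b ha ho hao
  have ha' : ∀ j, ∀ i, a i < b + j := fun j i => (ha i).trans_le (Nat.le_add_right _ _)
  obtain ⟨pl, Pl, hpl⟩ := hl a b (b + 1) (ha' 1) (by omega) (fun i => (ha i).ne)
  obtain ⟨pi, Pi, hpi⟩ := hi a (b + 1) (b + 2) (ha' 2) (by omega) (fun i => (ha' 1 i).ne)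
  choose ps Ps hps using fun x => hs x (Fin.cons (b + 1) a) (b + 2) (b + 3)
    (Fin.cases (by simp) (fun i => by simpa using ha' 3 i)) (by omega)
    (Fin.cases (by simp) (fun i => by simpa using (ha' 2 i).ne))
  obtain ⟨B, hB⟩ := hb
  obtain ⟨L, hL⟩ := hl.length_le
  -- Stack b holds the rest of the string, b + 1 the accumulator, b + 2 its new value, and b + 3 is
  -- a buffer: moving through it reverses twice, which preserves the order.
  let body : Sym → Prog := fun x =>
    .seq (ps x) (.seq (clear (b + 1)) (.seq (move (b + 2) (b + 3)) (move (b + 3) (b + 1))))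
  -- The time of one pass: the step function, on an accumulator of length at most `B`, then one
  -- clearing and two moves at 2 `B` + 1 each, and one unit for the loop. Summing over the symbols
  -- covers whichever step is taken.
  let Q : Polynomial ℕ := ∑ x, (Ps x).comp (B + Polynomial.X) + 6 * B + 4
  have hloop : ∀ (s : ℕ → Str), s o = [] → (∀ k, b ≤ k → s k = []) →
      ∀ (l₁ : Str) (acc : Str),
        (∀ l', l' <+: l₁ → (l'.foldl (fun acc x => step x acc fun i => s (a i)) acc).length ≤
          B.eval (∑ i, (s (a i)).length)) →
        ∃ T, Run (.loop b body) (update (update s b l₁) (b + 1) acc)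
          (update s (b + 1) (l₁.foldl (fun acc x => step x acc fun i => s (a i)) acc)) T ∧
          T ≤ l₁.length * Q.eval (∑ i, (s (a i)).length) + 1 := by
    intro s hs hb l₁
    induction l₁ with
    | nil =>
      intro acc _
      refine ⟨1, (Run.loop_nil (by simp)).congr ?_ rfl, by simp⟩
      rw [update_of_nil (hb b le_rfl)]
      rfl
    | cons x l₁ ih =>
      intro acc hacc
      have h0 := hacc [] List.nil_prefix
      have h1 := hacc [x] (by simp)
      simp only [List.foldl_nil, List.foldl_cons] at h0 h1
      obtain ⟨T, hT, hT'⟩ := ih (step x acc fun i => s (a i)) (fun l' hl' => by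
        have := hacc (x :: l') (by simpa using hl')
        simpa using this)
      obtain ⟨T₂, hT₂, hT₂'⟩ := hps x (update (update s b l₁) (b + 1) acc)
        (by simp [hb]) (fun k hk => by
          rw [update_of_ne (by omega), update_of_ne (by omega)]; exact hb k (by omega))
      have hsa : ∀ i, update (update s b l₁) (b + 1) acc (a i) = s (a i) := by
        intro i
        have := ha i
        rw [update_of_ne (by omega), update_of_ne (by omega)]
      simp only [Fin.cons_zero, Fin.cons_succ, hsa, update_self, Fin.sum_univ_succ] at hT₂ hT₂'
      have hbody := hT₂.seq ((run_clear (b + 1) _).seq ((run_move (k := b + 2) (k' := b + 3)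
        (by omega) _).seq (run_move (k := b + 3) (k' := b + 1) (by omega) _)))
      refine ⟨_, Run.loop_cons (x := x) (l := l₁) (T := T₂ + ((2 * acc.length + 1) +
        ((2 * (step x acc fun i => s (a i)).length + 1) +
          (2 * (step x acc fun i => s (a i)).length + 1)))) (by simp) ?_ hT, ?_⟩
      · have hst : update (update (update s b (x :: l₁)) (b + 1) acc) b l₁
            = update (update s b l₁) (b + 1) acc := by
          funext j; simp only [update_apply]; grind
        rw [hst]
        refine hbody.congr ?_ ?_
        · have e2 := hb (b + 2) (by omega)
          have e3 := hb (b + 3) (by omega)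
          funext j
          simp only [update_apply]
          by_cases j1 : j = b + 1
          · subst j1; simp [e3]
          · by_cases j2 : j = b + 2
            · subst j2; simp [e2]
            · by_cases j3 : j = b + 3
              · subst j3; simp [e3]
              · simp [j1, j2, j3]
        · have e3 := hb (b + 3) (by omega)
          simp [e3]
      · have hx : (Ps x).eval (acc.length + ∑ i, (s (a i)).length) ≤
            ∑ x, ((Ps x).comp (B + Polynomial.X)).eval (∑ i, (s (a i)).length) := by
          refine le_trans ?_ (Finset.single_le_sum
            (f := fun x => ((Ps x).comp (B + Polynomial.X)).eval (∑ i, (s (a i)).length))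
            (fun _ _ => Nat.zero_le _) (Finset.mem_univ x))
          simp only [Polynomial.eval_comp, Polynomial.eval_add, Polynomial.eval_X]
          exact eval_mono _ (by omega)
        have hQ : Q.eval (∑ i, (s (a i)).length) =
            ∑ x, ((Ps x).comp (B + Polynomial.X)).eval (∑ i, (s (a i)).length) +
              6 * B.eval (∑ i, (s (a i)).length) + 4 := by
          simp [Q]
        rw [List.length_cons, Nat.add_mul, one_mul]
        omega
  -- The result is moved to the output stack via b + 2, again so that two reversals cancel.
  refine ⟨.seq pl (.seq pi (.seq (.loop b body) (.seq (move (b + 1) (b + 2)) (move (b + 2) o)))),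
    Pl + Pi + L * Q + 4 * B + 10, fun s hs hbs => ?_⟩
  obtain ⟨T₁, hT₁, hT₁'⟩ := hpl s (hbs b le_rfl) (fun k hk => hbs k (by omega))
  obtain ⟨T₂, hT₂, hT₂'⟩ := hpi (update s b (l fun i => s (a i)))
    (by simp [hbs]) (fun k hk => by rw [update_of_ne (by omega)]; exact hbs k (by omega))
  have hsa : ∀ i, update s b (l fun i => s (a i)) (a i) = s (a i) := by
    intro i
    rw [update_of_ne (ha i).ne]
  simp only [hsa] at hT₂ hT₂'
  obtain ⟨T₃, hT₃, hT₃'⟩ := hloop s hs hbs (l fun i => s (a i)) (init fun i => s (a i))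
    (hB _)
  have hfin := hB (fun i => s (a i)) _ List.prefix_rfl
  have hlen := hL fun i => s (a i)
  refine ⟨_, (hT₁.seq (hT₂.seq (hT₃.seq ((run_move (k := b + 1) (k' := b + 2) (by omega) _).seq
    (run_move (k := b + 2) (k' := o) (by omega) _))))).congr ?_ rfl, ?_⟩
  · have e1 := hbs (b + 1) (by omega)
    have e2 := hbs (b + 2) (by omega)
    funext j
    simp only [update_apply]
    by_cases j1 : j = b + 1
    · subst j1; simp [e1, show b + 1 ≠ o by omega]
    · by_cases j2 : j = b + 2
      · subst j2; simp [e2, show b + 2 ≠ o by omega]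
      · by_cases j3 : j = o
        · subst j3; simp [e2, hs, j1, j2]
        · simp [j1, j2, j3]
  · have e2 := hbs (b + 2) (by omega)
    simp only [update_self, Polynomial.eval_add, Polynomial.eval_mul, Polynomial.eval_ofNat]
    rw [update_of_ne (by omega), e2]
    simp only [List.append_nil, List.length_reverse]
    have := Nat.mul_le_mul_right (Q.eval (∑ i, (s (a i)).length)) hlen
    omega

end PT

namespace PT

variable {m : ℕ}

/-- In a fold the accumulator is argument 0 of the step function; this lets parameters that do not
involve it be used there. -/
theorem shift {f : (Fin m → Str) → Str} (hf : PT f) :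
    PT fun w : Fin (m + 1) → Str => f fun i => w i.succ :=
  hf.comp fun j => proj j.succ

/-- A left fold each of whose steps lengthens the string by a bounded amount. -/
theorem foldl_add {l init g : (Fin m → Str) → Str} {step : Sym → Str → (Fin m → Str) → Str}
    (hl : PT l) (hi : PT init) (hg : PT g)
    (hs : ∀ x, PT fun w : Fin (m + 1) → Str => step x (w 0) fun i => w i.succ)
    (hb : ∀ x acc v, (step x acc v).length ≤ acc.length + (g v).length) :
    PT fun v => (l v).foldl (fun acc x => step x acc v) (init v) := by
  obtain ⟨L, hL⟩ := hl.length_le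
  obtain ⟨I, hI⟩ := hi.length_le
  obtain ⟨G, hG⟩ := hg.length_le
  refine foldl hl hi hs ⟨I + L * G, fun v l' hl' => ?_⟩
  have key : ∀ (l' : Str) (acc : Str), (l'.foldl (fun acc x => step x acc v) acc).length ≤
      acc.length + l'.length * (g v).length := by
    intro l'
    induction l' with
    | nil => simp
    | cons x l' ih =>
      intro acc
      have h1 := ih (step x acc v)
      have h2 := hb x acc v
      rw [List.foldl_cons, List.length_cons, Nat.add_mul]
      omega
  refine (key l' _).trans ?_
  simp only [Polynomial.eval_add, Polynomial.eval_mul]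
  exact Nat.add_le_add (hI v) (Nat.mul_le_mul (hl'.length_le.trans (hL v)) (hG v))

end PT

/-! ### Operations on strings -/

/-- The string of a list of bits. -/
def ofBits (l : List Bool) : Str := l.map some

/-- The string of one bit. -/
def bit (b : Bool) : Str := [some b]

/-- `a` if the string `l` starts with `some true`, otherwise `b`. -/
def ifTrue (l a b : Str) : Str := caseHead l b fun x => if x = some true then a else b

@[simp] theorem ifTrue_bit (c : Bool) (a b : Str) : ifTrue (bit c) a b = if c then a else b := by
  cases c <;> rfl

/-- Conjunction. -/
def andS (a b : Str) : Str := ifTrue a b (bit false)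

/-- Disjunction. -/
def orS (a b : Str) : Str := ifTrue a (bit true) b

@[simp] theorem andS_bit (a b : Bool) : andS (bit a) (bit b) = bit (a && b) := by
  cases a <;> rfl

@[simp] theorem orS_bit (a b : Bool) : orS (bit a) (bit b) = bit (a || b) := by
  cases a <;> rfl

/-- Removes as many symbols from `x` as `c` has. -/
def dropS (c x : Str) : Str := c.foldl (fun acc _ => acc.tail) x

@[simp] theorem dropS_eq (c x : Str) : dropS c x = x.drop c.length := by
  unfold dropS
  induction c generalizing x with
  | nil => simp
  | cons y c ih => simp [ih]

/-- The reversed string. -/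
def revS (x : Str) : Str := x.foldl (fun acc y => y :: acc) []

@[simp] theorem revS_eq (x : Str) : revS x = x.reverse := by
  simp [revS]

/-- Concatenation. -/
def appS (x y : Str) : Str := (revS x).foldl (fun acc y => y :: acc) y

@[simp] theorem appS_eq (x y : Str) : appS x y = x ++ y := by
  simp [appS]

/-- The first `|c|` symbols of `x`. -/
def takeS (c x : Str) : Str := revS (dropS (dropS c x) (revS x))

@[simp] theorem takeS_eq (c x : Str) : takeS c x = x.take c.length := by
  simp only [takeS, revS_eq, dropS_eq, List.length_drop, List.drop_reverse, List.reverse_reverse]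
  rcases le_total c.length x.length with h | h
  · congr 1; omega
  · rw [List.take_of_length_le h, List.take_of_length_le (by omega)]

/-- As many zeros as `c` has symbols. -/
def zerosS (c : Str) : Str := c.foldl (fun acc _ => some false :: acc) []

@[simp] theorem zerosS_eq (c : Str) : zerosS c = ofBits (List.replicate c.length false) := by
  simp [zerosS, ofBits]

/-- A string whose length is the product of the lengths of `c` and `x`. -/
def timesS (c x : Str) : Str := c.foldl (fun acc _ => appS x acc) []

@[simp] theorem length_timesS (c x : Str) : (timesS c x).length = c.length * x.length := by
  unfold timesS
  simp

/-- The test whether two strings are equal. -/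
def eqS (x y : Str) : Str :=
  -- The accumulator is a flag followed by the unread part of `y`. After a mismatch it is `bit
  -- false` for good; at the end the strings agree if the flag is still set and nothing of `y`
  -- remains.
  let r := x.foldl (fun acc a => ifTrue acc
    (caseHead acc.tail (bit false) fun b => if b = a then some true :: acc.tail.tail else bit false)
      (bit false)) (some true :: y)
  ifTrue r (caseHead r.tail (bit true) fun _ => bit false) (bit false)

@[simp] theorem eqS_eq (x y : Str) : eqS x y = bit (decide (x = y)) := by
  unfold eqS
  set step : Str → Sym → Str := fun acc a => ifTrue acc
    (caseHead acc.tail (bit false) fun b => if b = a then some true :: acc.tail.tail else bit false)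
      (bit false) with hstep
  have hff : ∀ x : Str, x.foldl step (bit false) = bit false := by
    intro x
    induction x with
    | nil => rfl
    | cons a x ih => exact ih
  induction x generalizing y with
  | nil => cases y <;> rfl
  | cons a x ih =>
    simp only [List.foldl_cons] at ih ⊢
    cases y with
    | nil =>
      have : step (some true :: []) a = bit false := rfl
      rw [this, hff]
      rfl
    | cons b y =>
      by_cases hab : b = a
      · subst hab
        have : step (some true :: b :: y) b = some true :: y := by
          simp [hstep, ifTrue, caseHead]
        rw [this, ih]
        simp
      · have : step (some true :: b :: y) a = bit false := by
          simp [hstep, ifTrue, caseHead, hab]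
        rw [this, hff]
        have : ¬ (a :: x = b :: y) := by simp [Ne.symm hab]
        simp [this, ifTrue, caseHead, bit]

/-- The exclusive or of two symbols. -/
def xorSym : Sym → Sym → Sym
  | some a, some b => some (a ^^ b)
  | _, _ => none

/-- The bitwise exclusive or of two strings of the same length. -/
def xorS (x y : Str) : Str :=
  x.foldl (fun acc a => caseHead acc (bit false) fun b => appS acc.tail [xorSym a b]) y

theorem length_xorS_le (x y : Str) : (xorS x y).length ≤ y.length + x.length := by
  unfold xorS
  induction x generalizing y with
  | nil => simp
  | cons a x ih =>
    rw [List.foldl_cons, List.length_cons]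
    refine (ih _).trans ?_
    cases y
    · simp [caseHead, bit, Nat.add_comm]
    · simp only [caseHead, appS_eq, List.tail_cons, List.length_append, List.length_cons,
        List.length_nil]
      omega

theorem xorS_ofBits {x y : List Bool} (h : x.length = y.length) :
    xorS (ofBits x) (ofBits y) = ofBits (List.zipWith xor x y) := by
  unfold xorS
  -- The accumulator is a queue: bits of `y` leave at the front and results `z` enter at the back,
  -- so the computed part has to be generalized.
  suffices h : ∀ z : Str, (ofBits x).foldl (fun acc a => caseHead acc (bit false) fun b =>
      appS acc.tail [xorSym a b]) (ofBits y ++ z) = z ++ ofBits (List.zipWith xor x y) by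
    simpa using h []
  induction x generalizing y with
  | nil =>
    rw [List.length_nil, eq_comm, List.length_eq_zero_iff] at h
    subst h
    simp [ofBits]
  | cons a x ih =>
    cases y with
    | nil => simp at h
    | cons b y =>
      intro z
      have h1 := ih (y := y) (by simpa using h) (z ++ [some (a ^^ b)])
      simp only [ofBits, List.map_cons, List.foldl_cons, List.cons_append, caseHead, List.tail_cons,
        xorSym, appS_eq, List.append_assoc, List.zipWith_cons_cons] at h1 ⊢
      rw [h1]
      simp

/-- The sum of those rows, of length `|t|` each, for which the corresponding bit of `y` is set. -/
def lcS (t y rows : Str) : Str :=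
  -- The first |t| symbols of the accumulator are the running sum and the rest are the unread rows;
  -- each bit of `y` consumes one row.
  takeS t (y.foldl (fun acc a => appS
    (if a = some true then xorS (takeS t acc) (takeS t (dropS t acc)) else takeS t acc)
    (dropS t (dropS t acc))) (appS (zerosS t) rows))

/-- The outer `takeS` gives this bound for arbitrary strings. The bounds on folds need it, as they
quantify over all accumulators and not only over meaningful ones. -/
theorem length_lcS_le (t y rows : Str) : (lcS t y rows).length ≤ t.length := by
  simp [lcS]

/-- Replaces the first `|n|` blocks `z` of length `|t|` by `f z`, and appends the result. -/
def mapS (n t : Str) (f : Str → Str) (w : Str) : Str :=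
  n.foldl (fun acc _ => appS (dropS t acc) (f (takeS t acc))) w

/-- The matrix of the multiplication by `x`. -/
def mulMatS (t T x : Str) : Str := lcS (timesS t t) x T

/-- The product of field elements. -/
def mulS (t T x y : Str) : Str := lcS t y (mulMatS t T x)

/-- The product of a scalar and a vector with `|n|` entries. -/
def smulS (n t T c w : Str) : Str := mapS n t (mulS t T c) w

/-- The dot product of two vectors with `|n|` entries. -/
def dotS (n t T v u : Str) : Str := lcS t v (mapS n t (mulMatS t T) u)

/-- The powers `c, c², …, c^|d|`. -/
def powersS (d t T c : Str) : Str :=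
  dropS t (d.foldl (fun acc _ =>
    appS (mulS t T c (takeS t acc)) (appS (dropS t acc) (takeS t acc))) c)

/-- The entry of `x` at the first position where `w` is nonzero, and `0` if `w = 0`. -/
def pivotS (n t w x : Str) : Str :=
  -- Leading zero blocks are stripped from `w`. An empty remainder means `w = 0`; otherwise the
  -- difference of the lengths of `w` and the remainder is the offset of the pivot, which is then
  -- used to read `x`.
  let r := n.foldl (fun acc _ => ifTrue (eqS (takeS t acc) (zerosS t)) (dropS t acc) acc) w
  caseHead r (zerosS t) fun _ => takeS t (dropS (dropS r w) x)

/-- The first of the strings that are separated by `none`. -/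
def fieldS (l : Str) : Str :=
  -- The field is collected in reverse. A separator `none` on top of the accumulator freezes it, so
  -- everything after the first separator is ignored.
  let r := l.foldl (fun acc a => caseHead acc [a] fun h => if h = none then acc else a :: acc) []
  caseHead r [] fun h => if h = none then revS r.tail else revS r

/-- What follows the first separator `none`. -/
def restS (l : Str) : Str := (dropS (fieldS l) l).tail

/-! ### Polynomial time of the string operations. -/

namespace PT

variable {m : ℕ} {a b c l n t w x y T d : (Fin m → Str) → Str}

theorem ite {P : Prop} [Decidable P] (ha : PT a) (hb : PT b) :
    PT fun v => if P then a v else b v := by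
  split_ifs <;> assumption

theorem ifTrue (hl : PT l) (ha : PT a) (hb : PT b) :
    PT fun v => ifTrue (l v) (a v) (b v) :=
  caseHead hl hb fun _ => ite ha hb

theorem bit (b : Bool) : PT fun _ : Fin m → Str => bit b := const _

theorem andS (ha : PT a) (hb : PT b) : PT fun v => andS (a v) (b v) := ha.ifTrue hb (bit _)

theorem orS (ha : PT a) (hb : PT b) : PT fun v => orS (a v) (b v) := ha.ifTrue (bit _) hb

theorem dropS (hc : PT c) (hx : PT x) : PT fun v => dropS (c v) (x v) :=
  foldl_add (step := fun _ acc _ => acc.tail) hc hx nil (fun _ => (proj 0).tail) (by simp)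

theorem revS (hx : PT x) : PT fun v => revS (x v) :=
  foldl_add (step := fun y acc _ => y :: acc) (g := fun _ => [none]) hx nil (const _)
    (fun _ => (proj 0).cons _) (by simp)

theorem appS (hx : PT x) (hy : PT y) : PT fun v => appS (x v) (y v) :=
  foldl_add (step := fun y acc _ => y :: acc) (g := fun _ => [none]) hx.revS hy (const _)
    (fun _ => (proj 0).cons _) (by simp)

theorem takeS (hc : PT c) (hx : PT x) : PT fun v => takeS (c v) (x v) :=
  ((hc.dropS hx).dropS hx.revS).revS

theorem zerosS (hc : PT c) : PT fun v => zerosS (c v) :=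
  foldl_add (step := fun _ acc _ => some false :: acc) (g := fun _ => [none]) hc nil (const _)
    (fun _ => (proj 0).cons _) (by simp)

theorem timesS (hc : PT c) (hx : PT x) : PT fun v => timesS (c v) (x v) :=
  foldl_add (step := fun _ acc v => IntroLines.appS (x v) acc) (g := x) hc nil hx
    (fun _ => hx.shift.appS (proj 0)) (by simp [Nat.add_comm])

theorem eqS (hx : PT x) (hy : PT y) : PT fun v => eqS (x v) (y v) := by
  have hr : PT fun v => (x v).foldl (fun acc a => IntroLines.ifTrue acc
      (IntroLines.caseHead acc.tail (IntroLines.bit false) fun b =>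
        if b = a then some true :: acc.tail.tail else IntroLines.bit false)
      (IntroLines.bit false)) (some true :: y v) := by
    refine foldl_add (step := fun a acc _ => IntroLines.ifTrue acc
      (IntroLines.caseHead acc.tail (IntroLines.bit false) fun b =>
        if b = a then some true :: acc.tail.tail else IntroLines.bit false)
      (IntroLines.bit false)) (g := fun _ => [none]) hx (hy.cons _) (const _) (fun a => ?_) ?_
    · exact (proj 0).ifTrue ((proj 0).tail.caseHead (bit _)
        fun _ => ite ((proj 0).tail.tail.cons _) (bit _)) (bit _)
    · intro x acc _
      rcases acc with _ | ⟨a, _ | ⟨b, acc⟩⟩ <;>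
        simp only [IntroLines.ifTrue, IntroLines.caseHead, IntroLines.bit, List.tail_cons] <;>
        (try split_ifs) <;> simp
  exact hr.ifTrue (hr.tail.caseHead (bit _) fun _ => bit _) (bit _)

theorem xorS (hx : PT x) (hy : PT y) : PT fun v => xorS (x v) (y v) := by
  refine foldl_add (step := fun a acc _ => IntroLines.caseHead acc (IntroLines.bit false) fun b =>
    IntroLines.appS acc.tail [xorSym a b]) (g := fun _ => [none]) hx hy (const _)
    (fun a => (proj 0).caseHead (bit _) fun _ => (proj 0).tail.appS (const _)) ?_
  intro x acc _
  cases acc <;> simp [IntroLines.caseHead, IntroLines.bit]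

theorem lcS (ht : PT t) (hx : PT x) (hy : PT y) : PT fun v => lcS (t v) (x v) (y v) := by
  refine ht.takeS (foldl_add (step := fun a acc v => IntroLines.appS
    (if a = some true then IntroLines.xorS (IntroLines.takeS (t v) acc)
      (IntroLines.takeS (t v) (IntroLines.dropS (t v) acc)) else IntroLines.takeS (t v) acc)
    (IntroLines.dropS (t v) (IntroLines.dropS (t v) acc))) (g := t)
    hx (ht.zerosS.appS hy) ht (fun a => ?_) ?_)
  · have ht' := ht.shift
    exact (ite ((ht'.takeS (proj 0)).xorS (ht'.takeS (ht'.dropS (proj 0))))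
      (ht'.takeS (proj 0))).appS (ht'.dropS (ht'.dropS (proj 0)))
  · intro a acc v
    have := length_xorS_le (IntroLines.takeS (t v) acc)
      (IntroLines.takeS (t v) (IntroLines.dropS (t v) acc))
    split_ifs <;> simp at this ⊢ <;> omega

theorem mapS {f : Str → (Fin m → Str) → Str} {g : (Fin m → Str) → Str} (hn : PT n) (ht : PT t)
    (hf : PT fun v : Fin (m + 1) → Str => f (v 0) fun i => v i.succ) (hw : PT w) (hg : PT g)
    (hb : ∀ x v, (f x v).length ≤ (g v).length) :
    PT fun v => mapS (n v) (t v) (fun x => f x v) (w v) := by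
  refine foldl_add (step := fun _ acc v => IntroLines.appS (IntroLines.dropS (t v) acc)
    (f (IntroLines.takeS (t v) acc) v)) hn hw hg (fun _ => ?_) ?_
  · have ht' := ht.shift
    refine (ht'.dropS (proj 0)).appS ?_
    exact hf.comp (g := Fin.cons (fun v => IntroLines.takeS (t fun i => v i.succ) (v 0))
      fun i v => v i.succ) (Fin.cases (ht'.takeS (proj 0)) fun i => proj _)
  · intro _ acc v
    have := hb (IntroLines.takeS (t v) acc) v
    simp at this ⊢
    omega

theorem mulMatS (ht : PT t) (hT : PT T) (hx : PT x) :
    PT fun v => mulMatS (t v) (T v) (x v) :=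
  (ht.timesS ht).lcS hx hT

theorem mulS (ht : PT t) (hT : PT T) (hx : PT x) (hy : PT y) :
    PT fun v => mulS (t v) (T v) (x v) (y v) :=
  ht.lcS hy (ht.mulMatS hT hx)

theorem smulS (hn : PT n) (ht : PT t) (hT : PT T) (hc : PT c) (hw : PT w) :
    PT fun v => smulS (n v) (t v) (T v) (c v) (w v) :=
  hn.mapS ht (f := fun x v => IntroLines.mulS (t v) (T v) (c v) x)
    (ht.shift.mulS hT.shift hc.shift (proj 0)) hw ht fun _ _ => length_lcS_le _ _ _

theorem dotS (hn : PT n) (ht : PT t) (hT : PT T) (hx : PT x) (hy : PT y) :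
    PT fun v => dotS (n v) (t v) (T v) (x v) (y v) :=
  ht.lcS hx (hn.mapS ht (f := fun x v => IntroLines.mulMatS (t v) (T v) x)
    (ht.shift.mulMatS hT.shift (proj 0)) hy (ht.timesS ht) fun _ _ => length_lcS_le _ _ _)

theorem powersS (hd : PT d) (ht : PT t) (hT : PT T) (hc : PT c) :
    PT fun v => powersS (d v) (t v) (T v) (c v) := by
  refine ht.dropS (foldl_add (step := fun _ acc v => IntroLines.appS
    (IntroLines.mulS (t v) (T v) (c v) (IntroLines.takeS (t v) acc))
    (IntroLines.appS (IntroLines.dropS (t v) acc) (IntroLines.takeS (t v) acc)))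
    hd hc ht (fun _ => ?_) ?_)
  · have ht' := ht.shift
    exact (ht'.mulS hT.shift hc.shift (ht'.takeS (proj 0))).appS
      ((ht'.dropS (proj 0)).appS (ht'.takeS (proj 0)))
  · intro _ acc v
    have := length_lcS_le (t v) (IntroLines.takeS (t v) acc)
      (IntroLines.mulMatS (t v) (T v) (c v))
    simp [IntroLines.mulS] at this ⊢
    omega

theorem pivotS (hn : PT n) (ht : PT t) (hw : PT w) (hx : PT x) :
    PT fun v => pivotS (n v) (t v) (w v) (x v) := by
  have hr : PT fun v => (n v).foldl (fun acc _ => IntroLines.ifTrue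
      (IntroLines.eqS (IntroLines.takeS (t v) acc) (IntroLines.zerosS (t v)))
      (IntroLines.dropS (t v) acc) acc) (w v) := by
    refine foldl_add (step := fun _ acc v => IntroLines.ifTrue
      (IntroLines.eqS (IntroLines.takeS (t v) acc) (IntroLines.zerosS (t v)))
      (IntroLines.dropS (t v) acc) acc) hn hw nil (fun _ => ?_) ?_
    · have ht' := ht.shift
      exact ((ht'.takeS (proj 0)).eqS ht'.zerosS).ifTrue (ht'.dropS (proj 0)) (proj 0)
    · intro _ acc v
      rw [eqS_eq, ifTrue_bit]
      split_ifs <;> simp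
  exact hr.caseHead ht.zerosS fun _ => ht.takeS ((hr.dropS hw).dropS hx)

theorem fieldS (hl : PT l) : PT fun v => fieldS (l v) := by
  have hr : PT fun v => (l v).foldl (fun acc a => IntroLines.caseHead acc [a] fun h =>
      if h = none then acc else a :: acc) [] := by
    refine foldl_add (step := fun a acc _ => IntroLines.caseHead acc [a] fun h =>
      if h = none then acc else a :: acc) (g := fun _ => [none]) hl nil (const _)
      (fun a => (proj 0).caseHead (const _) fun _ => ite (proj 0) ((proj 0).cons _)) ?_
    intro a acc _
    cases acc
    · simp [IntroLines.caseHead]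
    · simp only [IntroLines.caseHead]
      split_ifs <;> simp
  exact hr.caseHead nil fun _ => ite hr.tail.revS hr.revS

theorem restS (hl : PT l) : PT fun v => restS (l v) := (hl.fieldS.dropS hl).tail

end PT

/-! ### Specifications of the string operations -/

@[simp] theorem length_ofBits (l : List Bool) : (ofBits l).length = l.length := by simp [ofBits]

@[simp] theorem ofBits_append (l l' : List Bool) : ofBits (l ++ l') = ofBits l ++ ofBits l' := by
  simp [ofBits]

theorem ofBits_injective : Injective ofBits := List.map_injective_iff.2 (Option.some_injective _)

/-- The fold maintains the partial sum in front of the unread rows, and additivity of the encoding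
turns exclusive or into the sum. The group is kept general because the rows are field elements in
one use and whole t-tuples of field elements in another. -/
theorem lcS_spec {M : Type} [AddCommMonoid M] {φ : M → List Bool} {t : Str}
    (hlen : ∀ x, (φ x).length = t.length) (hzero : φ 0 = List.replicate t.length false)
    (hadd : ∀ x y, φ (x + y) = List.zipWith xor (φ x) (φ y)) {y : List Bool} {rows : List M}
    (hy : y.length = rows.length) :
    lcS t (ofBits y) (ofBits (rows.map φ).flatten) =
      ofBits (φ (List.zipWith (fun c r => if c then r else 0) y rows).sum) := by
  have key : ∀ (y : List Bool) (rows : List M) (s : M), y.length = rows.length →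
      (ofBits y).foldl (fun acc a => appS
        (if a = some true then xorS (takeS t acc) (takeS t (dropS t acc)) else takeS t acc)
        (dropS t (dropS t acc))) (ofBits (φ s) ++ ofBits (rows.map φ).flatten) =
      ofBits (φ (s + (List.zipWith (fun c r => if c then r else 0) y rows).sum)) := by
    intro y
    induction y with
    | nil =>
      intro rows s h
      rw [List.length_nil, eq_comm, List.length_eq_zero_iff] at h
      subst h
      simp [ofBits]
    | cons c y ih =>
      intro rows s h
      cases rows with
      | nil => simp at h
      | cons r rows =>
        have e1 : ∀ z : Str, takeS t (ofBits (φ s) ++ z) = ofBits (φ s) := fun z => by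
          rw [takeS_eq, List.take_left' (by simp [hlen])]
        have e2 : ∀ (x : M) (z : Str), dropS t (ofBits (φ x) ++ z) = z := fun x z => by
          rw [dropS_eq, List.drop_left' (by simp [hlen])]
        have e3 : ∀ z : Str, takeS t (ofBits (φ r) ++ z) = ofBits (φ r) := fun z => by
          rw [takeS_eq, List.take_left' (by simp [hlen])]
        have hcons : ofBits (c :: y) = some c :: ofBits y := rfl
        rw [hcons, List.foldl_cons, List.map_cons, List.flatten_cons, ofBits_append, e1, e2, e2, e3,
          xorS_ofBits (by rw [hlen, hlen]), ← hadd]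
        cases c with
        | false => simpa using ih rows s (by simpa using h)
        | true => simpa [add_assoc] using ih rows (s + r) (by simpa using h)
  unfold lcS
  have h0 := key y rows 0 hy
  rw [appS_eq, zerosS_eq, ← hzero, h0, takeS_eq, List.take_of_length_le (by simp [hlen]), zero_add]

/-- The string is treated as a queue of blocks: after as many rounds as there are blocks, every
block has left at the front and its image stands at the back, in the original order. -/
theorem mapS_spec {n t : Str} {f : Str → Str} {chunks : List Str}
    (ht : ∀ z ∈ chunks, z.length = t.length) (hn : n.length = chunks.length) :
    mapS n t f chunks.flatten = (chunks.map f).flatten := by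
  unfold mapS
  suffices h : ∀ (n : Str) (z : Str), n.length = chunks.length →
      n.foldl (fun acc _ => appS (dropS t acc) (f (takeS t acc))) (chunks.flatten ++ z) =
        z ++ (chunks.map f).flatten by simpa using h n [] hn
  clear hn n
  induction chunks with
  | nil =>
    intro n z h
    rw [List.length_nil, List.length_eq_zero_iff] at h
    subst h
    simp
  | cons c chunks ih =>
    intro n z h
    cases n with
    | nil => simp at h
    | cons x n =>
      have hc := ht c (by simp)
      rw [List.foldl_cons, List.flatten_cons, List.append_assoc, takeS_eq, dropS_eq,
        List.take_left' hc, List.drop_left' hc, appS_eq, List.append_assoc,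
        ih (fun z hz => ht z (by simp [hz])) n _ (by simpa using h)]
      simp

theorem fieldS_ofBits_append (l : List Bool) (z : Str) :
    fieldS (ofBits l ++ none :: z) = ofBits l := by
  set step : Str → Sym → Str := fun acc a => caseHead acc [a] fun h =>
    if h = none then acc else a :: acc with hstep
  have h1 : ∀ (l : List Bool) (y : List Bool), (ofBits l).foldl step (ofBits y) =
      ofBits (l.reverse ++ y) := by
    intro l
    induction l with
    | nil => intro y; rfl
    | cons a l ih =>
      intro y
      have : step (ofBits y) (some a) = ofBits (a :: y) := by cases y <;> rfl
      rw [show ofBits (a :: l) = some a :: ofBits l from rfl, List.foldl_cons, this, ih]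
      simp
  have h2 : ∀ (z y : Str), z.foldl step (none :: y) = none :: y := by
    intro z
    induction z with
    | nil => intro y; rfl
    | cons a z ih => intro y; exact ih y
  have h3 : (ofBits l ++ none :: z).foldl step [] = none :: ofBits l.reverse := by
    have := h1 l []
    rw [List.foldl_append, show ([] : Str) = ofBits [] from rfl, this, List.append_nil,
      List.foldl_cons]
    have : step (ofBits l.reverse) none = none :: ofBits l.reverse := by
      cases l.reverse <;> rfl
    rw [this, h2]
  unfold fieldS
  simp only [← hstep, h3]
  simp [caseHead, ofBits]

theorem fieldS_ofBits (l : List Bool) : fieldS (ofBits l) = ofBits l := by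
  set step : Str → Sym → Str := fun acc a => caseHead acc [a] fun h =>
    if h = none then acc else a :: acc with hstep
  have h1 : ∀ (l : List Bool) (y : List Bool), (ofBits l).foldl step (ofBits y) =
      ofBits (l.reverse ++ y) := by
    intro l
    induction l with
    | nil => intro y; rfl
    | cons a l ih =>
      intro y
      have : step (ofBits y) (some a) = ofBits (a :: y) := by cases y <;> rfl
      rw [show ofBits (a :: l) = some a :: ofBits l from rfl, List.foldl_cons, this, ih]
      simp
  have h3 : (ofBits l).foldl step [] = ofBits l.reverse := by
    have := h1 l []
    rwa [List.append_nil] at this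
  unfold fieldS
  simp only [← hstep, h3]
  rcases h : l.reverse with _ | ⟨a, r⟩
  · rw [List.reverse_eq_nil_iff] at h
    subst h
    rfl
  · have : l = r.reverse ++ [a] := by rw [← List.reverse_reverse l, h]; simp
    rw [this]
    simp [caseHead, ofBits]

theorem restS_ofBits_append (l : List Bool) (z : Str) : restS (ofBits l ++ none :: z) = z := by
  simp [restS, fieldS_ofBits_append]

theorem joinStrings_cons (l : List Bool) (ls : List (List Bool)) (h : ls ≠ []) :
    joinStrings (l :: ls) = ofBits l ++ none :: joinStrings ls := by
  cases ls with
  | nil => exact absurd rfl h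
  | cons a ls => simp [joinStrings, ofBits]

theorem joinStrings_singleton (l : List Bool) : joinStrings [l] = ofBits l := by
  simp [joinStrings, ofBits]

section Field

variable {F : Type} [Field F] [Algebra (ZMod 2) F] {t : ℕ} (b : Module.Basis (Fin t) (ZMod 2) F)

@[simp] theorem length_fieldBits (x : F) : (fieldBits b x).length = t := by simp [fieldBits]

theorem length_flatten_ofFn {α : Type} {m k : ℕ} {f : Fin m → List α} (h : ∀ i, (f i).length = k) :
    (List.ofFn f).flatten.length = m * k := by
  simp [List.length_flatten, List.map_ofFn, Function.comp_def, h]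

@[simp] theorem length_vecBits {m : ℕ} (u : Fin m → F) : (vecBits b u).length = m * t :=
  length_flatten_ofFn fun _ => length_fieldBits b _

theorem zmod_two_decide_add (x y : ZMod 2) :
    decide (x + y = 1) = (decide (x = 1) ^^ decide (y = 1)) := by
  revert x y; decide

theorem zipWith_ofFn {α β γ : Type} (f : α → β → γ) {m : ℕ} (g : Fin m → α) (h : Fin m → β) :
    List.zipWith f (List.ofFn g) (List.ofFn h) = List.ofFn fun i => f (g i) (h i) := by
  apply List.ext_getElem <;> simp

theorem fieldBits_add (x y : F) :
    fieldBits b (x + y) = List.zipWith xor (fieldBits b x) (fieldBits b y) := by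
  simp only [fieldBits, zipWith_ofFn]
  congr 1
  funext i
  simp [zmod_two_decide_add]

theorem fieldBits_zero : fieldBits b 0 = List.replicate t false := by
  simp [fieldBits]

theorem fieldBits_injective : Injective (fieldBits b) := by
  intro x y h
  apply b.repr.injective
  ext i
  have h1 := congrFun (List.ofFn_injective h) i
  simp only [decide_eq_decide] at h1
  revert h1
  generalize b.repr x i = x
  generalize b.repr y i = y
  revert x y
  decide

theorem vecBits_succ {m : ℕ} (u : Fin (m + 1) → F) :
    vecBits b u = fieldBits b (u 0) ++ vecBits b (fun i => u i.succ) := by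
  simp [vecBits, List.ofFn_succ]

theorem vecBits_add {m : ℕ} (u v : Fin m → F) :
    vecBits b (u + v) = List.zipWith xor (vecBits b u) (vecBits b v) := by
  induction m with
  | zero => simp [vecBits]
  | succ m ih =>
    rw [vecBits_succ, vecBits_succ b u, vecBits_succ b v, List.zipWith_append (by simp), ← ih,
      Pi.add_apply, fieldBits_add]
    rfl

theorem vecBits_zero {m : ℕ} : vecBits b (0 : Fin m → F) = List.replicate (m * t) false := by
  induction m with
  | zero => simp [vecBits]
  | succ m ih =>
    rw [vecBits_succ, Pi.zero_apply, fieldBits_zero,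
      show (fun i : Fin m => (0 : Fin (m + 1) → F) i.succ) = 0 from rfl, ih, List.replicate_append_replicate]
    congr 1
    ring

theorem vecBits_injective {m : ℕ} : Injective (vecBits b (m := m)) := by
  intro u v h
  induction m with
  | zero => exact Subsingleton.elim _ _
  | succ m ih =>
    rw [vecBits_succ, vecBits_succ] at h
    obtain ⟨h1, h2⟩ := List.append_inj h (by simp)
    have h2' := congrFun (ih h2)
    funext i
    exact Fin.cases (fieldBits_injective b h1) h2' i

theorem sum_repr_smul (x y : F) :
    ∑ i, (if decide (b.repr x i = 1) = true then b i * y else 0) = x * y := by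
  conv_rhs => rw [← b.sum_repr x, Finset.sum_mul]
  refine Finset.sum_congr rfl fun i _ => ?_
  have : b.repr x i = 0 ∨ b.repr x i = 1 := by
    generalize b.repr x i = z
    revert z
    decide
  rcases this with h | h <;> simp [h]

/-- The multiplication table of the basis. -/
noncomputable def tableS : Str :=
  ofBits (List.ofFn fun i => (List.ofFn fun j => fieldBits b (b i * b j)).flatten).flatten

theorem ofBits_vecBits {m : ℕ} (u : Fin m → F) :
    ofBits (vecBits b u) = (List.ofFn fun i => ofBits (fieldBits b (u i))).flatten := by
  simp [vecBits, ofBits, List.map_flatten, List.map_ofFn, Function.comp_def]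

theorem take_drop_vecBits {m : ℕ} (u : Fin m → F) (j : Fin m) :
    ((ofBits (vecBits b u)).drop (j * t)).take t = ofBits (fieldBits b (u j)) := by
  induction m with
  | zero => exact j.elim0
  | succ m ih =>
    rw [vecBits_succ, ofBits_append]
    refine Fin.cases ?_ (fun i => ?_) j
    · simp
    · rw [Fin.val_succ, Nat.add_mul, one_mul, Nat.add_comm, ← List.drop_drop,
        List.drop_left' (by simp), ih]

variable {st : Str} (hst : st.length = t)

include hst

/-- Row i of the table is one string holding the products of basis element i with all basis
elements. Combining the rows with the coordinates of x therefore yields x times each basis element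
simultaneously. -/
theorem mulMatS_spec (x : F) :
    mulMatS st (tableS b) (ofBits (fieldBits b x)) = ofBits (vecBits b fun j => x * b j) := by
  have h := lcS_spec (M := Fin t → F) (φ := vecBits b) (t := timesS st st)
    (y := fieldBits b x) (rows := List.ofFn fun i j => b i * b j)
    (by simp [hst]) (by rw [vecBits_zero, length_timesS, hst]) (vecBits_add b) (by simp)
  rw [List.map_ofFn] at h
  refine h.trans ?_
  congr 2
  rw [fieldBits, zipWith_ofFn, List.sum_ofFn]
  funext j
  rw [Finset.sum_apply, ← sum_repr_smul b x (b j)]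
  refine Finset.sum_congr rfl fun i _ => ?_
  split_ifs <;> rfl

theorem mulS_spec (x y : F) :
    mulS st (tableS b) (ofBits (fieldBits b x)) (ofBits (fieldBits b y)) =
      ofBits (fieldBits b (x * y)) := by
  unfold mulS
  rw [mulMatS_spec b hst]
  have h := lcS_spec (M := F) (φ := fieldBits b) (t := st)
    (y := fieldBits b y) (rows := List.ofFn fun j => x * b j)
    (by simp [hst]) (by rw [fieldBits_zero, hst]) (fieldBits_add b) (by simp)
  rw [List.map_ofFn] at h
  refine h.trans ?_
  congr 2
  rw [fieldBits, zipWith_ofFn, List.sum_ofFn, mul_comm, ← sum_repr_smul b y x]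
  refine Finset.sum_congr rfl fun i _ => ?_
  rw [mul_comm]

theorem smulS_spec {m : ℕ} {sn : Str} (hsn : sn.length = m) (c : F) (w : Fin m → F) :
    smulS sn st (tableS b) (ofBits (fieldBits b c)) (ofBits (vecBits b w)) =
      ofBits (vecBits b (c • w)) := by
  unfold smulS
  rw [ofBits_vecBits b, ofBits_vecBits b, mapS_spec, List.map_ofFn]
  · congr 2
    funext i
    exact mulS_spec b hst c (w i)
  · simp [List.mem_ofFn, hst]
  · simp [hsn]

/-- The products of the u i with all basis elements, listed one after the other, have as many rows
as the vector v has bits. A single linear combination with these bits thus computes the whole sum,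
without separate multiplications and additions. -/
theorem dotS_spec {m : ℕ} {sn : Str} (hsn : sn.length = m) (v u : Fin m → F) :
    dotS sn st (tableS b) (ofBits (vecBits b v)) (ofBits (vecBits b u)) =
      ofBits (fieldBits b (v ⬝ᵥ u)) := by
  unfold dotS
  rw [ofBits_vecBits b u, mapS_spec, List.map_ofFn]
  · have h1 : (List.ofFn (mulMatS st (tableS b) ∘ fun i => ofBits (fieldBits b (u i)))).flatten =
        ofBits (((List.ofFn fun i => List.ofFn fun j => u i * b j).flatten).map
          (fieldBits b)).flatten := by
      simp only [Function.comp_def, mulMatS_spec b hst]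
      simp [vecBits, ofBits, List.map_flatten, List.map_ofFn, Function.comp_def, List.flatten_flatten]
    rw [h1, lcS_spec (M := F) (by simp [hst]) (by rw [fieldBits_zero, hst]) (fieldBits_add b)]
    · congr 2
      clear h1 hsn
      induction m with
      | zero => simp [vecBits]
      | succ m ih =>
        rw [vecBits_succ, List.ofFn_succ, List.flatten_cons, List.zipWith_append (by simp),
          List.sum_append, ih, fieldBits, zipWith_ofFn, List.sum_ofFn, dotProduct, dotProduct,
          Fin.sum_univ_succ, ← sum_repr_smul b (v 0) (u 0)]
        simp only [mul_comm (u 0)]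
    · rw [length_vecBits, length_flatten_ofFn (k := t) (by simp)]
  · simp [List.mem_ofFn, hst]
  · simp [hsn]

/-- The invariant of the fold: the highest power so far is in front, followed by the lower ones in
increasing order. A step moves the front power to the back and puts its product with c in front; the
last front power is one too many and is dropped. -/
theorem powersS_spec {m : ℕ} {sd : Str} (hsd : sd.length = m) (c : F) :
    powersS sd st (tableS b) (ofBits (fieldBits b c)) =
      ofBits (vecBits b fun i : Fin m => c ^ ((i : ℕ) + 1)) := by
  have e1 : ∀ (x : F) (z : Str), takeS st (ofBits (fieldBits b x) ++ z) = ofBits (fieldBits b x) :=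
    fun x z => by rw [takeS_eq, List.take_left' (by simp [hst])]
  have e2 : ∀ (x : F) (z : Str), dropS st (ofBits (fieldBits b x) ++ z) = z := fun x z => by
    rw [dropS_eq, List.drop_left' (by simp [hst])]
  have key : ∀ (sd : Str) (k : ℕ), sd.foldl (fun acc _ =>
      appS (mulS st (tableS b) (ofBits (fieldBits b c)) (takeS st acc))
        (appS (dropS st acc) (takeS st acc)))
        (ofBits (fieldBits b (c ^ (k + 1))) ++
          ofBits (vecBits b fun i : Fin k => c ^ ((i : ℕ) + 1))) =
      ofBits (fieldBits b (c ^ (k + sd.length + 1))) ++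
          ofBits (vecBits b fun i : Fin (k + sd.length) => c ^ ((i : ℕ) + 1)) := by
    intro sd
    induction sd with
    | nil => intro k; rfl
    | cons x sd ih =>
      intro k
      rw [List.foldl_cons, e1, e2, mulS_spec b hst, appS_eq, appS_eq, ← pow_succ']
      have h1 : ofBits (vecBits b fun i : Fin k => c ^ ((i : ℕ) + 1)) ++
          ofBits (fieldBits b (c ^ (k + 1))) =
          ofBits (vecBits b fun i : Fin (k + 1) => c ^ ((i : ℕ) + 1)) := by
        simp only [vecBits, List.ofFn_succ_last, List.flatten_append]
        simp
      rw [h1, ih (k + 1), List.length_cons, Nat.add_comm sd.length 1, ← Nat.add_assoc]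
  have h0 := key sd 0
  unfold powersS
  subst hsd
  have h2 : ofBits (fieldBits b (c ^ (0 + 1))) ++
      ofBits (vecBits b fun i : Fin 0 => c ^ ((i : ℕ) + 1)) = ofBits (fieldBits b c) := by
    simp [vecBits, ofBits]
  rw [h2] at h0
  rw [h0, e2, Nat.zero_add]

theorem zerosS_eq_zero : zerosS st = ofBits (fieldBits b 0) := by
  rw [zerosS_eq, hst, fieldBits_zero]

theorem pivotS_zero {m : ℕ} {sn : Str} (hsn : sn.length = m) (x : Str) :
    pivotS sn st (ofBits (vecBits b (0 : Fin m → F))) x = ofBits (fieldBits b 0) := by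
  have key : ∀ (m : ℕ) (sn : Str), sn.length = m → sn.foldl (fun acc _ =>
      ifTrue (eqS (takeS st acc) (zerosS st)) (dropS st acc) acc)
        (ofBits (vecBits b (0 : Fin m → F))) = [] := by
    intro m
    induction m with
    | zero =>
      intro sn h
      rw [List.length_eq_zero_iff] at h
      subst h
      simp [vecBits, ofBits]
    | succ m ih =>
      intro sn h
      cases sn with
      | nil => simp at h
      | cons a sn =>
        rw [List.foldl_cons, vecBits_succ, ofBits_append, takeS_eq, List.take_left' (by simp [hst]),
          dropS_eq, List.drop_left' (by simp [hst]), Pi.zero_apply, eqS_eq,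
          decide_eq_true (zerosS_eq_zero b hst).symm, ifTrue_bit, if_pos rfl]
        exact ih sn (by simpa using h)
  unfold pivotS
  simp only [key m sn hsn]
  rw [caseHead, zerosS_eq_zero b hst]

theorem pivotS_ne_zero {m : ℕ} {sn : Str} (hsn : sn.length = m) (ht : 0 < t) {w : Fin m → F}
    {j : Fin m} (hj : w j ≠ 0) (hj' : ∀ i < j, w i = 0) (x : Fin m → F) :
    pivotS sn st (ofBits (vecBits b w)) (ofBits (vecBits b x)) = ofBits (fieldBits b (x j)) := by
  have hfix : ∀ (sn acc : Str), takeS st acc ≠ zerosS st → sn.foldl (fun acc _ =>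
      ifTrue (eqS (takeS st acc) (zerosS st)) (dropS st acc) acc) acc = acc := by
    intro sn acc h
    induction sn with
    | nil => rfl
    | cons a sn ih =>
      rw [List.foldl_cons, eqS_eq, decide_eq_false h, ifTrue_bit, if_neg (by simp), ih]
  have key : ∀ (m : ℕ) (w : Fin m → F) (j : Fin m) (_ : w j ≠ 0) (_ : ∀ i < j, w i = 0) (sn : Str),
      sn.length = m → sn.foldl (fun acc _ =>
      ifTrue (eqS (takeS st acc) (zerosS st)) (dropS st acc) acc) (ofBits (vecBits b w)) =
        (ofBits (vecBits b w)).drop (j * t) := by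
    intro m
    induction m with
    | zero => exact fun _ j => j.elim0
    | succ m ih =>
      intro w j hj hj' sn h
      cases sn with
      | nil => simp at h
      | cons a sn =>
        by_cases h0 : j = 0
        · subst h0
          rw [hfix]
          · simp
          · rw [vecBits_succ, ofBits_append, takeS_eq, List.take_left' (by simp [hst]), zerosS_eq, hst,
              ← fieldBits_zero b]
            exact fun h => hj (fieldBits_injective b (ofBits_injective h))
        · obtain ⟨i, rfl⟩ := Fin.exists_succ_eq.2 h0
          rw [List.foldl_cons, vecBits_succ, ofBits_append, takeS_eq,
            List.take_left' (by simp [hst]), dropS_eq, List.drop_left' (by simp [hst]),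
            hj' 0 (Fin.succ_pos i), eqS_eq, decide_eq_true (zerosS_eq_zero b hst).symm,
            ifTrue_bit, if_pos rfl,
            ih (fun i => w i.succ) i hj (fun k hk => hj' k.succ (by simpa using hk)) sn
              (by simpa using h),
            Fin.val_succ, Nat.add_mul, one_mul, Nat.add_comm _ t, ← List.drop_drop,
            List.drop_left' (by simp)]
  have hjt : j * t + t ≤ m * t := by
    have := Nat.mul_le_mul_right t (Nat.succ_le_of_lt j.2)
    rwa [Nat.succ_mul] at this
  unfold pivotS
  simp only [key m w j hj hj' sn hsn]
  -- Positivity of t enters here: the block at the pivot must be nonempty, or the remainder could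
  -- not be told from the case of the zero vector.
  have hne : (ofBits (vecBits b w)).drop (j * t) ≠ [] := by
    intro h
    have := congrArg List.length h
    simp at this
    omega
  obtain ⟨a, r, har⟩ := List.exists_cons_of_ne_nil hne
  have hlen : (ofBits (vecBits b w)).length - ((ofBits (vecBits b w)).drop (j * t)).length
      = j * t := by
    simp
    omega
  rw [takeS_eq, dropS_eq, dropS_eq, List.length_drop, hlen, hst, take_drop_vecBits b, har]
  rfl

end Field

/-! ### The decision procedure -/

/-- The answer after its first optional vector, which has `|w|` bits. -/
def skipS (w a : Str) : Str := ifTrue a (dropS w a.tail) a.tail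

/-- The optional vector number `i` of an answer, if there is one. -/
def vecS (i : Fin 2) (w a : Str) : Str :=
  if i = 0 then takeS w a.tail else takeS w (skipS w a).tail

/-- The second block of an answer. -/
def replyS (w a : Str) : Str := skipS w (skipS w a)

/-- The format of an answer: which vectors are present, and the type of the second block. -/
def shapeS (w a : Str) : Str :=
  appS (takeS [none] a) (appS (takeS [none] (skipS w a)) (takeS [none, none, none] (replyS w a)))

/-- The content of the second block of an answer. -/
def bodyS (w a : Str) : Str := dropS [none, none, none] (replyS w a)

/-- The point of the line. -/
def linePointS (w l : Str) : Str := takeS w l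

/-- The direction of the line. -/
def lineDirS (w l : Str) : Str := takeS w (dropS w l)

/-- The coefficients of the function on the line. -/
def lineCoeffS (w l : Str) : Str := dropS w (dropS w l)

/-- The part of a second block that describes a line and a function on it. -/
def lineS (n t d l : Str) : Str :=
  takeS (appS (timesS n t) (appS (timesS n t) (timesS (none :: d) t))) l

/-- The part of a second block after the line. -/
def lineDotS (n t d l : Str) : Str :=
  dropS (appS (timesS n t) (appS (timesS n t) (timesS (none :: d) t))) l

/-- The test whether `x` lies on the line through `p` in direction `w`. -/
def onLineS (n t T p w x : Str) : Str := eqS x (xorS p (smulS n t T (pivotS n t w x) w))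

/-- The value at `x` of the function with coefficients `z` on a line with direction `w`. -/
def evalS (n t d T w z x : Str) : Str :=
  xorS (takeS t z) (dotS d t T (dropS t z) (powersS d t T (pivotS n t w x)))

/-- The test whether the function on the line `l` is defined at `x` and has the value `e`. -/
def hasValueS (n t d T l x e : Str) : Str :=
  andS (onLineS n t T (linePointS (timesS n t) l) (lineDirS (timesS n t) l) x)
    (eqS e (evalS n t d T (lineDirS (timesS n t) l) (lineCoeffS (timesS n t) l) x))

/-- The test whether the line `l` is the line through `u` in direction `v`. -/
def lineThroughS (n t T l u v : Str) : Str :=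
  andS (onLineS n t T (linePointS (timesS n t) l) (lineDirS (timesS n t) l) u)
    (andS (eqS v (smulS n t T (pivotS n t (lineDirS (timesS n t) l) v) (lineDirS (timesS n t) l)))
      (eqS (eqS v (zerosS (timesS n t))) (eqS (lineDirS (timesS n t) l) (zerosS (timesS n t)))))

/-- The format of an answer of copy `c`, as bits. -/
def formatBits (c : Fin 2) (p s : Bool) (tag : List Bool) : List Bool :=
  place c p s 0 :: place c p s 1 :: tag

/-- The test whether an answer has the given format. -/
def formatS (c : Fin 2) (p s : Bool) (tag : List Bool) (w a : Str) : Str :=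
  eqS (shapeS w a) (ofBits (formatBits c p s tag))

/-- The other register. -/
def other (c : Fin 2) : Fin 2 := if c = 0 then 1 else 0

/-- The winning condition of a round. -/
def checkS (n t d T : Str) : Round → Str → Str → Str
  | .hideSurface c, a, b =>
      andS (formatS c false true [false, false, false] (timesS n t) a)
        (andS (formatS c true true [false, false, false] (timesS n t) b)
          (andS (eqS (vecS (other c) (timesS n t) a) (vecS (other c) (timesS n t) b))
            (andS (eqS (bodyS (timesS n t) a) (bodyS (timesS n t) b))
              (lineThroughS n t T (bodyS (timesS n t) b) (vecS c (timesS n t) b)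
                (vecS (other c) (timesS n t) b)))))
  | .hideAnswer c, a, b =>
      andS (formatS c false true [false, false, false] (timesS n t) a)
        (andS (formatS c false true [false, false, true] (timesS n t) b)
          (andS (eqS (vecS (other c) (timesS n t) a) (vecS (other c) (timesS n t) b))
            (eqS (bodyS (timesS n t) a) (lineS n t d (bodyS (timesS n t) b)))))
  | .hideBasis c, a, b =>
      andS (formatS c true true [false, true, false] (timesS n t) a)
        (andS (formatS c false true [false, true, true] (timesS n t) b)
          (andS (eqS (vecS (other c) (timesS n t) a) (vecS (other c) (timesS n t) b))
            (eqS (bodyS (timesS n t) b)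
              (dotS n t T (vecS (other c) (timesS n t) a) (vecS c (timesS n t) a)))))
  | .hideDot c, a, b =>
      andS (formatS c false true [false, false, true] (timesS n t) a)
        (andS (formatS c false true [false, true, true] (timesS n t) b)
          (eqS (lineDotS n t d (bodyS (timesS n t) a)) (bodyS (timesS n t) b)))
  | .cross c, a, b =>
      andS (formatS c false true [false, false, false] (timesS n t) a)
        (andS (formatS c true false [true, false, false] (timesS n t) b)
          (hasValueS n t d T (bodyS (timesS n t) a) (vecS c (timesS n t) b)
            (bodyS (timesS n t) b)))
  | .intersect, a, b =>
      andS (formatS 0 false true [false, false, false] (timesS n t) a)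
        (andS (formatS 1 false true [false, false, false] (timesS n t) b)
          (andS (onLineS n t T (linePointS (timesS n t) (bodyS (timesS n t) a))
              (lineDirS (timesS n t) (bodyS (timesS n t) a))
              (xorS (vecS 0 (timesS n t) b) (vecS 1 (timesS n t) a)))
            (hasValueS n t d T (bodyS (timesS n t) b)
              (xorS (vecS 0 (timesS n t) b) (vecS 1 (timesS n t) a))
              (evalS n t d T (lineDirS (timesS n t) (bodyS (timesS n t) a))
                (lineCoeffS (timesS n t) (bodyS (timesS n t) a))
                (xorS (vecS 0 (timesS n t) b) (vecS 1 (timesS n t) a))))))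
  | .consistency, a, b =>
      andS (formatS 0 true false [true, false, false] (timesS n t) a)
        (andS (formatS 0 true false [true, false, false] (timesS n t) b)
          (eqS (bodyS (timesS n t) a) (bodyS (timesS n t) b)))

/-- All rounds. -/
def rounds : List Round :=
  [.hideSurface 0, .hideSurface 1, .hideAnswer 0, .hideAnswer 1, .hideBasis 0, .hideBasis 1,
    .hideDot 0, .hideDot 1, .cross 0, .cross 1, .intersect, .consistency]

/-- The verdict on the answers `a₀` and `a₁` to the questions whose codes are concatenated in
`q`. -/
def verdictS (n t d T q a₀ a₁ : Str) (l : List Round) : Str :=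
  l.foldr (fun r acc => orS (orS
    (andS (eqS q (ofBits (questionBits r.questions.1 ++ questionBits r.questions.2)))
      (checkS n t d T r a₀ a₁))
    (andS (eqS q (ofBits (questionBits r.questions.2 ++ questionBits r.questions.1)))
      (checkS n t d T r a₁ a₀))) acc) (bit false)

/-- The verdict, from the whole input. -/
def decideS (l : Str) : Str :=
  verdictS (fieldS l) (fieldS (restS l)) (fieldS (restS^[2] l)) (fieldS (restS^[3] l))
    (appS (fieldS (restS^[4] l)) (fieldS (restS^[5] l)))
    (fieldS (restS^[6] l)) (fieldS (restS^[7] l)) rounds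

/-! ### Polynomial time of the decision procedure. -/

namespace PT

variable {m : ℕ} {n t d T w a b l x u v p z e q : (Fin m → Str) → Str}

theorem skipS (hw : PT w) (ha : PT a) : PT fun v => skipS (w v) (a v) :=
  ha.ifTrue (hw.dropS ha.tail) ha.tail

theorem vecS (i : Fin 2) (hw : PT w) (ha : PT a) : PT fun v => vecS i (w v) (a v) :=
  ite (hw.takeS ha.tail) (hw.takeS (hw.skipS ha).tail)

theorem replyS (hw : PT w) (ha : PT a) : PT fun v => replyS (w v) (a v) :=
  hw.skipS (hw.skipS ha)

theorem shapeS (hw : PT w) (ha : PT a) : PT fun v => shapeS (w v) (a v) :=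
  ((const _).takeS ha).appS (((const _).takeS (hw.skipS ha)).appS ((const _).takeS (hw.replyS ha)))

theorem bodyS (hw : PT w) (ha : PT a) : PT fun v => bodyS (w v) (a v) :=
  (const _).dropS (hw.replyS ha)

theorem lineDirS (hw : PT w) (hl : PT l) : PT fun v => lineDirS (w v) (l v) :=
  hw.takeS (hw.dropS hl)

theorem lineCoeffS (hw : PT w) (hl : PT l) : PT fun v => lineCoeffS (w v) (l v) :=
  hw.dropS (hw.dropS hl)

theorem lineS (hn : PT n) (ht : PT t) (hd : PT d) (hl : PT l) :
    PT fun v => lineS (n v) (t v) (d v) (l v) :=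
  ((hn.timesS ht).appS ((hn.timesS ht).appS ((hd.cons _).timesS ht))).takeS hl

theorem lineDotS (hn : PT n) (ht : PT t) (hd : PT d) (hl : PT l) :
    PT fun v => lineDotS (n v) (t v) (d v) (l v) :=
  ((hn.timesS ht).appS ((hn.timesS ht).appS ((hd.cons _).timesS ht))).dropS hl

theorem onLineS (hn : PT n) (ht : PT t) (hT : PT T) (hp : PT p) (hw : PT w) (hx : PT x) :
    PT fun v => onLineS (n v) (t v) (T v) (p v) (w v) (x v) :=
  hx.eqS (hp.xorS (hn.smulS ht hT (hn.pivotS ht hw hx) hw))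

theorem evalS (hn : PT n) (ht : PT t) (hd : PT d) (hT : PT T) (hw : PT w) (hz : PT z)
    (hx : PT x) : PT fun v => evalS (n v) (t v) (d v) (T v) (w v) (z v) (x v) :=
  (ht.takeS hz).xorS (hd.dotS ht hT (ht.dropS hz) (hd.powersS ht hT (hn.pivotS ht hw hx)))

theorem hasValueS (hn : PT n) (ht : PT t) (hd : PT d) (hT : PT T) (hl : PT l) (hx : PT x)
    (he : PT e) : PT fun v => hasValueS (n v) (t v) (d v) (T v) (l v) (x v) (e v) :=
  have hw := hn.timesS ht
  (hn.onLineS ht hT (hw.takeS hl) (hw.lineDirS hl) hx).andS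
    (he.eqS (hn.evalS ht hd hT (hw.lineDirS hl) (hw.lineCoeffS hl) hx))

theorem lineThroughS (hn : PT n) (ht : PT t) (hT : PT T) (hl : PT l) (hu : PT u) (hv : PT v) :
    PT fun w => lineThroughS (n w) (t w) (T w) (l w) (u w) (v w) :=
  have hw := hn.timesS ht
  (hn.onLineS ht hT (hw.takeS hl) (hw.lineDirS hl) hu).andS
    ((hv.eqS (hn.smulS ht hT (hn.pivotS ht (hw.lineDirS hl) hv) (hw.lineDirS hl))).andS
      ((hv.eqS hw.zerosS).eqS ((hw.lineDirS hl).eqS hw.zerosS)))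

theorem formatS (c : Fin 2) (i j : Bool) (tag : List Bool) (hw : PT w) (ha : PT a) :
    PT fun v => formatS c i j tag (w v) (a v) :=
  (hw.shapeS ha).eqS (const _)

theorem checkS (hn : PT n) (ht : PT t) (hd : PT d) (hT : PT T) (r : Round) (ha : PT a)
    (hb : PT b) : PT fun v => checkS (n v) (t v) (d v) (T v) r (a v) (b v) := by
  have hw := hn.timesS ht
  cases r with
  | hideSurface c =>
    exact (formatS _ _ _ _ hw ha).andS ((formatS _ _ _ _ hw hb).andS
      (((vecS _ hw ha).eqS (vecS _ hw hb)).andS (((hw.bodyS ha).eqS (hw.bodyS hb)).andS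
        (hn.lineThroughS ht hT (hw.bodyS hb) (vecS _ hw hb) (vecS _ hw hb)))))
  | hideAnswer c =>
    exact (formatS _ _ _ _ hw ha).andS ((formatS _ _ _ _ hw hb).andS
      (((vecS _ hw ha).eqS (vecS _ hw hb)).andS
        ((hw.bodyS ha).eqS (hn.lineS ht hd (hw.bodyS hb)))))
  | hideBasis c =>
    exact (formatS _ _ _ _ hw ha).andS ((formatS _ _ _ _ hw hb).andS
      (((vecS _ hw ha).eqS (vecS _ hw hb)).andS
        ((hw.bodyS hb).eqS (hn.dotS ht hT (vecS _ hw ha) (vecS _ hw ha)))))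
  | hideDot c =>
    exact (formatS _ _ _ _ hw ha).andS ((formatS _ _ _ _ hw hb).andS
      ((hn.lineDotS ht hd (hw.bodyS ha)).eqS (hw.bodyS hb)))
  | cross c =>
    exact (formatS _ _ _ _ hw ha).andS ((formatS _ _ _ _ hw hb).andS
      (hn.hasValueS ht hd hT (hw.bodyS ha) (vecS _ hw hb) (hw.bodyS hb)))
  | intersect =>
    have hx := (vecS 0 hw hb).xorS (vecS 1 hw ha)
    exact (formatS _ _ _ _ hw ha).andS ((formatS _ _ _ _ hw hb).andS
      ((hn.onLineS ht hT (hw.takeS (hw.bodyS ha)) (hw.lineDirS (hw.bodyS ha)) hx).andS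
        (hn.hasValueS ht hd hT (hw.bodyS hb) hx
          (hn.evalS ht hd hT (hw.lineDirS (hw.bodyS ha)) (hw.lineCoeffS (hw.bodyS ha)) hx))))
  | consistency =>
    exact (formatS _ _ _ _ hw ha).andS ((formatS _ _ _ _ hw hb).andS
      ((hw.bodyS ha).eqS (hw.bodyS hb)))

theorem verdictS (hn : PT n) (ht : PT t) (hd : PT d) (hT : PT T) (hq : PT q) (ha : PT a)
    (hb : PT b) (l : List Round) :
    PT fun v => verdictS (n v) (t v) (d v) (T v) (q v) (a v) (b v) l := by
  induction l with
  | nil => exact bit _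
  | cons r l ih =>
    exact (((hq.eqS (const _)).andS (hn.checkS ht hd hT r ha hb)).orS
      ((hq.eqS (const _)).andS (hn.checkS ht hd hT r hb ha))).orS ih

theorem decideS (hl : PT l) : PT fun v => decideS (l v) :=
  have h1 := hl.restS
  have h2 := h1.restS
  have h3 := h2.restS
  have h4 := h3.restS
  have h5 := h4.restS
  have h6 := h5.restS
  have h7 := h6.restS
  verdictS hl.fieldS h1.fieldS h2.fieldS h3.fieldS (h4.fieldS.appS h5.fieldS) h6.fieldS h7.fieldS _

end PT

/-! ### Correctness of the decision procedure -/

theorem andS_bit_left (p : Bool) (x : Str) : andS (bit p) x = if p then x else bit false := by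
  cases p <;> rfl

theorem isSome_eq_place {α : Type} {o : Fin 2 → Option α} {c : Fin 2} {p s : Bool}
    (h : (fun i => (o i).isSome) = place c p s) :
    (o c).isSome = p ∧ (o (other c)).isSome = s := by
  constructor
  · have := congrFun h c
    simpa [place] using this
  · have := congrFun h (other c)
    revert this
    fin_cases c <;> simp [place, other]

theorem eq_place {T : Type} {o : Fin 2 → T} (c : Fin 2) : o = place c (o c) (o (other c)) := by
  funext i
  fin_cases c <;> fin_cases i <;> rfl

@[simp] theorem place_self {T : Type} (c : Fin 2) (p s : T) : place c p s c = p := by simp [place]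

@[simp] theorem place_other {T : Type} (c : Fin 2) (p s : T) : place c p s (other c) = s := by
  fin_cases c <;> simp [place, other]

theorem place_inj {T : Type} {c : Fin 2} {p s p' s' : T} :
    place c p s = place c p' s' ↔ p = p' ∧ s = s' := by
  constructor
  · intro h
    exact ⟨by simpa using congrFun h c, by simpa using congrFun h (other c)⟩
  · rintro ⟨rfl, rfl⟩
    rfl

theorem isSome_place {α : Type} {c : Fin 2} (p s : Option α) :
    (fun i => (place c p s i).isSome) = place c p.isSome s.isSome := by
  funext i
  unfold place
  split_ifs <;> rfl

/-! ### Codes and parameters of lines. -/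

section Lines

variable {F : Type} [Field F] {n d : ℕ}

theorem LineFn.isCode_code (f : LineFn F n d) : f.IsCode f.code := f.exists_isCode.choose_spec

/-- The value at parameter `c` of the function with the coefficients of the code. -/
noncomputable def LineFn.codeVal (f : LineFn F n d) (c : F) : F := ∑ i, f.code.2.2 i * c ^ (i : ℕ)

/-- The code fixes the line as a set, and every point of it has some parameter, at which the
coefficients determine the value. -/
theorem LineFn.code_injective : Injective (LineFn.code : LineFn F n d → _) := by
  intro f f' h
  have hf := f.isCode_code
  have hf' := f'.isCode_code
  rw [← h] at hf'
  obtain ⟨⟨s, g⟩, hg⟩ := f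
  obtain ⟨⟨s', g'⟩, hg'⟩ := f'
  have hs : s = s' := hf.2.1.trans hf'.2.1.symm
  subst hs
  have : g = g' := by
    funext x
    have hx : x.1 ∈ LineFn.line ⟨⟨s, g⟩, hg⟩ := x.2
    rw [hf.2.1] at hx
    obtain ⟨c, hc⟩ := hx
    exact (hf.2.2 x c hc.symm).trans (hf'.2.2 x c hc.symm).symm
  subst this
  rfl

/-- `c` is the parameter of the point `x` of the line of `f`, if `x` is on this line. -/
def LineFn.IsParam (f : LineFn F n d) (x : Fin n → F) (c : F) : Prop :=
  ∀ c' : F, x = f.code.1 + c' • f.code.2.1 → x = f.code.1 + c • f.code.2.1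

theorem LineFn.IsParam.mem_line_iff {f : LineFn F n d} {x : Fin n → F} {c : F}
    (h : f.IsParam x c) : x ∈ f.line ↔ x = f.code.1 + c • f.code.2.1 := by
  rw [f.isCode_code.2.1]
  constructor
  · rintro ⟨c', hc'⟩
    exact h c' hc'.symm
  · exact fun hx => ⟨c, hx.symm⟩

theorem LineFn.IsParam.hasValue_iff {f : LineFn F n d} {x : Fin n → F} {c : F}
    (h : f.IsParam x c) (ν : F) :
    f.HasValue x ν ↔ x = f.code.1 + c • f.code.2.1 ∧ ν = f.codeVal c := by
  constructor
  · rintro ⟨hx, hν⟩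
    have hx' := h.mem_line_iff.1 hx
    exact ⟨hx', hν.symm.trans (f.isCode_code.2.2 ⟨x, hx⟩ c hx')⟩
  · rintro ⟨hx, hν⟩
    have hx' := h.mem_line_iff.2 hx
    exact ⟨hx', (f.isCode_code.2.2 ⟨x, hx'⟩ c hx).trans hν.symm⟩

/-- The type of the second block of an answer. -/
def tagBits : Reply F n d → List Bool
  | .line _ => [false, false, false]
  | .lineDot _ _ => [false, false, true]
  | .empty => [false, true, false]
  | .dot _ => [false, true, true]
  | .value _ => [true, false, false]

theorem length_tagBits (r : Reply F n d) : (tagBits r).length = 3 := by cases r <;> rfl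

theorem exists_of_tag_line {r : Reply F n d} (h : tagBits r = [false, false, false]) :
    ∃ f, r = .line f := by
  cases r <;> simp_all [tagBits]

theorem exists_of_tag_lineDot {r : Reply F n d} (h : tagBits r = [false, false, true]) :
    ∃ f e, r = .lineDot f e := by
  cases r <;> simp_all [tagBits]

theorem eq_of_tag_empty {r : Reply F n d} (h : tagBits r = [false, true, false]) :
    r = .empty := by
  cases r <;> simp_all [tagBits]

theorem exists_of_tag_dot {r : Reply F n d} (h : tagBits r = [false, true, true]) :
    ∃ e, r = .dot e := by
  cases r <;> simp_all [tagBits]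

theorem exists_of_tag_value {r : Reply F n d} (h : tagBits r = [true, false, false]) :
    ∃ e, r = .value e := by
  cases r <;> simp_all [tagBits]

end Lines

/-! ### Reading coded answers and computing with lines. -/

section Field

variable {F : Type} [Field F] [Algebra (ZMod 2) F] {t n d : ℕ}
  (b : Module.Basis (Fin t) (ZMod 2) F)

/-- The content of the second block of an answer. -/
noncomputable def bodyBits : Reply F n d → List Bool
  | .line f => lineFnBits b f
  | .lineDot f e => lineFnBits b f ++ fieldBits b e
  | .empty => []
  | .dot e => fieldBits b e
  | .value ν => fieldBits b ν

theorem replyBits_eq (r : Reply F n d) : replyBits b r = tagBits r ++ bodyBits b r := by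
  cases r <;> simp [replyBits, tagBits, bodyBits]

@[simp] theorem length_lineFnBits (f : LineFn F n d) :
    (lineFnBits b f).length = n * t + n * t + (d + 1) * t := by
  simp [lineFnBits, Nat.add_assoc]

theorem lineFnBits_injective : Injective (lineFnBits b : LineFn F n d → _) := by
  intro f f' h
  apply LineFn.code_injective
  unfold lineFnBits at h
  obtain ⟨h1, h2⟩ := List.append_inj h (by simp)
  obtain ⟨h3, h4⟩ := List.append_inj h1 (by simp)
  exact Prod.ext (vecBits_injective b h3) (Prod.ext (vecBits_injective b h4) (vecBits_injective b h2))

/-- The string of a field element. -/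
noncomputable def fS (x : F) : Str := ofBits (fieldBits b x)

/-- The string of a vector. -/
noncomputable def vS {m : ℕ} (u : Fin m → F) : Str := ofBits (vecBits b u)

theorem fS_inj {x y : F} : fS b x = fS b y ↔ x = y :=
  (ofBits_injective.comp (fieldBits_injective b)).eq_iff

theorem vS_inj {m : ℕ} {x y : Fin m → F} : vS b x = vS b y ↔ x = y :=
  (ofBits_injective.comp (vecBits_injective b)).eq_iff

theorem lineFnS_inj {f f' : LineFn F n d} :
    ofBits (lineFnBits b f) = ofBits (lineFnBits b f') ↔ f = f' :=
  (ofBits_injective.comp (lineFnBits_injective b)).eq_iff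

theorem xorS_fS (x y : F) : xorS (fS b x) (fS b y) = fS b (x + y) := by
  rw [fS, fS, xorS_ofBits (by simp), fS, fieldBits_add]

theorem xorS_vS {m : ℕ} (x y : Fin m → F) : xorS (vS b x) (vS b y) = vS b (x + y) := by
  rw [vS, vS, xorS_ofBits (by simp), vS, vecBits_add]

section Parse

variable {w : Str} (hw : w.length = n * t)

include hw

theorem skipS_optionBits (o : Option (Fin n → F)) (l : List Bool) :
    skipS w (ofBits (optionBits b o ++ l)) = ofBits l := by
  cases o with
  | none => rfl
  | some u =>
    have : ofBits (optionBits b (some u) ++ l) = bit true ++ (ofBits (vecBits b u) ++ ofBits l) := by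
      simp [optionBits, ofBits, bit]
    rw [this, skipS, show ∀ z x y : Str, ifTrue (bit true ++ z) x y = x from fun _ _ _ => rfl, dropS_eq]
    change List.drop w.length (ofBits (vecBits b u) ++ ofBits l) = _
    rw [List.drop_left' (by simp [hw])]

theorem takeS_optionBits (u : Fin n → F) (l : List Bool) :
    takeS w (ofBits (optionBits b (some u) ++ l)).tail = vS b u := by
  have : ofBits (optionBits b (some u) ++ l) = bit true ++ (ofBits (vecBits b u) ++ ofBits l) := by
    simp [optionBits, ofBits, bit]
  rw [this, takeS_eq]
  change List.take w.length (ofBits (vecBits b u) ++ ofBits l) = _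
  rw [List.take_left' (by simp [hw])]
  rfl

theorem vecS_answer {a : A F n d} {i : Fin 2} {u : Fin n → F} (h : a.1 i = some u) :
    vecS i w (ofBits (answerBits b a)) = vS b u := by
  unfold answerBits vecS
  rw [List.append_assoc]
  match i with
  | 0 => rw [if_pos rfl, h, takeS_optionBits b hw]
  | 1 => rw [if_neg (by decide), skipS_optionBits b hw, h, takeS_optionBits b hw]

theorem replyS_answer (a : A F n d) :
    replyS w (ofBits (answerBits b a)) = ofBits (tagBits a.2) ++ ofBits (bodyBits b a.2) := by
  rw [replyS, answerBits, List.append_assoc, skipS_optionBits b hw, skipS_optionBits b hw,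
    replyBits_eq, ofBits_append]

theorem bodyS_answer (a : A F n d) :
    bodyS w (ofBits (answerBits b a)) = ofBits (bodyBits b a.2) := by
  rw [bodyS, replyS_answer b hw, dropS_eq]
  exact List.drop_left' (by simp [length_tagBits])

theorem shapeS_answer (a : A F n d) : shapeS w (ofBits (answerBits b a)) =
    ofBits ((a.1 0).isSome :: (a.1 1).isSome :: tagBits a.2) := by
  have h1 : ∀ (o : Option (Fin n → F)) (l : List Bool),
      takeS [none] (ofBits (optionBits b o ++ l)) = bit o.isSome := by
    intro o l
    cases o <;> simp [optionBits, ofBits, bit]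
  rw [shapeS, replyS_answer b hw, answerBits, List.append_assoc, h1, skipS_optionBits b hw, h1,
    takeS_eq, List.take_left' (by simp [length_tagBits])]
  simp [ofBits, bit]

theorem formatS_answer (c : Fin 2) (p s : Bool) (tag : List Bool) (a : A F n d) :
    formatS c p s tag w (ofBits (answerBits b a)) =
      bit (decide ((fun i => (a.1 i).isSome) = place c p s ∧ tagBits a.2 = tag)) := by
  rw [formatS, shapeS_answer b hw, eqS_eq, formatBits]
  congr 2
  rw [ofBits_injective.eq_iff, List.cons.injEq, List.cons.injEq, ← and_assoc, funext_iff, Fin.forall_fin_two]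

theorem linePointS_line (f : LineFn F n d) (l : List Bool) :
    linePointS w (ofBits (lineFnBits b f ++ l)) = vS b f.code.1 := by
  rw [linePointS, lineFnBits, takeS_eq, List.append_assoc, List.append_assoc, ofBits_append,
    List.take_left' (by simp [hw])]
  rfl

theorem lineDirS_line (f : LineFn F n d) (l : List Bool) :
    lineDirS w (ofBits (lineFnBits b f ++ l)) = vS b f.code.2.1 := by
  rw [lineDirS, lineFnBits, takeS_eq, dropS_eq, List.append_assoc, List.append_assoc, ofBits_append,
    ofBits_append, List.drop_left' (by simp [hw]), List.take_left' (by simp [hw])]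
  rfl

theorem lineCoeffS_line (f : LineFn F n d) :
    lineCoeffS w (ofBits (lineFnBits b f)) = vS b f.code.2.2 := by
  rw [lineCoeffS, lineFnBits, dropS_eq, dropS_eq, List.append_assoc, ofBits_append,
    ofBits_append, List.drop_left' (by simp [hw]), List.drop_left' (by simp [hw])]
  rfl

end Parse

section Arith

variable {sn st sd : Str} (hn : sn.length = n) (hst : st.length = t) (hd : sd.length = d)
  (ht : 0 < t)

include hst

include hn in
theorem onLineS_spec {f : LineFn F n d} {x : Fin n → F} {c : F}
    (hc : pivotS sn st (vS b f.code.2.1) (vS b x) = fS b c) :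
    onLineS sn st (tableS b) (vS b f.code.1) (vS b f.code.2.1) (vS b x) =
      open Classical in bit (decide (x = f.code.1 + c • f.code.2.1)) := by
  have h := smulS_spec b hst hn c f.code.2.1
  change smulS sn st (tableS b) (fS b c) (vS b f.code.2.1) = vS b _ at h
  rw [onLineS, hc, h, xorS_vS, eqS_eq]
  exact congrArg bit (decide_eq_decide.2 (vS_inj b))

include hd in
theorem evalS_spec {f : LineFn F n d} {x : Fin n → F} {c : F}
    (hc : pivotS sn st (vS b f.code.2.1) (vS b x) = fS b c) :
    evalS sn st sd (tableS b) (vS b f.code.2.1) (vS b f.code.2.2) (vS b x) = fS b (f.codeVal c) := by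
  have h1 : vS b f.code.2.2 = fS b (f.code.2.2 0) ++ vS b fun i => f.code.2.2 i.succ := by
    rw [vS, vecBits_succ, ofBits_append]
    rfl
  have h2 : takeS st (vS b f.code.2.2) = fS b (f.code.2.2 0) := by
    rw [h1, takeS_eq]
    exact List.take_left' (by simp [fS, hst])
  have h3 : dropS st (vS b f.code.2.2) = vS b fun i => f.code.2.2 i.succ := by
    rw [h1, dropS_eq]
    exact List.drop_left' (by simp [fS, hst])
  have h4 := powersS_spec b hst hd c
  change powersS sd st (tableS b) (fS b c) = vS b _ at h4
  have h5 := dotS_spec b hst hd (fun i => f.code.2.2 i.succ) fun i : Fin d => c ^ ((i : ℕ) + 1)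
  change dotS sd st (tableS b) (vS b _) (vS b _) = fS b _ at h5
  rw [evalS, hc, h2, h3, h4, h5, xorS_fS, LineFn.codeVal, Fin.sum_univ_succ]
  simp [dotProduct]

include hn ht

/-- At the pivot coordinate j of a normalized code, the direction is 1 and the base point is 0. So x
j is the only possible parameter of x on the line, and also the only possible factor if x is a
multiple of the direction. For direction 0 the parameter is irrelevant and 0 serves. -/
theorem exists_isParam (f : LineFn F n d) (x : Fin n → F) : ∃ c : F,
    pivotS sn st (vS b f.code.2.1) (vS b x) = fS b c ∧ f.IsParam x c ∧
      ∀ c' : F, x = c' • f.code.2.1 → x = c • f.code.2.1 := by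
  rcases f.isCode_code.1 with h | ⟨j, h1, h2, h3⟩
  · refine ⟨0, ?_, ?_, ?_⟩
    · rw [h]
      exact pivotS_zero b hst hn _
    · intro c' hc'
      simpa [h] using hc'
    · intro c' hc'
      simpa [h] using hc'
  · refine ⟨x j, ?_, ?_, ?_⟩
    · exact pivotS_ne_zero b hst hn ht (by rw [h1]; exact one_ne_zero) h2 x
    · intro c' hc'
      have : x j = c' := by rw [hc']; simp [h1, h3]
      rwa [this]
    · intro c' hc'
      have : x j = c' := by rw [hc']; simp [h1]
      rwa [this]

include hd in
theorem hasValueS_spec (f : LineFn F n d) (x : Fin n → F) (ν : F) :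
    hasValueS sn st sd (tableS b) (ofBits (lineFnBits b f)) (vS b x) (fS b ν) =
      open Classical in bit (decide (f.HasValue x ν)) := by
  classical
  have hw : (timesS sn st).length = n * t := by simp [hn, hst]
  obtain ⟨c, hc, hp, -⟩ := exists_isParam b hn hst ht f x
  have e1 := linePointS_line b hw f []
  have e2 := lineDirS_line b hw f []
  rw [List.append_nil] at e1 e2
  rw [hasValueS, e1, e2, lineCoeffS_line b hw, onLineS_spec b hn hst hc,
    evalS_spec b hst hd hc, eqS_eq, andS_bit, ← Bool.decide_and]
  congr 2
  rw [hp.hasValue_iff, fS_inj]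

/-- Two lines P + F W and u + F v coincide exactly if u lies on the first, v is a multiple of W, and
v and W vanish together. These are the three tests of `lineThroughS`; the last one excludes a point
posing as a line, and conversely. -/
theorem lineThroughS_spec (f : LineFn F n d) (u v : Fin n → F) :
    lineThroughS sn st (tableS b) (ofBits (lineFnBits b f)) (vS b u) (vS b v) =
      open Classical in bit (decide (f.line = lineThrough u v)) := by
  classical
  have hw : (timesS sn st).length = n * t := by simp [hn, hst]
  obtain ⟨c, hc, hp, -⟩ := exists_isParam b hn hst ht f u
  obtain ⟨c₂, hc₂, -, hp₂⟩ := exists_isParam b hn hst ht f v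
  have e1 := linePointS_line b hw f []
  have e2 := lineDirS_line b hw f []
  rw [List.append_nil] at e1 e2
  have h := smulS_spec b hst hn c₂ f.code.2.1
  change smulS sn st (tableS b) (fS b c₂) (vS b f.code.2.1) = vS b _ at h
  have hz : zerosS (timesS sn st) = vS b (0 : Fin n → F) := by
    rw [zerosS_eq, hw, vS, vecBits_zero]
  have hbit : ∀ p q : Bool, eqS (bit p) (bit q) = bit (decide (p = q)) := by
    intro p q
    rw [eqS_eq]
    cases p <;> cases q <;> rfl
  rw [lineThroughS, e1, e2, onLineS_spec b hn hst hc, hc₂, h, hz,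
    eqS_eq (vS b v) (vS b _), eqS_eq (vS b v) (vS b 0), eqS_eq (vS b _) (vS b 0), hbit,
    andS_bit, andS_bit, ← Bool.decide_and, ← Bool.decide_and]
  congr 2
  rw [decide_eq_decide, vS_inj, vS_inj, vS_inj, ← hp.mem_line_iff, f.isCode_code.2.1]
  apply propext
  have hline := f.isCode_code.1
  set P := f.code.1
  set W := f.code.2.1
  constructor
  · rintro ⟨⟨a, rfl⟩, h2, h3⟩
    by_cases hW : W = 0
    · have hv := h3.2 hW
      subst hv
      simp [lineThrough, hW]
    · have hv : v ≠ 0 := fun h => hW (h3.1 h)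
      have hc0 : c₂ ≠ 0 := fun h => hv (by rw [h2, h, zero_smul])
      ext x
      constructor
      · rintro ⟨z, rfl⟩
        refine ⟨(z - a) * c₂⁻¹, ?_⟩
        simp only
        rw [h2, smul_smul, mul_assoc, inv_mul_cancel₀ hc0, mul_one, add_assoc, ← add_smul]
        congr 2
        ring
      · rintro ⟨z, rfl⟩
        refine ⟨a + z * c₂, ?_⟩
        simp only
        rw [h2, smul_smul, add_assoc, ← add_smul]
  · intro heq
    have hu : u ∈ lineThrough P W := by rw [heq]; exact ⟨0, by simp⟩
    have huv : u + v ∈ lineThrough P W := by rw [heq]; exact ⟨1, by simp⟩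
    obtain ⟨a, ha⟩ := hu
    obtain ⟨a', ha'⟩ := huv
    simp only at ha ha'
    have hv : v = (a' - a) • W := by
      rw [← ha, add_assoc] at ha'
      rw [sub_smul, add_left_cancel ha']
      simp
    refine ⟨⟨a, ha⟩, hp₂ _ hv, fun h0 => ?_, fun h0 => by rw [hv, h0, smul_zero]⟩
    subst h0
    have h1 : P ∈ lineThrough u 0 := by rw [← heq]; exact ⟨0, by simp⟩
    have h2 : P + W ∈ lineThrough u 0 := by rw [← heq]; exact ⟨1, by simp⟩
    obtain ⟨z, hz⟩ := h1
    obtain ⟨z', hz'⟩ := h2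
    simp only [smul_zero, add_zero] at hz hz'
    rw [← hz] at hz'
    simpa using hz'

end Arith

end Field

theorem exists_of_slope {α : Type} {o : Fin 2 → Option α} {c : Fin 2}
    (h : (fun i => (o i).isSome) = place c false true) : ∃ v, o = place c none (some v) := by
  obtain ⟨h1, h2⟩ := isSome_eq_place h
  obtain ⟨v, hv⟩ := Option.isSome_iff_exists.1 h2
  refine ⟨v, (eq_place c).trans ?_⟩
  rw [hv, show o c = none by simpa using h1]

theorem exists_of_both {α : Type} {o : Fin 2 → Option α} {c : Fin 2}
    (h : (fun i => (o i).isSome) = place c true true) :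
    ∃ u v, o = place c (some u) (some v) := by
  obtain ⟨h1, h2⟩ := isSome_eq_place h
  obtain ⟨u, hu⟩ := Option.isSome_iff_exists.1 h1
  obtain ⟨v, hv⟩ := Option.isSome_iff_exists.1 h2
  exact ⟨u, v, (eq_place c).trans (by rw [hv, hu])⟩

theorem exists_of_point {α : Type} {o : Fin 2 → Option α} {c : Fin 2}
    (h : (fun i => (o i).isSome) = place c true false) : ∃ u, o = place c (some u) none := by
  obtain ⟨h1, h2⟩ := isSome_eq_place h
  obtain ⟨u, hu⟩ := Option.isSome_iff_exists.1 h1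
  refine ⟨u, (eq_place c).trans ?_⟩
  rw [hu, show o (other c) = none by simpa using h2]

section Field

variable {F : Type} [Field F] [Algebra (ZMod 2) F] {t n d : ℕ}
  (b : Module.Basis (Fin t) (ZMod 2) F) {sn st sd : Str} (hn : sn.length = n)
  (hst : st.length = t) (hd : sd.length = d)

include hn hst

/-- The test of the formats of two answers, followed by a further test. -/
theorem format_andS (c c' : Fin 2) (p s p' s' : Bool) (tag tag' : List Bool) (a a' : A F n d)
    (x : Str) {P : Prop} [Decidable P]
    (h : P → ((fun i => (a.1 i).isSome) = place c p s ∧ tagBits a.2 = tag) ∧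
      ((fun i => (a'.1 i).isSome) = place c' p' s' ∧ tagBits a'.2 = tag'))
    (hx : (fun i => (a.1 i).isSome) = place c p s → tagBits a.2 = tag →
      (fun i => (a'.1 i).isSome) = place c' p' s' → tagBits a'.2 = tag' → x = bit (decide P)) :
    andS (formatS c p s tag (timesS sn st) (ofBits (answerBits b a)))
      (andS (formatS c' p' s' tag' (timesS sn st) (ofBits (answerBits b a'))) x) =
        bit (decide P) := by
  have hw : (timesS sn st).length = n * t := by simp [hn, hst]
  rw [formatS_answer b hw, formatS_answer b hw, andS_bit_left, andS_bit_left]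
  by_cases h1 : (fun i => (a.1 i).isSome) = place c p s ∧ tagBits a.2 = tag
  · by_cases h2 : (fun i => (a'.1 i).isSome) = place c' p' s' ∧ tagBits a'.2 = tag'
    · rw [if_pos (by simpa using h1), if_pos (by simpa using h2)]
      exact hx h1.1 h1.2 h2.1 h2.2
    · rw [if_pos (by simpa using h1), if_neg (by simpa using h2),
        decide_eq_false fun hP => h2 (h hP).2]
  · rw [if_neg (by simpa using h1), decide_eq_false fun hP => h1 (h hP).1]

include hd in
-- Once the formats are known to be right, the vectors and the second blocks can be read off the
-- strings, and by injectivity of the codes each comparison of strings becomes an equation between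
-- the objects. `format_andS` isolates the first part.
theorem checkS_spec (ht : 0 < t) (r : Round) (a a' : A F n d) :
    checkS sn st sd (tableS b) r (ofBits (answerBits b a)) (ofBits (answerBits b a')) =
      open Classical in bit (decide (r.check a a')) := by
  classical
  have hw : (timesS sn st).length = n * t := by simp [hn, hst]
  have hl : (appS (timesS sn st) (appS (timesS sn st) (timesS (none :: sd) st))).length =
      n * t + n * t + (d + 1) * t := by simp [hn, hst, hd, Nat.add_assoc]
  have vec_pt : ∀ (c : Fin 2) (u : Fin n → F) (s : Option (Fin n → F)) (r : Reply F n d),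
      vecS c (timesS sn st) (ofBits (answerBits b (place c (some u) s, r))) = vS b u :=
    fun c u s r => vecS_answer b hw (by simp)
  have vec_sl : ∀ (c : Fin 2) (v : Fin n → F) (p : Option (Fin n → F)) (r : Reply F n d),
      vecS (other c) (timesS sn st) (ofBits (answerBits b (place c p (some v), r))) = vS b v :=
    fun c u s r => vecS_answer b hw (by simp)
  obtain ⟨o, r₁⟩ := a
  obtain ⟨o', r₂⟩ := a'
  cases r with
  | hideSurface c =>
    refine format_andS b hn hst _ _ _ _ _ _ _ _ _ _ _ ?_ ?_
    · rintro ⟨u, v, f, h1, h2, -⟩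
      rw [h1, h2]
      exact ⟨⟨isSome_place _ _, rfl⟩, ⟨isSome_place _ _, rfl⟩⟩
    · intro h1 h2 h3 h4
      obtain ⟨v, rfl⟩ := exists_of_slope h1
      obtain ⟨u', v', rfl⟩ := exists_of_both h3
      obtain ⟨f, rfl⟩ := exists_of_tag_line h2
      obtain ⟨f', rfl⟩ := exists_of_tag_line h4
      rw [vec_sl, vec_sl, vec_pt, bodyS_answer b hw, bodyS_answer b hw, bodyBits, bodyBits, eqS_eq,
        eqS_eq, lineThroughS_spec b hn hst ht, andS_bit, andS_bit, ← Bool.decide_and,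
        ← Bool.decide_and]
      refine congrArg bit (decide_eq_decide.2 ?_)
      rw [vS_inj, lineFnS_inj]
      simp only [Round.check, Prod.mk.injEq, place_inj, Reply.line.injEq, Option.some.injEq]
      grind
  | hideAnswer c =>
    refine format_andS b hn hst _ _ _ _ _ _ _ _ _ _ _ ?_ ?_
    · rintro ⟨v, f, e, h1, h2⟩
      rw [h1, h2]
      exact ⟨⟨isSome_place _ _, rfl⟩, ⟨isSome_place _ _, rfl⟩⟩
    · intro h1 h2 h3 h4
      obtain ⟨v, rfl⟩ := exists_of_slope h1
      obtain ⟨v', rfl⟩ := exists_of_slope h3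
      obtain ⟨f, rfl⟩ := exists_of_tag_line h2
      obtain ⟨f', e, rfl⟩ := exists_of_tag_lineDot h4
      rw [vec_sl, vec_sl, bodyS_answer b hw, bodyS_answer b hw, bodyBits, bodyBits, lineS, takeS_eq,
        hl, ofBits_append, List.take_left' (by simp), eqS_eq,
        eqS_eq, andS_bit, ← Bool.decide_and]
      refine congrArg bit (decide_eq_decide.2 ?_)
      rw [vS_inj, lineFnS_inj]
      simp only [Round.check, Prod.mk.injEq, place_inj, Reply.line.injEq, Option.some.injEq,
        Reply.lineDot.injEq]
      grind
  | hideBasis c =>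
    refine format_andS b hn hst _ _ _ _ _ _ _ _ _ _ _ ?_ ?_
    · rintro ⟨u, v, h1, h2⟩
      rw [h1, h2]
      exact ⟨⟨isSome_place _ _, rfl⟩, ⟨isSome_place _ _, rfl⟩⟩
    · intro h1 h2 h3 h4
      obtain ⟨u, v, rfl⟩ := exists_of_both h1
      obtain ⟨v', rfl⟩ := exists_of_slope h3
      obtain rfl := eq_of_tag_empty h2
      obtain ⟨e, rfl⟩ := exists_of_tag_dot h4
      have hdot := dotS_spec b hst hn v u
      change dotS sn st (tableS b) (vS b v) (vS b u) = fS b _ at hdot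
      rw [vec_sl, vec_sl, vec_pt, bodyS_answer b hw, bodyBits, hdot, eqS_eq,
        eqS_eq, andS_bit, ← Bool.decide_and]
      refine congrArg bit (decide_eq_decide.2 ?_)
      rw [vS_inj, ← fS, fS_inj]
      simp only [Round.check, Prod.mk.injEq, place_inj, Reply.dot.injEq, Option.some.injEq]
      grind
  | hideDot c =>
    refine format_andS b hn hst _ _ _ _ _ _ _ _ _ _ _ ?_ ?_
    · rintro ⟨v, v', f, e, h1, h2⟩
      rw [h1, h2]
      exact ⟨⟨isSome_place _ _, rfl⟩, ⟨isSome_place _ _, rfl⟩⟩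
    · intro h1 h2 h3 h4
      obtain ⟨v, rfl⟩ := exists_of_slope h1
      obtain ⟨v', rfl⟩ := exists_of_slope h3
      obtain ⟨f, e, rfl⟩ := exists_of_tag_lineDot h2
      obtain ⟨e', rfl⟩ := exists_of_tag_dot h4
      rw [bodyS_answer b hw, bodyS_answer b hw, bodyBits, bodyBits, lineDotS, dropS_eq,
        hl, ofBits_append, List.drop_left' (by simp), eqS_eq]
      refine congrArg bit (decide_eq_decide.2 ?_)
      rw [← fS, ← fS, fS_inj]
      simp only [Round.check, Prod.mk.injEq, place_inj, Reply.dot.injEq, Option.some.injEq,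
        Reply.lineDot.injEq]
      grind
  | cross c =>
    refine format_andS b hn hst _ _ _ _ _ _ _ _ _ _ _ ?_ ?_
    · rintro ⟨u, v, f, ν, h1, h2, -⟩
      rw [h1, h2]
      exact ⟨⟨isSome_place _ _, rfl⟩, ⟨isSome_place _ _, rfl⟩⟩
    · intro h1 h2 h3 h4
      obtain ⟨v, rfl⟩ := exists_of_slope h1
      obtain ⟨u, rfl⟩ := exists_of_point h3
      obtain ⟨f, rfl⟩ := exists_of_tag_line h2
      obtain ⟨ν, rfl⟩ := exists_of_tag_value h4
      rw [vec_pt, bodyS_answer b hw, bodyS_answer b hw, bodyBits, bodyBits, ← fS,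
        hasValueS_spec b hn hst hd ht]
      refine congrArg bit (decide_eq_decide.2 ?_)
      simp only [Round.check, Prod.mk.injEq, place_inj, Reply.line.injEq, Option.some.injEq,
        Reply.value.injEq]
      grind
  | intersect =>
    refine format_andS b hn hst _ _ _ _ _ _ _ _ _ _ _ ?_ ?_
    · rintro ⟨u, v, f, f', ν, h1, h2, -⟩
      rw [h1, h2]
      exact ⟨⟨isSome_place _ _, rfl⟩, ⟨isSome_place _ _, rfl⟩⟩
    · intro h1 h2 h3 h4
      obtain ⟨v, rfl⟩ := exists_of_slope h1
      obtain ⟨u, rfl⟩ := exists_of_slope h3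
      obtain ⟨f, rfl⟩ := exists_of_tag_line h2
      obtain ⟨f', rfl⟩ := exists_of_tag_line h4
      have e1 := linePointS_line b hw f []
      have e2 := lineDirS_line b hw f []
      rw [List.append_nil] at e1 e2
      obtain ⟨c, hc, hp, -⟩ := exists_isParam b hn hst ht f (u + v)
      have e3 := vec_sl 1 u none (.line f')
      have e4 := vec_sl 0 v none (.line f)
      rw [show other 1 = 0 from rfl] at e3
      rw [show other 0 = 1 from rfl] at e4
      rw [e3, e4,
        bodyS_answer b hw, bodyS_answer b hw, bodyBits, bodyBits,
        e1, e2, lineCoeffS_line b hw, xorS_vS, onLineS_spec b hn hst hc, evalS_spec b hst hd hc,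
        hasValueS_spec b hn hst hd ht, andS_bit, ← Bool.decide_and]
      refine congrArg bit (decide_eq_decide.2 ?_)
      -- The common value in the check is forced to be the value of f at u + v, which removes the
      -- existential quantifier; the procedure computes this value and tests f' against it.
      have hval : ∀ ν, f.HasValue (u + v) ν ↔ u + v = f.code.1 + c • f.code.2.1 ∧ ν = f.codeVal c :=
        hp.hasValue_iff
      simp only [Round.check, Prod.mk.injEq, place_inj, Reply.line.injEq, Option.some.injEq]
      constructor
      · rintro ⟨h1, h2⟩
        exact ⟨u, v, f, f', _, ⟨⟨trivial, rfl⟩, rfl⟩, ⟨⟨trivial, rfl⟩, rfl⟩, (hval _).2 ⟨h1, rfl⟩, h2⟩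
      · rintro ⟨u', v', f₁, f₂, ν, ⟨⟨-, rfl⟩, rfl⟩, ⟨⟨-, rfl⟩, rfl⟩, h1, h2⟩
        obtain ⟨h3, rfl⟩ := (hval _).1 h1
        exact ⟨h3, h2⟩
  | consistency =>
    refine format_andS b hn hst _ _ _ _ _ _ _ _ _ _ _ ?_ ?_
    · rintro ⟨u, v, ν, h1, h2⟩
      rw [h1, h2]
      exact ⟨⟨isSome_place _ _, rfl⟩, ⟨isSome_place _ _, rfl⟩⟩
    · intro h1 h2 h3 h4
      obtain ⟨u, rfl⟩ := exists_of_point h1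
      obtain ⟨u', rfl⟩ := exists_of_point h3
      obtain ⟨e, rfl⟩ := exists_of_tag_value h2
      obtain ⟨e', rfl⟩ := exists_of_tag_value h4
      rw [bodyS_answer b hw, bodyS_answer b hw, bodyBits, bodyBits, eqS_eq]
      refine congrArg bit (decide_eq_decide.2 ?_)
      rw [← fS, ← fS, fS_inj]
      simp only [Round.check, Prod.mk.injEq, place_inj, Reply.value.injEq, Option.some.injEq]
      grind

end Field

theorem mem_rounds (r : Round) : r ∈ rounds := by
  rcases r with c | c | c | c | c | _ | _ <;> (try fin_cases c) <;> simp [rounds]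

theorem length_questionBits (x : Q) : (questionBits x).length = 8 := by
  obtain ⟨w, c, q⟩ := x
  have h : ∀ p : PauliQuery, p.bits.length = 2 := by rintro (_ | _ | _ | _) <;> rfl
  have h' : q.bits.length = 3 := by rcases q with _ | _ | _ | _ | _ <;> rfl
  simp [questionBits, h, h']

theorem questionBits_injective : Injective questionBits := by
  rintro ⟨w, c, q⟩ ⟨w', c', q'⟩ h
  have hb : ∀ p p' : PauliQuery, p.bits = p'.bits → p = p' := by
    rintro (_ | _ | _ | _) (_ | _ | _ | _) <;> simp [PauliQuery.bits]
  have hb' : ∀ p p' : AuxQuery, p.bits = p'.bits → p = p' := by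
    rintro (_ | _ | _ | _ | _) (_ | _ | _ | _ | _) <;> simp [AuxQuery.bits]
  have hl : ∀ p : PauliQuery, p.bits.length = 2 := by rintro (_ | _ | _ | _) <;> rfl
  unfold questionBits at h
  obtain ⟨h1, h2⟩ := List.append_inj h (by simp [hl])
  obtain ⟨h3, h4⟩ := List.append_inj h1 (by simp [hl])
  obtain ⟨h5, h6⟩ := List.append_inj h3 (by simp [hl])
  have hc : c = c' := by
    have : ∀ c c' : Fin 2, [decide (c = 1)] = [decide (c' = 1)] → c = c' := by decide
    exact this _ _ h4
  have hw : w = w' := by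
    funext i
    match i with
    | 0 => exact hb _ _ h5
    | 1 => exact hb _ _ h6
  have hq : q = q' := hb' _ _ h2
  rw [hw, hc, hq]

theorem questionBits_append_inj {x y x' y' : Q} :
    ofBits (questionBits x ++ questionBits y) = ofBits (questionBits x' ++ questionBits y') ↔
      x = x' ∧ y = y' := by
  constructor
  · intro h
    obtain ⟨h1, h2⟩ := List.append_inj (ofBits_injective h) (by simp [length_questionBits])
    exact ⟨questionBits_injective h1, questionBits_injective h2⟩
  · rintro ⟨rfl, rfl⟩
    rfl

section Field

variable {F : Type} [Field F] [Algebra (ZMod 2) F] {t n d : ℕ}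
  (b : Module.Basis (Fin t) (ZMod 2) F)

include b in
theorem pos_of_basis : 0 < t := by
  rcases Nat.eq_zero_or_pos t with rfl | h
  · have := b.repr.toEquiv.subsingleton
    exact absurd (Subsingleton.elim (0 : F) 1) zero_ne_one
  · exact h

theorem verdictS_spec {sn st sd : Str} (hn : sn.length = n) (hst : st.length = t)
    (hd : sd.length = d) (x₀ x₁ : Q) (a₀ a₁ : A F n d) (l : List Round) :
    verdictS sn st sd (tableS b) (ofBits (questionBits x₀ ++ questionBits x₁))
      (ofBits (answerBits b a₀)) (ofBits (answerBits b a₁)) l =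
      open Classical in bit (decide (∃ r ∈ l, (r.questions = (x₀, x₁) ∧ r.check a₀ a₁) ∨
        (r.questions = (x₁, x₀) ∧ r.check a₁ a₀))) := by
  classical
  have ht := pos_of_basis b
  induction l with
  | nil => simp [verdictS]
  | cons r l ih =>
    unfold verdictS at ih
    rw [verdictS, List.foldr_cons, ih, checkS_spec b hn hst hd ht, checkS_spec b hn hst hd ht,
      eqS_eq, eqS_eq, andS_bit, andS_bit, orS_bit, orS_bit]
    congr 1
    rw [Bool.eq_iff_iff]
    have hq : ∀ x y, r.questions = (x, y) ↔ x = r.questions.1 ∧ y = r.questions.2 := fun x y => by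
      rw [Prod.eq_iff_fst_eq_snd_eq, eq_comm, eq_comm (a := r.questions.2)]
    simp only [Bool.or_eq_true, Bool.and_eq_true, decide_eq_true_eq, questionBits_append_inj,
      List.mem_cons, exists_eq_or_imp, hq, and_comm (a := x₁ = r.questions.1)]

theorem decideS_spec (x₀ x₁ : Q) (a₀ a₁ : A F n d) :
    decideS (joinStrings (inputStrings b n d ++
      [questionBits x₀, questionBits x₁, answerBits b a₀, answerBits b a₁])) =
      open Classical in bit (decide ((introIntersect F n d).accepts x₀ x₁ a₀ a₁)) := by
  have hj : joinStrings (inputStrings b n d ++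
      [questionBits x₀, questionBits x₁, answerBits b a₀, answerBits b a₁]) =
      ofBits (List.replicate n true) ++ none :: (ofBits (List.replicate t true) ++ none ::
        (ofBits (List.replicate d true) ++ none :: (tableS b ++ none ::
          (ofBits (questionBits x₀) ++ none :: (ofBits (questionBits x₁) ++ none ::
            (ofBits (answerBits b a₀) ++ none :: ofBits (answerBits b a₁))))))) := by
    simp only [inputStrings, List.cons_append, List.nil_append]
    iterate 7 rw [joinStrings_cons _ _ (List.cons_ne_nil _ _)]
    rw [joinStrings_singleton]
    rfl
  have hT : ∀ z, fieldS (tableS b ++ none :: z) = tableS b := fun z => fieldS_ofBits_append _ _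
  have hT' : ∀ z, restS (tableS b ++ none :: z) = z := fun z => restS_ofBits_append _ _
  rw [hj, decideS]
  simp only [Function.iterate_succ, Function.iterate_zero, Function.comp_apply, id,
    restS_ofBits_append, fieldS_ofBits_append, hT, hT', fieldS_ofBits, appS_eq, ← ofBits_append]
  rw [verdictS_spec b (by simp) (by simp) (by simp)]
  congr 2
  simp [mem_rounds, introIntersect]

end Field

/-! ### Lengths of the codes and the running time of the decision -/

theorem Polynomial.exists_eval_le (P : Polynomial ℕ) :
    ∃ C, ∀ M, 1 ≤ M → P.eval M ≤ C * M ^ C := by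
  induction P using Polynomial.induction_on' with
  | add p q hp hq =>
    obtain ⟨A, hA⟩ := hp
    obtain ⟨B, hB⟩ := hq
    refine ⟨A + B, fun M hM => ?_⟩
    rw [Polynomial.eval_add, add_mul]
    exact Nat.add_le_add
      ((hA M hM).trans (Nat.mul_le_mul_left _ (Nat.pow_le_pow_right hM (Nat.le_add_right _ _))))
      ((hB M hM).trans (Nat.mul_le_mul_left _ (Nat.pow_le_pow_right hM (Nat.le_add_left _ _))))
  | monomial k c =>
    refine ⟨c + k, fun M hM => ?_⟩
    rw [Polynomial.eval_monomial]
    exact Nat.mul_le_mul (Nat.le_add_right _ _) (Nat.pow_le_pow_right hM (Nat.le_add_left _ _))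

section Field

variable {F : Type} [Field F] [Algebra (ZMod 2) F] {t n d : ℕ} (b : Module.Basis (Fin t) (ZMod 2) F)

theorem length_answerBits_le (hn : 0 < n) (a : A F n d) :
    (answerBits b a).length ≤ 12 * (n * t + d * t) := by
  have ht := pos_of_basis b
  have h1 : t ≤ n * t := Nat.le_mul_of_pos_left t hn
  have ho : ∀ o : Option (Fin n → F), (optionBits b o).length ≤ 1 + n * t := by
    rintro (_ | u) <;> simp [optionBits, Nat.add_comm]
  have hr : ∀ r : Reply F n d, (replyBits b r).length ≤ 3 + 2 * (n * t) + d * t + 2 * t := by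
    rintro (f | ⟨f, e⟩ | _ | e | ν) <;> simp [replyBits, lineFnBits, add_mul] <;> omega
  have := ho (a.1 0)
  have := ho (a.1 1)
  have := hr a.2
  -- The total is at most 5 + 4nt + dt + 2t, and 1 ≤ t ≤ nt.
  simp only [answerBits, List.length_append]
  omega

/-- The cubic term is the multiplication table, with t bits for each of t² products; all other parts
of the input are linear. -/
theorem length_input_le (hn : 0 < n) (x₀ x₁ : Q) (a₀ a₁ : A F n d) :
    (joinStrings (inputStrings b n d ++
      [questionBits x₀, questionBits x₁, answerBits b a₀, answerBits b a₁])).length ≤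
      (n * t + d * t) ^ 3 + 50 * (n * t + d * t) := by
  have ht := pos_of_basis b
  have h1 : t ≤ n * t := Nat.le_mul_of_pos_left t hn
  have h2 : n ≤ n * t := Nat.le_mul_of_pos_right n ht
  have h3 : d ≤ d * t := Nat.le_mul_of_pos_right d ht
  have h4 := length_answerBits_le b hn a₀
  have h5 := length_answerBits_le b hn a₁
  have h6 : t * (t * t) ≤ (n * t + d * t) ^ 3 := by
    calc t * (t * t) = t ^ 3 := by ring
      _ ≤ _ := Nat.pow_le_pow_left (by omega) 3
  have h7 : (List.ofFn fun i => (List.ofFn fun j => fieldBits b (b i * b j)).flatten).flatten.length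
      = t * (t * t) := length_flatten_ofFn fun i => length_flatten_ofFn fun j => length_fieldBits b _
  simp only [inputStrings, List.cons_append, List.nil_append]
  iterate 7 rw [joinStrings_cons _ _ (List.cons_ne_nil _ _)]
  rw [joinStrings_singleton]
  simp only [List.length_append, List.length_cons, length_ofBits, List.length_replicate, h7,
    length_questionBits]
  omega

end Field

theorem exists_decides : ∃ (D : TM2ComputableAux (Option Bool) Bool) (C : ℕ),
    ∀ (F : Type) [Field F] [Algebra (ZMod 2) F] (t n d : ℕ)
      (b : Module.Basis (Fin t) (ZMod 2) F), 0 < n → 0 < d →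
      Decides D b (C * (n * t + d * t) ^ C) (introIntersect F n d) := by
  -- Input on stack 0, result on stack 1 and work space from 2 on, as `Prog.machine` expects.
  obtain ⟨p, P, hp⟩ := (PT.proj (m := 1) 0).decideS (fun _ => 0) 1 2 (by simp) (by simp) (by simp)
  obtain ⟨C, hC⟩ := Polynomial.exists_eval_le
    -- The inner polynomial is the bound on the input length, and the added 1 is the final step of
    -- the machine.
    (P.comp (Polynomial.X ^ 3 + 50 * Polynomial.X) + 1)
  refine ⟨Prog.decider p, C, fun F _ _ t n d b hn hd x₀ x₁ a₀ a₁ => ?_⟩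
  set inp := joinStrings (inputStrings b n d ++
    [questionBits x₀, questionBits x₁, answerBits b a₀, answerBits b a₁]) with hinp
  obtain ⟨T, hT, hle⟩ := hp (update (fun _ => []) 0 inp) (by simp)
    (fun k hk => by rw [update_of_ne (by omega)])
  have h := Prog.haltsWithin_decider hT
  have hout : (update (update (fun _ => []) 0 inp) 1
      (decideS (update (fun _ => ([] : Str)) 0 inp 0)) 1).head? = some (some
        (open Classical in decide ((introIntersect F n d).accepts x₀ x₁ a₀ a₁))) := by
    rw [update_self, update_self, hinp, decideS_spec]
    rfl
  rw [hout] at h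
  have hM : 1 ≤ n * t + d * t :=
    Nat.succ_le_of_lt (Nat.add_pos_left (Nat.mul_pos hn (pos_of_basis b)) _)
  have hbound : T + 1 ≤ C * (n * t + d * t) ^ C := by
    refine le_trans ?_ (hC _ hM)
    rw [Polynomial.eval_add, Polynomial.eval_comp, Polynomial.eval_one]
    refine Nat.add_le_add_right (hle.trans (eval_mono P ?_)) 1
    simpa using length_input_le b hn x₀ x₁ a₀ a₁
  obtain ⟨c', h1, h2, ⟨h3⟩⟩ := h
  refine ⟨c', h1, h2.trans ?_, ⟨⟨h3.toEvalsTo, h3.steps_le_m.trans hbound⟩⟩⟩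
  simp

/-! ### The randomized machine that samples the questions -/

namespace Sampler

/-- The stack alphabets: input, output and coins. -/
abbrev Alph : Fin 3 → Type := ![Option Bool, Option Bool, Bool]

abbrev Stmt : Type := TM2.Stmt Alph Unit (Fin 6 → Bool)

/-- Pops coins into the given places of the memory. -/
def popCoins (l : List (Fin 6)) (q : Stmt) : Stmt :=
  l.foldr (fun i q => .pop (2 : Fin 3) (fun v x => update v i (Option.getD (α := Bool) x false)) q) q

/-- Pushes the string `out v 0, …, out v (m - 1)`, which depends on the memory `v`. -/
def pushString (out : (Fin 6 → Bool) → ℕ → Option Bool) : ℕ → Stmt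
  | 0 => .halt
  | m + 1 => .push (1 : Fin 3) (fun v => out v m) (pushString out m)

theorem stepAux_popCoins (r : Fin 6 → Bool) (l : List (Fin 6)) (q : Stmt) (v : Fin 6 → Bool)
    (S : ∀ k, List (Alph k)) :
    TM2.stepAux (popCoins l q) v (update S 2 (l.map r : List Bool)) =
      TM2.stepAux q (fun i => if i ∈ l then r i else v i) (update S 2 ([] : List Bool)) := by
  induction l generalizing v with
  | nil => simp [popCoins]
  | cons i l ih =>
    have h0 : TM2.stepAux (popCoins (i :: l) q) v
        (update S 2 ((i :: l).map r : List Bool)) = TM2.stepAux (popCoins l q) (update v i (r i))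
          (update S 2 (l.map r : List Bool)) := by
      have h1 : update S 2 ((i :: l).map r : List Bool) 2 = (r i :: l.map r : List Bool) :=
        update_self _ _ _
      rw [popCoins, List.foldr_cons, TM2.stepAux.eq_def]
      dsimp only
      rw [h1]
      exact congrArg (TM2.stepAux (popCoins l q) (update v i (r i))) (update_idem _ _ _)
    rw [h0, ih]
    congr 1
    funext j
    by_cases hj : j = i
    · subst hj; simp
    · simp [hj]

theorem map_range_succ_append {α : Type} (f : ℕ → α) (m : ℕ) (l : List α) :
    (List.range (m + 1)).map f ++ l = (List.range m).map f ++ f m :: l := by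
  simp [List.range_succ]

theorem stepAux_pushString (out : (Fin 6 → Bool) → ℕ → Option Bool) (m : ℕ) (v : Fin 6 → Bool)
    (S : ∀ k, List (Alph k)) :
    TM2.stepAux (pushString out m) v S =
      ⟨none, v, update S 1 (List.map (β := Alph 1) (out v) (List.range m) ++ S 1)⟩ := by
  induction m generalizing S with
  | zero =>
    simp only [pushString, TM2.stepAux]
    congr 1
    exact (update_eq_self _ _).symm
  | succ m ih =>
    rw [pushString, TM2.stepAux.eq_def]
    dsimp only
    rw [ih, update_idem, update_self]
    exact congrArg (fun L => (⟨none, v, update S 1 L⟩ : TM2.Cfg Alph Unit (Fin 6 → Bool)))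
      (map_range_succ_append (α := Alph 1) (out v) m (S 1)).symm

/-- The machine that pops the coins and pushes a string of length `m` that depends on them. -/
def machine (out : (Fin 6 → Bool) → ℕ → Option Bool) (m : ℕ) : FinTM2 where
  K := Fin 3
  k₀ := 0
  k₁ := 1
  Γ := Alph
  Λ := Unit
  main := ()
  σ := Fin 6 → Bool
  initialState := fun _ => false
  Γk₀Fin := inferInstanceAs (Fintype (Option Bool))
  m := fun _ => popCoins (List.finRange 6) (pushString out m)

/-- The randomized machine, with its alphabets. -/
def coinMachine (out : (Fin 6 → Bool) → ℕ → Option Bool) (m : ℕ) :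
    CoinMachine (Option Bool) (Option Bool) where
  tm := machine out m
  inputAlphabet := Equiv.refl _
  outputAlphabet := Equiv.refl _
  kc := (2 : Fin 3)
  kc_ne := show (2 : Fin 3) ≠ 0 by decide
  coinAlphabet := Equiv.refl _

/-- All pops and pushes belong to one label, so the machine halts after a single step. The bound 6
appears because `CoinMachine.Samples` uses one number both for the coins and for the time. -/
theorem haltsWithin_coinMachine (out : (Fin 6 → Bool) → ℕ → Option Bool) (m : ℕ)
    (inp : List (Option Bool)) (r : Fin 6 → Bool) :
    HaltsWithin (coinMachine out m).tm (initCoins (coinMachine out m).tm (coinMachine out m).kc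
        (inp.map (coinMachine out m).inputAlphabet.symm)
        ((List.ofFn r).map (coinMachine out m).coinAlphabet.symm))
      (((List.range m).map (out r)).map (coinMachine out m).outputAlphabet.symm) 6 := by
  let S : ∀ k, List (Alph k) := update (fun _ => []) (0 : Fin 3) inp
  let S' : ∀ k, List (Alph k) := update S 2 ([] : List Bool)
  refine ⟨(⟨none, r, update S' 1 (List.map (β := Alph 1) (out r) (List.range m) ++ S' 1)⟩ :
    TM2.Cfg Alph Unit (Fin 6 → Bool)), rfl, ?_, ⟨⟨⟨1, ?_⟩, by norm_num⟩⟩⟩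
  · have h : S' 1 = [] := rfl
    have h' : update S' 1 (List.map (β := Alph 1) (out r) (List.range m) ++ S' 1) 1 =
        List.map (β := Alph 1) (out r) (List.range m) := by
      rw [update_self, h, List.append_nil]
    exact h'.trans (List.map_id _).symm
  · have hinit : initCoins (coinMachine out m).tm (coinMachine out m).kc
        (inp.map (coinMachine out m).inputAlphabet.symm)
        ((List.ofFn r).map (coinMachine out m).coinAlphabet.symm) =
        (⟨some (), fun _ => false, update S 2 ((List.finRange 6).map r : List Bool)⟩ :
          TM2.Cfg Alph Unit (Fin 6 → Bool)) := by
      have h1 : inp.map (coinMachine out m).inputAlphabet.symm = inp := List.map_id _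
      have h2 : (List.ofFn r).map (coinMachine out m).coinAlphabet.symm =
        ((List.finRange 6).map r : List Bool) := (List.map_id _).trans (List.ofFn_eq_map)
      rw [initCoins, h1, h2]
      rfl
    rw [hinit]
    refine congrArg some ((stepAux_popCoins r _ _ _ S).trans ?_)
    rw [stepAux_pushString]
    simp only [List.mem_finRange, if_true]
    rfl

end Sampler

/-- The questions of the test, as a function of the seed. -/
def seedQuestions (s : Fin 4 × Bool × Fin 4 × Bool) : Q × Q :=
  let x := (drawRound s.1 s.2.1 s.2.2.1).questions
  if s.2.2.2 then x else x.swap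

theorem exists_samples : ∃ (R : CoinMachine (Option Bool) (Option Bool)) (T : ℕ),
    ∀ (F : Type) [Field F] [Algebra (ZMod 2) F] (t n d : ℕ)
      (b : Module.Basis (Fin t) (ZMod 2) F), 0 < n → 0 < d →
      R.Samples (joinStrings (inputStrings b n d)) T (introIntersect F n d) := by
  -- There are 4·2·4·2 = 64 seeds; any bijection with six bits carries uniform coins to a uniform
  -- seed.
  have e : (Fin 6 → Bool) ≃ Fin 4 × Bool × Fin 4 × Bool := Fintype.equivOfCardEq (by simp)
  let str : (Fin 6 → Bool) → List (Option Bool) := fun r =>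
    joinStrings [questionBits (seedQuestions (e r)).1, questionBits (seedQuestions (e r)).2]
  -- Two questions of 8 bits and a separator. A fixed length lets the output be a finite table
  -- indexed by the coins.
  have hlen : ∀ r, (str r).length = 17 := fun r => by
    simp only [str]
    rw [joinStrings_cons _ _ (List.cons_ne_nil _ _), joinStrings_singleton]
    simp [length_questionBits]
  have hstr : ∀ r, (List.range 17).map (fun i => (str r).getD i none) = str r := fun r => by
    rw [← hlen r]
    refine List.ext_getElem (by simp) fun i h1 h2 => ?_
    simp [h2]
  refine ⟨Sampler.coinMachine (fun r i => (str r).getD i none) 17, 6, fun F _ _ t n d b _ _ =>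
    ⟨fun r => seedQuestions (e r), fun r => ?_, fun x => ?_⟩⟩
  · have h := Sampler.haltsWithin_coinMachine (fun r i => (str r).getD i none) 17
      (joinStrings (inputStrings b n d)) r
    rw [hstr] at h
    exact h
  · have hc : Nat.card {r // seedQuestions (e r) = x} =
        Nat.card {s // (introIntersect F n d).ask s = x} :=
      Nat.card_congr (e.subtypeEquiv fun r => Iff.rfl)
    have hs : (Fintype.card (introIntersect F n d).Seed : ℝ) = 2 ^ 6 := by
      have : Fintype.card (Fin 4 × Bool × Fin 4 × Bool) = 64 := by simp
      change ((Fintype.card (Fin 4 × Bool × Fin 4 × Bool) : ℕ) : ℝ) = _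
      rw [this]
      norm_num
    rw [hc, hs]

/-! ### The Frobenius inner product and projective measurements -/

section Frobenius

open Matrix

open scoped Classical

variable {ι A B K : Type} [Fintype ι] [Fintype A] [Fintype B] [Fintype K]

/-- The real part of the Frobenius inner product. -/
noncomputable def ip (X Y : Matrix ι ι ℂ) : ℝ := (Xᴴ * Y).trace.re

/-- The square of the Frobenius norm. -/
noncomputable def fr (X : Matrix ι ι ℂ) : ℝ := ip X X

theorem fr_eq_sum (X : Matrix ι ι ℂ) : fr X = ∑ i, ∑ j, ‖X i j‖ ^ 2 := by
  have h : ∀ z : ℂ, (star z * z).re = ‖z‖ ^ 2 := fun z => by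
    rw [← Complex.normSq_eq_norm_sq, Complex.normSq_apply]
    simp [Complex.mul_re]
  simp only [fr, ip, trace, Matrix.diag_apply, mul_apply, conjTranspose_apply, Complex.re_sum, h]
  exact Finset.sum_comm

theorem fr_nonneg (X : Matrix ι ι ℂ) : 0 ≤ fr X := by
  rw [fr_eq_sum]
  positivity

theorem eq_zero_of_fr_eq_zero {X : Matrix ι ι ℂ} (h : fr X = 0) : X = 0 := by
  rw [fr_eq_sum, Finset.sum_eq_zero_iff_of_nonneg fun i _ => by positivity] at h
  ext i j
  have h1 := h i (Finset.mem_univ _)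
  rw [Finset.sum_eq_zero_iff_of_nonneg fun i _ => by positivity] at h1
  simpa using h1 j (Finset.mem_univ _)

@[simp] theorem fr_zero : fr (0 : Matrix ι ι ℂ) = 0 := by simp [fr, ip]

theorem fr_transpose (X : Matrix ι ι ℂ) : fr Xᵀ = fr X := by
  rw [fr_eq_sum, fr_eq_sum, Finset.sum_comm]
  rfl

theorem fr_mul_eq_transpose (X Y : Matrix ι ι ℂ) : fr (X * Y) = fr (Yᵀ * Xᵀ) := by
  rw [← fr_transpose, transpose_mul]

theorem ip_comm (X Y : Matrix ι ι ℂ) : ip X Y = ip Y X := by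
  have h : (Yᴴ * X).trace = star (Xᴴ * Y).trace := by
    rw [← trace_conjTranspose, conjTranspose_mul, conjTranspose_conjTranspose]
  rw [ip, ip, h, Complex.star_def, Complex.conj_re]

theorem ip_add_right (X Y Z : Matrix ι ι ℂ) : ip X (Y + Z) = ip X Y + ip X Z := by
  simp [ip, mul_add]

theorem ip_sub_right (X Y Z : Matrix ι ι ℂ) : ip X (Y - Z) = ip X Y - ip X Z := by
  simp [ip, mul_sub]

theorem ip_sum_right (X : Matrix ι ι ℂ) (Y : A → Matrix ι ι ℂ) :
    ip X (∑ a, Y a) = ∑ a, ip X (Y a) := by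
  simp [ip, Finset.mul_sum, trace_sum]

theorem ip_zero_right (X : Matrix ι ι ℂ) : ip X 0 = 0 := by simp [ip]

theorem ip_mul_left (P X Y : Matrix ι ι ℂ) : ip (P * X) Y = ip X (Pᴴ * Y) := by
  rw [ip, ip, conjTranspose_mul, mul_assoc]

theorem ip_mul_right (Q X Y : Matrix ι ι ℂ) : ip (X * Q) Y = ip X (Y * Qᴴ) := by
  rw [ip, ip, conjTranspose_mul, mul_assoc, trace_mul_comm, mul_assoc]

theorem fr_sub (X Y : Matrix ι ι ℂ) : fr (X - Y) = fr X + fr Y - 2 * ip X Y := by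
  rw [fr, ip_sub_right, ip_comm _ X, ip_comm _ Y, ip_sub_right, ip_sub_right, ip_comm Y X]
  simp only [fr]
  ring

theorem fr_add (X Y : Matrix ι ι ℂ) : fr (X + Y) = fr X + fr Y + 2 * ip X Y := by
  rw [fr, ip_add_right, ip_comm _ X, ip_comm _ Y, ip_add_right, ip_add_right, ip_comm Y X]
  simp only [fr]
  ring

theorem fr_add_le (X Y : Matrix ι ι ℂ) : fr (X + Y) ≤ 2 * fr X + 2 * fr Y := by
  have h1 := fr_add X Y
  have h2 := fr_sub X Y
  have h3 := fr_nonneg (X - Y)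
  linarith

theorem fr_sub_comm (X Y : Matrix ι ι ℂ) : fr (X - Y) = fr (Y - X) := by
  rw [fr_sub, fr_sub, ip_comm]
  ring

/-- The triangle inequality along a path with five vertices. -/
theorem fr_path_le (X₀ X₁ X₂ X₃ X₄ : Matrix ι ι ℂ) :
    fr (X₀ - X₄) ≤ 4 * (fr (X₀ - X₁) + fr (X₁ - X₂) + fr (X₂ - X₃) + fr (X₃ - X₄)) := by
  have h1 := fr_add_le (X₀ - X₁) (X₁ - X₂)
  have h2 := fr_add_le (X₂ - X₃) (X₃ - X₄)
  have h3 := fr_add_le (X₀ - X₁ + (X₁ - X₂)) (X₂ - X₃ + (X₃ - X₄))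
  rw [show X₀ - X₁ + (X₁ - X₂) + (X₂ - X₃ + (X₃ - X₄)) = X₀ - X₄ by abel] at h3
  linarith

/-- Multiplication by an isometry. -/
theorem fr_isometry_mul [DecidableEq ι] {U : Matrix ι ι ℂ} (hU : Uᴴ * U = 1) (X : Matrix ι ι ℂ) :
    fr (U * X) = fr X := by
  rw [fr, ip_mul_left, ← mul_assoc, hU, one_mul, fr]

theorem fr_mul_isometry [DecidableEq ι] {U : Matrix ι ι ℂ} (hU : U * Uᴴ = 1) (X : Matrix ι ι ℂ) :
    fr (X * U) = fr X := by
  rw [fr, ip_mul_right, mul_assoc, hU, mul_one, fr]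

theorem ip_proj_left {P : Matrix ι ι ℂ} (h1 : Pᴴ = P) (h2 : P * P = P) (X Y : Matrix ι ι ℂ) :
    ip (P * X) Y = ip (P * X) (P * Y) := by
  rw [ip_mul_left, ip_mul_left, h1, ← mul_assoc, h2]

theorem ip_proj_right {P : Matrix ι ι ℂ} (h1 : Pᴴ = P) (h2 : P * P = P) (X Y : Matrix ι ι ℂ) :
    ip (X * P) Y = ip (X * P) (Y * P) := by
  rw [ip_mul_right, ip_mul_right, h1, mul_assoc, h2]

/-- Two vectors that arise from `Ψ` by projections on both sides, one of which is finer on the left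
and one on the right. -/
theorem ip_eq_fr {P R Q T : Matrix ι ι ℂ} (hP : Pᴴ = P) (hP' : P * P = P) (hQ : Qᴴ = Q)
    (hQ' : Q * Q = Q) (hR : P * R = P) (hT : T * Q = Q) (Ψ : Matrix ι ι ℂ) :
    ip (P * Ψ * T) (R * Ψ * Q) = fr (P * Ψ * Q) := by
  rw [mul_assoc P, ip_proj_left hP hP', ← mul_assoc P, ← mul_assoc P, ← mul_assoc P, hR, ip_comm,
    ip_proj_right hQ hQ', mul_assoc _ T Q, hT, fr]

/-- Families of vectors of norm at most one with a large inner product are close. -/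
theorem sum_fr_sub_le {x y : K → Matrix ι ι ℂ} {γ : ℝ} (hx : ∑ k, fr (x k) ≤ 1)
    (hy : ∑ k, fr (y k) ≤ 1) (h : 1 - γ ≤ ∑ k, ip (x k) (y k)) :
    ∑ k, fr (x k - y k) ≤ 2 * γ := by
  simp only [fr_sub, Finset.sum_sub_distrib, Finset.sum_add_distrib, ← Finset.mul_sum]
  linarith

/-- Consistency is transitive along z', z, x, y. The three squared distances are at most 2c, 2b and
2a, and the triangle inequality costs a factor 4. To return from a distance to an inner product,
lower bounds 1 - 2c and 1 - 2a for the norms of z' and y are needed; they follow from the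
nonnegativity of the outer two distances. Half of 2a + 2c + 8(a + b + c) gives the constants. -/
theorem one_sub_le_sum_ip {x y z z' : K → Matrix ι ι ℂ} {a b c : ℝ} (hx : ∑ k, fr (x k) ≤ 1)
    (hy : ∑ k, fr (y k) ≤ 1) (hz : ∑ k, fr (z k) ≤ 1) (hz' : ∑ k, fr (z' k) ≤ 1)
    (ha : 1 - a ≤ ∑ k, ip (x k) (y k)) (hb : 1 - b ≤ ∑ k, ip (x k) (z k))
    (hc : 1 - c ≤ ∑ k, ip (z' k) (z k)) :
    1 - (5 * a + 4 * b + 5 * c) ≤ ∑ k, ip (z' k) (y k) := by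
  have h1 := sum_fr_sub_le hx hy ha
  have h2 := sum_fr_sub_le hx hz hb
  have h3 := sum_fr_sub_le hz' hz hc
  have h4 : ∑ k, fr (z' k - y k) ≤ 4 * (∑ k, fr (z' k - z k) + ∑ k, fr (x k - z k) +
      ∑ k, fr (x k - y k)) := by
    rw [← Finset.sum_add_distrib, ← Finset.sum_add_distrib, Finset.mul_sum]
    refine Finset.sum_le_sum fun k _ => ?_
    have := fr_path_le (z' k) (z k) (x k) (y k) (y k)
    rw [sub_self, fr_zero, fr_sub_comm (z k), add_zero] at this
    exact this
  have h5 : 0 ≤ ∑ k, fr (x k - y k) := Finset.sum_nonneg fun k _ => fr_nonneg _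
  have h6 : 0 ≤ ∑ k, fr (z' k - z k) := Finset.sum_nonneg fun k _ => fr_nonneg _
  have h7 : ∑ k, fr (z' k - y k) =
      ∑ k, fr (z' k) + ∑ k, fr (y k) - 2 * ∑ k, ip (z' k) (y k) := by
    simp only [fr_sub, Finset.sum_sub_distrib, Finset.sum_add_distrib, ← Finset.mul_sum]
  simp only [fr_sub, Finset.sum_sub_distrib, Finset.sum_add_distrib, ← Finset.mul_sum] at h5 h6
  linarith

/-! ### Projective measurements and their coarse-grainings. -/

/-- A family of hermitian projections whose sum is the identity. -/
structure IsPVM [DecidableEq ι] (M : A → Matrix ι ι ℂ) : Prop where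
  herm : ∀ a, (M a)ᴴ = M a
  idem : ∀ a, M a * M a = M a
  sum : ∑ a, M a = 1

/-- The sum of the elements of a measurement with outcomes in a set. -/
noncomputable def part (M : A → Matrix ι ι ℂ) (S : A → Prop) : Matrix ι ι ℂ :=
  ∑ a, if S a then M a else 0

omit [Fintype ι] in
theorem part_transpose (M : A → Matrix ι ι ℂ) (S : A → Prop) :
    part (fun a => (M a)ᵀ) S = (part M S)ᵀ := by
  rw [part, part, transpose_sum]
  refine Finset.sum_congr rfl fun a _ => ?_
  split_ifs <;> simp

omit [Fintype ι] in
theorem part_eq (M : A → Matrix ι ι ℂ) (a : A) : part M (fun a' => a' = a) = M a := by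
  simp [part]

theorem sum_fibers {α : Type} [AddCommMonoid α] (p : A → K) [∀ a k, Decidable (p a = k)]
    (g : A → α) : ∑ k, ∑ a, (if p a = k then g a else 0) = ∑ a, g a := by
  rw [Finset.sum_comm]
  refine Finset.sum_congr rfl fun a _ => ?_
  rw [Finset.sum_eq_single (p a) (fun k _ hk => if_neg hk.symm) (by simp), if_pos rfl]

namespace IsPVM

variable [DecidableEq ι] {M : A → Matrix ι ι ℂ} {N : B → Matrix ι ι ℂ}

theorem of_isProjMeas (h : IsProjMeas M) : IsPVM M :=
  ⟨fun a => (h.1.1 a).isHermitian, h.2, h.1.2⟩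

theorem transpose (h : IsPVM M) : IsPVM fun a => (M a)ᵀ where
  herm a := by
    change ((M a)ᴴ)ᵀ = _
    rw [h.herm]
  idem a := by rw [← transpose_mul, h.idem]
  sum := by rw [← transpose_sum, h.sum, transpose_one]

/-- Pythagoras for the decomposition of X by the projectors; orthogonality is not needed, only
idempotence and the sum. -/
theorem sum_fr_mul (h : IsPVM M) (X : Matrix ι ι ℂ) : ∑ a, fr (M a * X) = fr X := by
  have : ∀ a, fr (M a * X) = ip X (M a * X) := fun a => by
    rw [fr, ip_mul_left, h.herm, ← mul_assoc, h.idem]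
  simp only [this]
  rw [← ip_sum_right, ← Finset.sum_mul, h.sum, one_mul, fr]

/-- Apply Pythagoras to the projector M b itself: its component in b already carries the full norm,
so nothing is left for the other components. -/
theorem mul_of_ne (h : IsPVM M) {a b : A} (hab : a ≠ b) : M a * M b = 0 := by
  refine eq_zero_of_fr_eq_zero ?_
  have h1 := h.sum_fr_mul (M b)
  rw [← Finset.add_sum_erase _ _ (Finset.mem_univ b), h.idem, add_eq_left,
    Finset.sum_eq_zero_iff_of_nonneg fun _ _ => fr_nonneg _] at h1
  exact h1 a (Finset.mem_erase.2 ⟨hab, Finset.mem_univ _⟩)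

theorem part_mul_part (h : IsPVM M) (S T : A → Prop) :
    part M S * part M T = part M fun a => S a ∧ T a := by
  simp only [part, Finset.sum_mul, Finset.mul_sum]
  refine Finset.sum_congr rfl fun a _ => ?_
  rw [Finset.sum_eq_single a]
  · by_cases h1 : S a <;> by_cases h2 : T a <;> simp [h1, h2, h.idem]
  · intro b _ hb
    split_ifs <;> simp [h.mul_of_ne hb]
  · simp

theorem part_herm (h : IsPVM M) (S : A → Prop) : (part M S)ᴴ = part M S := by
  rw [part, conjTranspose_sum]
  refine Finset.sum_congr rfl fun a _ => ?_
  split_ifs <;> simp [h.herm]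

theorem part_idem (h : IsPVM M) (S : A → Prop) : part M S * part M S = part M S := by
  rw [h.part_mul_part]
  simp

theorem part_commute (h : IsPVM M) (S T : A → Prop) :
    part M S * part M T = part M T * part M S := by
  rw [h.part_mul_part, h.part_mul_part]
  simp only [and_comm]

theorem coarse (h : IsPVM M) (p : A → K) : IsPVM fun k => part M fun a => p a = k where
  herm _ := h.part_herm _
  idem _ := h.part_idem _
  sum := by
    simp only [part]
    rw [sum_fibers, h.sum]

theorem fr_part_mul (h : IsPVM M) (S : A → Prop) (X : Matrix ι ι ℂ) :
    fr (part M S * X) = ∑ a, if S a then fr (M a * X) else 0 := by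
  rw [fr, ip_mul_left, h.part_herm, ← mul_assoc, h.part_idem, part, Finset.sum_mul, ip_sum_right]
  refine Finset.sum_congr rfl fun a _ => ?_
  split_ifs
  · rw [fr, ip_mul_left, h.herm, ← mul_assoc, h.idem]
  · rw [zero_mul, ip_zero_right]

theorem sum_fr_mul_right (h : IsPVM N) (X : Matrix ι ι ℂ) : ∑ b, fr (X * N b) = fr X := by
  rw [← fr_transpose X, ← h.transpose.sum_fr_mul]
  exact Finset.sum_congr rfl fun b _ => fr_mul_eq_transpose _ _

theorem fr_mul_part (h : IsPVM N) (S : B → Prop) (X : Matrix ι ι ℂ) :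
    fr (X * part N S) = ∑ b, if S b then fr (X * N b) else 0 := by
  rw [fr_mul_eq_transpose, ← part_transpose, h.transpose.fr_part_mul]
  simp only [fr_mul_eq_transpose X]

theorem sum_sum_fr (hM : IsPVM M) (hN : IsPVM N) (Ψ : Matrix ι ι ℂ) :
    ∑ a, ∑ b, fr (M a * Ψ * N b) = fr Ψ := by
  simp only [hN.sum_fr_mul_right, hM.sum_fr_mul]

end IsPVM

/-! ### Rejection weights, observables and approximate commutation. -/

/-- The weight of the pairs of outcomes that do not satisfy a relation. -/
noncomputable def bad (M : A → Matrix ι ι ℂ) (N : B → Matrix ι ι ℂ) (Ψ : Matrix ι ι ℂ)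
    (S : A → B → Prop) : ℝ :=
  ∑ a, ∑ b, if S a b then 0 else fr (M a * Ψ * N b)

theorem bad_mono (M : A → Matrix ι ι ℂ) (N : B → Matrix ι ι ℂ) (Ψ : Matrix ι ι ℂ)
    {S T : A → B → Prop} (h : ∀ a b, S a b → T a b) : bad M N Ψ T ≤ bad M N Ψ S := by
  refine Finset.sum_le_sum fun a _ => Finset.sum_le_sum fun b _ => ?_
  by_cases hS : S a b
  · rw [if_pos hS, if_pos (h a b hS)]
  · rw [if_neg hS]
    split_ifs
    · exact fr_nonneg _
    · exact le_rfl

theorem bad_nonneg (M : A → Matrix ι ι ℂ) (N : B → Matrix ι ι ℂ) (Ψ : Matrix ι ι ℂ)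
    (S : A → B → Prop) : 0 ≤ bad M N Ψ S :=
  Finset.sum_nonneg fun a _ => Finset.sum_nonneg fun b _ => by
    split_ifs
    · exact le_rfl
    · exact fr_nonneg _

/-- Transposition exchanges the two players, so each statement about one side yields its mirror
image. -/
theorem bad_transpose (M : A → Matrix ι ι ℂ) (N : B → Matrix ι ι ℂ) (Ψ : Matrix ι ι ℂ)
    (S : A → B → Prop) :
    bad (fun b => (N b)ᵀ) (fun a => (M a)ᵀ) Ψᵀ (fun b a => S a b) = bad M N Ψ S := by
  rw [bad, bad, Finset.sum_comm]
  refine Finset.sum_congr rfl fun a _ => Finset.sum_congr rfl fun b _ => ?_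
  rw [← transpose_mul, ← transpose_mul, fr_transpose, mul_assoc]

section

variable [DecidableEq ι] {M : A → Matrix ι ι ℂ} {N : B → Matrix ι ι ℂ}

theorem good_eq (hM : IsPVM M) (hN : IsPVM N) {Ψ : Matrix ι ι ℂ} (hΨ : fr Ψ = 1)
    (S : A → B → Prop) :
    ∑ a, ∑ b, (if S a b then fr (M a * Ψ * N b) else 0) = 1 - bad M N Ψ S := by
  rw [← hΨ, ← hM.sum_sum_fr hN, bad, ← Finset.sum_sub_distrib]
  refine Finset.sum_congr rfl fun a _ => ?_
  rw [← Finset.sum_sub_distrib]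
  refine Finset.sum_congr rfl fun b _ => ?_
  split_ifs <;> simp

theorem fr_part_mul_part (hM : IsPVM M) (hN : IsPVM N) (Ψ : Matrix ι ι ℂ) (S : A → Prop)
    (T : B → Prop) :
    fr (part M S * Ψ * part N T) =
      ∑ a, ∑ b, if S a ∧ T b then fr (M a * Ψ * N b) else 0 := by
  rw [mul_assoc, hM.fr_part_mul]
  refine Finset.sum_congr rfl fun a _ => ?_
  by_cases h : S a
  · simp only [h, if_true, true_and]
    rw [← mul_assoc, hN.fr_mul_part]
  · simp [h]

omit [DecidableEq ι] in
theorem bad_injective_le {C : Type} [Fintype C] (M : A → Matrix ι ι ℂ) (N : B → Matrix ι ι ℂ)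
    (Ψ : Matrix ι ι ℂ) (S : A → B → Prop) {e : C → A} (he : Injective e) :
    bad (fun c => M (e c)) N Ψ (fun c b => S (e c) b) ≤ bad M N Ψ S := by
  rw [bad, bad, ← Finset.sum_image (s := Finset.univ) (g := e)
    (f := fun a => ∑ b, if S a b then 0 else fr (M a * Ψ * N b)) fun _ _ _ _ h => he h]
  exact Finset.sum_le_sum_of_subset_of_nonneg (Finset.subset_univ _) fun a _ _ =>
    Finset.sum_nonneg fun b _ => by
      split_ifs
      · exact le_rfl
      · exact fr_nonneg _

omit [DecidableEq ι] in
theorem bad_equiv {C : Type} [Fintype C] (M : A → Matrix ι ι ℂ) (N : B → Matrix ι ι ℂ)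
    (Ψ : Matrix ι ι ℂ) (S : A → B → Prop) (e : C ≃ A) :
    bad (fun c => M (e c)) N Ψ (fun c b => S (e c) b) = bad M N Ψ S :=
  Fintype.sum_equiv e _ _ fun _ => rfl

theorem bad_coarse_right (M : A → Matrix ι ι ℂ) (hN : IsPVM N) (Ψ : Matrix ι ι ℂ) (q : B → K)
    (S : A → K → Prop) :
    bad M (fun k => part N fun b => q b = k) Ψ S = bad M N Ψ fun a b => S a (q b) := by
  refine Finset.sum_congr rfl fun a _ => ?_
  rw [← sum_fibers q]
  refine Finset.sum_congr rfl fun k _ => ?_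
  rw [hN.fr_mul_part]
  by_cases h : S a k
  · rw [if_pos h]
    refine (Finset.sum_eq_zero fun b _ => ?_).symm
    by_cases hb : q b = k
    · rw [if_pos hb, if_pos (show S a (q b) by rwa [hb])]
    · rw [if_neg hb]
  · rw [if_neg h]
    refine Finset.sum_congr rfl fun b _ => ?_
    by_cases hb : q b = k
    · rw [if_pos hb, if_pos hb, if_neg (show ¬ S a (q b) by rwa [hb])]
    · rw [if_neg hb, if_neg hb]

theorem bad_coarse_left (hM : IsPVM M) (N : B → Matrix ι ι ℂ) (Ψ : Matrix ι ι ℂ) (p : A → K)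
    (S : K → B → Prop) :
    bad (fun k => part M fun a => p a = k) N Ψ S = bad M N Ψ fun a b => S (p a) b := by
  rw [← bad_transpose, ← bad_transpose M]
  simp only [← part_transpose]
  exact bad_coarse_right _ hM.transpose _ p _

/-- Parts of a measurement that are disjoint have a total weight of at most one. -/
theorem sum_fr_part_mul_le {C : Type} [Fintype C] (hM : IsPVM M) (S : K → A → Prop) (g : K → C)
    (Y : C → Matrix ι ι ℂ) (h : ∀ a k l, S k a → S l a → g k = g l → k = l) :
    ∑ k, fr (part M (S k) * Y (g k)) ≤ ∑ c, fr (Y c) := by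
  have h1 : ∀ c, fr (Y c) = ∑ a, fr (M a * Y c) := fun c => (hM.sum_fr_mul _).symm
  simp only [hM.fr_part_mul, h1]
  rw [Finset.sum_comm, Finset.sum_comm (s := Finset.univ (α := C))]
  refine Finset.sum_le_sum fun a _ => ?_
  rw [← sum_fibers g]
  refine Finset.sum_le_sum fun c _ => ?_
  -- By assumption, for fixed a and c at most one k contributes.
  by_cases hk : ∃ k, g k = c ∧ S k a
  · obtain ⟨k, rfl, hk⟩ := hk
    rw [Finset.sum_eq_single k, if_pos rfl, if_pos hk]
    · intro l _ hl
      by_cases hg : g l = g k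
      · rw [if_pos hg, if_neg fun hS => hl (h a l k hS hk hg)]
      · rw [if_neg hg]
    · simp
  · rw [Finset.sum_eq_zero]
    · exact fr_nonneg _
    · intro k _
      by_cases hg : g k = c
      · rw [if_pos hg, if_neg fun hS => hk ⟨k, hg, hS⟩]
      · rw [if_neg hg]

theorem sum_fr_mul_part_le {C : Type} [Fintype C] (hN : IsPVM N) (S : K → B → Prop) (g : K → C)
    (Y : C → Matrix ι ι ℂ) (h : ∀ b k l, S k b → S l b → g k = g l → k = l) :
    ∑ k, fr (Y (g k) * part N (S k)) ≤ ∑ c, fr (Y c) := by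
  have := sum_fr_part_mul_le hN.transpose S g (fun c => (Y c)ᵀ) h
  simpa only [fr_mul_eq_transpose (Y _), ← part_transpose, fr_transpose] using this

/-- Consistent measurements of the two players are close. -/
theorem sum_fr_sub_le_bad (hM : IsPVM M) (hN : IsPVM N) {Ψ : Matrix ι ι ℂ} (hΨ : fr Ψ = 1)
    (p : A → K) (q : B → K) (S : A → B → Prop) (h : ∀ a b, S a b → p a = q b) :
    ∑ k, fr ((part M fun a => p a = k) * Ψ - Ψ * part N fun b => q b = k) ≤
      2 * bad M N Ψ S := by
  have hP := hM.coarse p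
  have hQ := hN.coarse q
  refine sum_fr_sub_le (by rw [hP.sum_fr_mul, hΨ]) (by rw [hQ.sum_fr_mul_right, hΨ]) ?_
  have h1 : ∀ k, ip ((part M fun a => p a = k) * Ψ) (Ψ * part N fun b => q b = k) =
      ∑ l, if k = l then
        fr ((part M fun a => p a = k) * Ψ * part N fun b => q b = l) else 0 := fun k => by
    have := ip_eq_fr (hP.herm k) (hP.idem k) (hQ.herm k) (hQ.idem k) (mul_one _) (one_mul _) Ψ
    rw [mul_one, one_mul] at this
    rw [this]
    simp
  simp only [h1]
  rw [good_eq hP hQ hΨ, bad_coarse_left hM, bad_coarse_right _ hN]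
  linarith [bad_mono M N Ψ h]

/-- The observable `∑ₐ (-1)^(p a) M a`. -/
noncomputable def obs (M : A → Matrix ι ι ℂ) (p : A → ZMod 2) : Matrix ι ι ℂ :=
  (part M fun a => p a = 0) - part M fun a => p a = 1

theorem obs_herm (hM : IsPVM M) (p : A → ZMod 2) : (obs M p)ᴴ = obs M p := by
  rw [obs, conjTranspose_sub, hM.part_herm, hM.part_herm]

theorem obs_mul_obs (hM : IsPVM M) (p : A → ZMod 2) : obs M p * obs M p = 1 := by
  have h := hM.coarse p
  have hs := h.sum
  rw [show (Finset.univ : Finset (ZMod 2)) = {0, 1} from rfl,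
    Finset.sum_pair (zero_ne_one)] at hs
  rw [obs, sub_mul, mul_sub, mul_sub, h.idem 0, h.idem 1, h.mul_of_ne (a := 0) (b := 1) (by decide),
    h.mul_of_ne (a := 1) (b := 0) (by decide), ← hs]
  abel

theorem obs_commute_part (hM : IsPVM M) (p : A → ZMod 2) (S : A → Prop) :
    obs M p * part M S = part M S * obs M p := by
  rw [obs, sub_mul, mul_sub, hM.part_commute _ S, hM.part_commute _ S]

/-- The two halves of the observables differ by the two terms of `sum_fr_sub_le_bad`; splitting the
square of their sum doubles its constant 2. -/
theorem fr_obs_sub_le (hM : IsPVM M) (hN : IsPVM N) {Ψ : Matrix ι ι ℂ} (hΨ : fr Ψ = 1)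
    (p : A → ZMod 2) (q : B → ZMod 2) (S : A → B → Prop) (h : ∀ a b, S a b → p a = q b) :
    fr (obs M p * Ψ - Ψ * obs N q) ≤ 4 * bad M N Ψ S := by
  have h1 := sum_fr_sub_le_bad hM hN hΨ p q S h
  rw [show (Finset.univ : Finset (ZMod 2)) = {0, 1} from rfl,
    Finset.sum_pair (zero_ne_one)] at h1
  have h2 := fr_add_le ((part M fun a => p a = 0) * Ψ - Ψ * part N fun b => q b = 0)
    (Ψ * (part N fun b => q b = 1) - (part M fun a => p a = 1) * Ψ)
  rw [fr_sub_comm (Ψ * (part N fun b => q b = 1))] at h2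
  rw [show obs M p * Ψ - Ψ * obs N q = ((part M fun a => p a = 0) * Ψ - Ψ * part N fun b => q b = 0)
    + (Ψ * (part N fun b => q b = 1) - (part M fun a => p a = 1) * Ψ) by
      rw [obs, obs, sub_mul, mul_sub]; abel]
  linarith

/-- The shift lemma: if the measurement `L` of Bob approximately commutes with the symmetry `U` of
the state, then an error bound for `L` and a measurement of Alice is inherited by the shifted
measurement of Alice. -/
theorem bad_shift_le {C : Type} [Fintype C] {L : B → Matrix ι ι ℂ} {J : C → Matrix ι ι ℂ}
    (hJ : IsPVM J) {U Ψ : Matrix ι ι ℂ} (hU : Uᴴ = U) (hU' : U * U = 1) {η : ℝ}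
    (hc : ∑ b, fr (U * Ψ * L b - Ψ * L b * U) ≤ η) (S : C → B → Prop) :
    bad (fun c => U * J c * U) L Ψ S ≤ 2 * bad J L Ψ S + 2 * η := by
  -- The outer U is an isometry and drops out. Inside, UΨL is replaced by ΨLU, where the right-hand
  -- U is again an isometry and drops out, and the commutator remains as the error.
  have h1 : ∀ c b, fr (U * J c * U * Ψ * L b) ≤
      2 * fr (J c * Ψ * L b) + 2 * fr (J c * (U * Ψ * L b - Ψ * L b * U)) := by
    intro c b
    have := fr_add_le (J c * Ψ * L b * U) (J c * (U * Ψ * L b - Ψ * L b * U))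
    rw [fr_mul_isometry (by rw [hU, hU'])] at this
    refine le_trans (le_of_eq ?_) this
    rw [mul_assoc, mul_assoc, mul_assoc, mul_assoc, fr_isometry_mul (by rw [hU, hU'])]
    congr 1
    simp only [mul_sub, mul_assoc]
    abel
  have h2 : ∑ c, ∑ b, fr (J c * (U * Ψ * L b - Ψ * L b * U)) ≤ η := by
    rw [Finset.sum_comm]
    simpa only [hJ.sum_fr_mul] using hc
  calc bad (fun c => U * J c * U) L Ψ S
      ≤ ∑ c, ∑ b, (2 * (if S c b then 0 else fr (J c * Ψ * L b)) +
          2 * fr (J c * (U * Ψ * L b - Ψ * L b * U))) := by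
        refine Finset.sum_le_sum fun c _ => Finset.sum_le_sum fun b _ => ?_
        split_ifs
        · have := fr_nonneg (J c * (U * Ψ * L b - Ψ * L b * U))
          linarith
        · exact h1 c b
    _ = 2 * bad J L Ψ S + 2 * ∑ c, ∑ b, fr (J c * (U * Ψ * L b - Ψ * L b * U)) := by
        simp only [Finset.sum_add_distrib, ← Finset.mul_sum, bad]
    _ ≤ _ := by linarith

/-- A measurement `L` that is consistent with a measurement `L'` of the other player commutes
approximately with `U`, if `U` is close to an observable `E` that commutes with `L'`. -/
theorem sum_fr_commutator_le {L L' : B → Matrix ι ι ℂ} (hL : IsPVM L) (hL' : IsPVM L')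
    {U E Ψ : Matrix ι ι ℂ} (hU : Uᴴ = U) (hU' : U * U = 1) (hΨ : U * Ψ = Ψ * U)
    (hE : Eᴴ = E) (hE' : E * E = 1) (hEL : ∀ b, E * L' b = L' b * E) {β β' : ℝ}
    (h1 : ∑ b, fr (L' b * Ψ - Ψ * L b) ≤ β) (h2 : fr (U * Ψ - E * Ψ) ≤ β') :
    ∑ b, fr (U * Ψ * L b - Ψ * L b * U) ≤ 8 * β + 8 * β' := by
  have key : ∀ b, fr (U * Ψ * L b - Ψ * L b * U) ≤ 4 * (fr ((U * Ψ - E * Ψ) * L b) +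
      fr (L' b * Ψ - Ψ * L b) + fr (L' b * (U * Ψ - E * Ψ)) + fr (L' b * Ψ - Ψ * L b)) := by
    intro b
    -- The path replaces U by E, then Bob's L by Alice's L'; E and L' commute exactly, so E can be
    -- turned back into U, which passes through Ψ to the right, and L' finally becomes L again.
    have h := fr_path_le (U * Ψ * L b) (E * Ψ * L b) (E * L' b * Ψ) (L' b * U * Ψ) (Ψ * L b * U)
    have e1 : fr (E * Ψ * L b - E * L' b * Ψ) = fr (L' b * Ψ - Ψ * L b) := by
      rw [mul_assoc, mul_assoc, ← mul_sub, fr_isometry_mul (by rw [hE, hE']), fr_sub_comm]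
    have e2 : fr (E * L' b * Ψ - L' b * U * Ψ) = fr (L' b * (U * Ψ - E * Ψ)) := by
      rw [hEL, fr_sub_comm, mul_sub, ← mul_assoc, ← mul_assoc]
    have e3 : fr (L' b * U * Ψ - Ψ * L b * U) = fr (L' b * Ψ - Ψ * L b) := by
      rw [mul_assoc, hΨ, ← mul_assoc, ← sub_mul, fr_mul_isometry (by rw [hU, hU'])]
    rwa [← sub_mul, e1, e2, e3] at h
  refine (Finset.sum_le_sum fun b _ => key b).trans ?_
  rw [← Finset.mul_sum]
  simp only [Finset.sum_add_distrib, hL.sum_fr_mul_right, hL'.sum_fr_mul]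
  linarith

end

end Frobenius

/-! ### The shared state and the honest measurements -/

section States

set_option linter.unusedSectionVars false

open Matrix

open scoped Classical

/-- A bipartite state as a matrix. -/
def stateMat {ι : Type} (ψ : ι × ι → ℂ) : Matrix ι ι ℂ := Matrix.of fun a b => ψ (a, b)

section

variable {ι A : Type} [Fintype ι] [Fintype A]

/-- The correspondence between bipartite vectors and matrices, by which Alice acts from the left and
Bob, transposed, from the right. All estimates are made in this form. -/
theorem kronecker_mulVec_apply (P Q : Matrix ι ι ℂ) (ψ : ι × ι → ℂ) (i j : ι) :
    ((P ⊗ₖ Q).mulVec ψ) (i, j) = (P * stateMat ψ * Qᵀ) i j := by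
  simp only [mulVec, dotProduct, kroneckerMap_apply, Fintype.sum_prod_type, mul_apply, stateMat,
    of_apply, transpose_apply, Finset.sum_mul]
  rw [Finset.sum_comm]
  refine Finset.sum_congr rfl fun k _ => Finset.sum_congr rfl fun l _ => ?_
  ring

theorem jointProb_eq (ψ : ι × ι → ℂ) {P Q : Matrix ι ι ℂ} (hP : Pᴴ = P) (hP' : P * P = P)
    (hQ : Qᴴ = Q) (hQ' : Q * Q = Q) :
    jointProb ψ P Q = fr (P * stateMat ψ * Qᵀ) := by
  have h1 : jointProb ψ P Q = ip (stateMat ψ) (P * stateMat ψ * Qᵀ) := by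
    simp only [jointProb, ip, dotProduct, Fintype.sum_prod_type, kronecker_mulVec_apply, trace,
      Matrix.diag_apply]
    rw [Finset.sum_comm]
    congr 1
  have hQt : (Qᵀ)ᴴ = Qᵀ := by
    change (Qᴴ)ᵀ = _
    rw [hQ]
  have hQt' : Qᵀ * Qᵀ = Qᵀ := by rw [← transpose_mul, hQ']
  rw [h1, ip_comm, ip_proj_right hQt hQt', mul_assoc, ip_proj_left hP hP', ← mul_assoc, fr]

theorem stateDist_eq [DecidableEq ι] (ψ : ι × ι → ℂ) (M N : A → Matrix ι ι ℂ) :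
    stateDist ψ M N = ∑ a, fr (M a * stateMat ψ - N a * stateMat ψ) := by
  refine Finset.sum_congr rfl fun a _ => ?_
  rw [Fintype.sum_prod_type]
  simp only [kronecker_mulVec_apply]
  rw [transpose_one, mul_one, sub_mul, fr_eq_sum]

theorem fr_kronecker {κ : Type} [Fintype κ] (X : Matrix ι ι ℂ) (Y : Matrix κ κ ℂ) :
    fr (X ⊗ₖ Y : Matrix (ι × κ) (ι × κ) ℂ) = fr X * fr Y := by
  simp only [fr, ip, conjTranspose_kronecker, ← mul_kronecker_mul, trace_kronecker]
  rw [Complex.mul_re]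
  have h : ∀ (μ : Type) [Fintype μ] (Z : Matrix μ μ ℂ), (Zᴴ * Z).trace.im = 0 := by
    intro μ _ Z
    have h1 : (Zᴴ * Z).trace = star (Zᴴ * Z).trace := by
      rw [← trace_conjTranspose, conjTranspose_mul, conjTranspose_conjTranspose]
    exact Complex.conj_eq_iff_im.1 h1.symm
  rw [h, h, mul_zero, sub_zero]

end

section Registers

variable {F : Type} [Field F] [Fintype F] [DecidableEq F] {n : ℕ} {aux : Type} [Fintype aux]
  [DecidableEq aux]

/-- The honest measurement of whether the contents of the registers have a property. -/
noncomputable def zProj (aux : Type) [DecidableEq aux] (S : (Fin 2 → Fin n → F) → Prop) :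
    Matrix ((Fin 2 → Fin n → F) × aux) ((Fin 2 → Fin n → F) × aux) ℂ :=
  diagonal (fun x => if S x then 1 else 0) ⊗ₖ (1 : Matrix aux aux ℂ)

theorem zProj_mul_zProj (S T : (Fin 2 → Fin n → F) → Prop) :
    zProj aux S * zProj aux T = zProj aux fun x => S x ∧ T x := by
  rw [zProj, zProj, ← mul_kronecker_mul, diagonal_mul_diagonal, one_mul, zProj]
  congr 2
  funext x
  by_cases h1 : S x <;> by_cases h2 : T x <;> simp [h1, h2]

theorem zProj_transpose (S : (Fin 2 → Fin n → F) → Prop) :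
    (zProj aux S)ᵀ = zProj aux S := by
  rw [zProj, ← kroneckerMap_transpose, diagonal_transpose, transpose_one]

theorem zProj_herm (S : (Fin 2 → Fin n → F) → Prop) : (zProj aux S)ᴴ = zProj aux S := by
  rw [zProj, conjTranspose_kronecker, diagonal_conjTranspose, conjTranspose_one]
  congr 2
  funext x
  by_cases h : S x <;> simp [h]

theorem isPVM_zProj (c : Fin 2) :
    IsPVM fun u : Fin n → F => zProj aux fun x => x c = u where
  herm _ := zProj_herm _
  idem _ := by rw [zProj_mul_zProj]; simp
  sum := by
    ext ⟨x, a⟩ ⟨y, b⟩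
    rw [Matrix.sum_apply]
    by_cases h : x = y
    · subst h
      rw [Finset.sum_eq_single (x c) (fun u _ hu => by simp [zProj, Ne.symm hu]) (by simp)]
      simp [zProj, one_apply]
    · simp [zProj, kroneckerMap_apply, h]

theorem eq_iff_place {T : Type} (c : Fin 2) (x y : Fin 2 → T) :
    x = y ↔ x c = y c ∧ x (other c) = y (other c) := by
  constructor
  · rintro rfl
    exact ⟨rfl, rfl⟩
  · intro h
    funext i
    fin_cases c <;> fin_cases i <;> first | exact h.1 | exact h.2

theorem prod_place (c : Fin 2) (g : Fin 2 → ℂ) : ∏ i, g i = g c * g (other c) := by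
  fin_cases c
  · exact Fin.prod_univ_two g
  · exact (Fin.prod_univ_two g).trans (mul_comm _ _)

theorem tauZ_apply (u x y : Fin n → F) : tauZ u x y = if x = y ∧ x = u then 1 else 0 := by
  rw [tauZ, vecMulVec_apply, ketZ, Pi.star_apply]
  by_cases h1 : x = u
  · subst h1
    by_cases h2 : y = x
    · subst h2; simp
    · simp [h2, Ne.symm h2]
  · simp [h1]

/-- The honest measurement of one register in the `Z` basis. -/
theorem tensor_tauZ (c : Fin 2) (u : Fin n → F) (Q : Matrix aux aux ℂ) :
    tensor (place c (tauZ u) 1) Q = diagonal (fun x => if x c = u then 1 else 0) ⊗ₖ Q := by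
  ext ⟨x, a⟩ ⟨y, b⟩
  simp only [tensor, of_apply, kroneckerMap_apply]
  congr 1
  rw [prod_place c, place_self, place_other, tauZ_apply, one_apply, diagonal_apply]
  simp only [eq_iff_place c x]
  by_cases h1 : x c = y c <;> by_cases h2 : x (other c) = y (other c) <;> simp [h1, h2]

theorem tensor_tauZ_one (c : Fin 2) (u : Fin n → F) :
    tensor (place c (tauZ u) 1) (1 : Matrix aux aux ℂ) = zProj aux fun x => x c = u := by
  rw [tensor_tauZ, zProj]
  congr!

variable [Algebra (ZMod 2) F]

theorem tensor_pauliProj (c : Fin 2) (W W' : PauliQuery) (p s : Option (Fin n → F))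
    (Q : Matrix aux aux ℂ) :
    tensor (fun i => pauliProj (place c W W' i) (place c p s i)) Q =
      tensor (place c (pauliProj W p) (pauliProj W' s)) Q := by
  congr 1
  funext i
  simp only [place]
  split_ifs <;> rfl

theorem place_swap {T : Type} (c : Fin 2) (p s : T) : place c p s = place (other c) s p := by
  funext i
  fin_cases c <;> fin_cases i <;> rfl

/-- Adding the content of the slope register of copy `c` to its point register. -/
def shift (c : Fin 2) (x : Fin 2 → Fin n → F) : Fin 2 → Fin n → F :=
  place c (x c + x (other c)) (x (other c))

theorem add_self_eq_zero' (v : Fin n → F) : v + v = 0 := by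
  have : CharP F 2 := charP_of_injective_algebraMap (algebraMap (ZMod 2) F).injective 2
  funext i
  exact CharTwo.add_self_eq_zero _

theorem shift_shift (c : Fin 2) (x : Fin 2 → Fin n → F) : shift c (shift c x) = x := by
  rw [eq_iff_place c]
  simp [shift, add_assoc, add_self_eq_zero']

/-- The permutation matrix of `shift c`. -/
noncomputable def shiftMat (aux : Type) [DecidableEq aux] (c : Fin 2) :
    Matrix ((Fin 2 → Fin n → F) × aux) ((Fin 2 → Fin n → F) × aux) ℂ :=
  (Matrix.of fun x y => if shift c x = y then 1 else 0) ⊗ₖ (1 : Matrix aux aux ℂ)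

theorem shift_eq_comm (c : Fin 2) (x y : Fin 2 → Fin n → F) : shift c x = y ↔ shift c y = x := by
  constructor <;> rintro rfl <;> exact shift_shift c _

theorem shiftMat_transpose (c : Fin 2) :
    (shiftMat aux c : Matrix ((Fin 2 → Fin n → F) × aux) _ ℂ)ᵀ = shiftMat aux c := by
  rw [shiftMat, ← kroneckerMap_transpose, transpose_one]
  congr 1
  ext x y
  simp only [transpose_apply, of_apply, shift_eq_comm c y]

theorem shiftMat_herm (c : Fin 2) :
    (shiftMat aux c : Matrix ((Fin 2 → Fin n → F) × aux) _ ℂ)ᴴ = shiftMat aux c := by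
  rw [shiftMat, conjTranspose_kronecker, conjTranspose_one]
  congr 1
  ext x y
  simp only [conjTranspose_apply, of_apply, shift_eq_comm c y]
  split_ifs <;> simp

theorem shift_conj (c : Fin 2) (D : Matrix (Fin 2 → Fin n → F) (Fin 2 → Fin n → F) ℂ)
    (N : Matrix aux aux ℂ) :
    shiftMat aux c * (D ⊗ₖ N) * shiftMat aux c = (D.submatrix (shift c) (shift c)) ⊗ₖ N := by
  rw [shiftMat, ← mul_kronecker_mul, ← mul_kronecker_mul, one_mul, mul_one]
  congr 1
  ext x y
  simp only [mul_apply, of_apply, ite_mul, one_mul, zero_mul, Finset.sum_ite_eq, Finset.mem_univ,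
    if_true, mul_ite, mul_one, mul_zero, submatrix_apply]
  simp only [shift_eq_comm c _ y, Finset.sum_ite_eq, Finset.mem_univ, if_true]

theorem shiftMat_mul_self (c : Fin 2) :
    (shiftMat aux c : Matrix ((Fin 2 → Fin n → F) × aux) _ ℂ) * shiftMat aux c = 1 := by
  have h := shift_conj (n := n) (F := F) (aux := aux) c 1 1
  rw [one_kronecker_one, mul_one] at h
  rw [h, submatrix_one _ (LeftInverse.injective (shift_shift c)), one_kronecker_one]

/-- The measurement of both registers in the `Z` basis, and of the value at a point that depends on
the outcome. -/
noncomputable def pointMeas (G : (Fin n → F) → F → Matrix aux aux ℂ)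
    (φ : (Fin 2 → Fin n → F) → Fin n → F) (k : (Fin 2 → Fin n → F) × F) :
    Matrix ((Fin 2 → Fin n → F) × aux) ((Fin 2 → Fin n → F) × aux) ℂ :=
  Matrix.single k.1 k.1 1 ⊗ₖ G (φ k.1) k.2

theorem isPVM_pointMeas {G : (Fin n → F) → F → Matrix aux aux ℂ} (hG : ∀ w, IsPVM (G w))
    (φ : (Fin 2 → Fin n → F) → Fin n → F) : IsPVM (pointMeas G φ) where
  herm k := by
    rw [pointMeas, conjTranspose_kronecker, (hG _).herm, conjTranspose_single, star_one]
  idem k := by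
    rw [pointMeas, ← mul_kronecker_mul, (hG _).idem, single_mul_single_same, mul_one]
  sum := by
    have h : ∀ x : Fin 2 → Fin n → F, ∑ ν, pointMeas G φ (x, ν) = single x x 1 ⊗ₖ 1 := by
      intro x
      rw [← (hG (φ x)).sum]
      ext ⟨y, a⟩ ⟨z, b⟩
      simp only [Matrix.sum_apply, pointMeas, kroneckerMap_apply, Finset.mul_sum]
    rw [Fintype.sum_prod_type]
    simp only [h]
    ext ⟨y, a⟩ ⟨z, b⟩
    simp only [Matrix.sum_apply, kroneckerMap_apply, single_apply, one_apply, Prod.mk.injEq]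
    by_cases hyz : y = z
    · subst hyz; simp
    · rw [Finset.sum_eq_zero]
      · simp [hyz]
      · intro x _
        rw [if_neg, zero_mul]
        rintro ⟨rfl, rfl⟩
        exact hyz rfl

theorem zProj_mul_pointMeas (G : (Fin n → F) → F → Matrix aux aux ℂ)
    (φ : (Fin 2 → Fin n → F) → Fin n → F) {S : (Fin 2 → Fin n → F) → Prop}
    {k : (Fin 2 → Fin n → F) × F} (hk : S k.1) :
    zProj aux S * pointMeas G φ k = pointMeas G φ k := by
  rw [zProj, pointMeas, ← mul_kronecker_mul, one_mul]
  congr 1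
  ext x y
  rw [diagonal_mul, single_apply]
  by_cases h : k.1 = x ∧ k.1 = y
  · rw [if_pos h, ← h.1, if_pos hk, one_mul]
  · rw [if_neg h, mul_zero]

/-- The shift permutes the contents of the registers and does not touch the auxiliary space, so
conjugating only changes the point at which the value is taken. This is how a value at u becomes a
value at u + v. -/
theorem shift_conj_pointMeas (G : (Fin n → F) → F → Matrix aux aux ℂ)
    (φ : (Fin 2 → Fin n → F) → Fin n → F) (c : Fin 2) (k : (Fin 2 → Fin n → F) × F) :
    shiftMat aux c * pointMeas G φ (shift c k.1, k.2) * shiftMat aux c =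
      pointMeas G (φ ∘ shift c) k := by
  rw [pointMeas, shift_conj, pointMeas]
  congr 1
  ext x y
  simp only [submatrix_apply, single_apply, (LeftInverse.injective (shift_shift c)).eq_iff]

/-- The measurement of the point in one register. -/
theorem part_pointMeas (G : (Fin n → F) → F → Matrix aux aux ℂ) (c : Fin 2)
    (k : (Fin n → F) × F) :
    (part (pointMeas G fun x => x c) fun l => (l.1 c, l.2) = k) =
      tensor (place c (tauZ k.1) 1) (G k.1 k.2) := by
  obtain ⟨u, ν⟩ := k
  rw [tensor_tauZ]
  ext ⟨y, a⟩ ⟨z, b⟩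
  simp only [part, Matrix.sum_apply, kroneckerMap_apply, diagonal_apply, Prod.mk.injEq]
  rw [Fintype.sum_prod_type, Finset.sum_eq_single y]
  · rw [Finset.sum_eq_single ν]
    · by_cases h : y c = u
      · subst h
        by_cases hyz : y = z
        · subst hyz; simp [pointMeas]
        · simp [pointMeas, hyz]
      · simp [h]
    · intro μ _ hμ
      simp [hμ]
    · simp
  · intro x _ hx
    refine Finset.sum_eq_zero fun μ _ => ?_
    split_ifs
    · simp [pointMeas, hx]
    · rfl
  · simp

end Registers

end States

/-! ### The measurements of a register strategy -/

theorem questions_injective {r r' : Round} (h : r.questions = r'.questions) : r = r' :=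
  List.inj_on_of_nodup_map (f := Round.questions) (l := rounds) (by decide) (mem_rounds r)
    (mem_rounds r') h

/-- A finite check over the twelve rounds. It shows that the questions determine the round and the
roles, except for the consistency round, whose winning condition is symmetric; so acceptance reduces
to `Round.check`. -/
theorem eq_consistency_of_swap {r r' : Round} (h : r'.questions = r.questions.swap) :
    r = .consistency := by
  have key : ∀ x ∈ rounds.map Round.questions, x.swap ∈ rounds.map Round.questions →
      x = Round.consistency.questions := by decide
  exact questions_injective (key _ (List.mem_map_of_mem (mem_rounds r))
    (h ▸ List.mem_map_of_mem (mem_rounds r')))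

theorem accepts_iff {F : Type} [Field F] {n d : ℕ} (r : Round) (a a' : A F n d) :
    (introIntersect F n d).accepts r.questions.1 r.questions.2 a a' ↔ r.check a a' := by
  constructor
  · rintro ⟨r', ⟨h, hc⟩ | ⟨h, hc⟩⟩
    · exact questions_injective h ▸ hc
    · obtain rfl := eq_consistency_of_swap h
      obtain rfl := questions_injective (r := r') (r' := .consistency) h
      obtain ⟨u, u', ν, h1, h2⟩ := hc
      exact ⟨u', u, ν, h2, h1⟩
  · exact fun h => ⟨r, .inl ⟨rfl, h⟩⟩

theorem exists_seed (r : Round) : ∃ h b i, drawRound h b i = r := by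
  rcases r with c | c | c | c | c | _ | _
  · exact ⟨Fin.castLE (by decide) c, true, 0, by fin_cases c <;> rfl⟩
  · exact ⟨Fin.castLE (by decide) c, true, 1, by fin_cases c <;> rfl⟩
  · exact ⟨Fin.castLE (by decide) c, true, 2, by fin_cases c <;> rfl⟩
  · exact ⟨Fin.castLE (by decide) c, true, 3, by fin_cases c <;> rfl⟩
  · exact ⟨Fin.castLE (by decide) c, false, 0, by fin_cases c <;> rfl⟩
  · exact ⟨2, true, 0, rfl⟩
  · exact ⟨3, true, 0, rfl⟩

section Strategy

open Matrix

open scoped Classical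

set_option linter.unusedSectionVars false

variable {F : Type} [Field F] [Fintype F] [DecidableEq F] [Algebra (ZMod 2) F] {n d : ℕ}
  {aux : Type} [Fintype aux] [DecidableEq aux]

theorem epr_eq (u v : Fin n → F) :
    epr u v = if u = v then ((1 / √(Fintype.card F : ℝ) : ℝ) : ℂ) ^ n else 0 := by
  rw [epr]
  by_cases h : u = v
  · subst h; simp
  · rw [if_neg h]
    obtain ⟨j, hj⟩ := Function.ne_iff.1 h
    exact Finset.prod_eq_zero (Finset.mem_univ j) (if_neg hj)

variable (S : RegisterStrategy 2 F n (Fin 2 × AuxQuery) (Reply F n d) aux)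

/-- EPR pairs correspond to a multiple of the identity matrix. Hence Ψ commutes with every operator
that acts on the registers only, in particular with honest `Z` measurements and with the shift. -/
theorem stateMat_state : stateMat S.state =
    ((((1 / √(Fintype.card F : ℝ) : ℝ) : ℂ) ^ n) ^ 2 • (1 : Matrix (Fin 2 → Fin n → F) _ ℂ)) ⊗ₖ
      stateMat S.auxState := by
  ext ⟨x, a⟩ ⟨y, b⟩
  simp only [stateMat, of_apply, RegisterStrategy.state, kroneckerMap_apply, Matrix.smul_apply, one_apply,
    epr_eq, Fin.prod_univ_two, smul_eq_mul]
  congr 1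
  by_cases h : x = y
  · subst h; simp [sq]
  · rw [if_neg h, mul_zero]
    rw [eq_iff_place 0] at h
    by_cases h0 : x 0 = y 0
    · have h1 : x 1 ≠ y 1 := fun h1 => h ⟨h0, h1⟩
      rw [if_neg h1, mul_zero]
    · rw [if_neg h0, zero_mul]

theorem stateMat_transpose : (stateMat S.state)ᵀ = stateMat S.state := by
  rw [stateMat_state, ← kroneckerMap_transpose, transpose_smul, transpose_one]
  congr 1
  ext a b
  exact S.auxState_symm b a

theorem fr_state : fr (stateMat S.state) = 1 := by
  have h1 : fr (stateMat S.auxState) = 1 := by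
    rw [fr_eq_sum, ← S.auxState_norm, Fintype.sum_prod_type]
    rfl
  have hq : (0 : ℝ) < Fintype.card F := by exact_mod_cast Fintype.card_pos
  have hr : (1 / √(Fintype.card F : ℝ)) ^ 2 = (Fintype.card F : ℝ)⁻¹ := by
    rw [div_pow, Real.sq_sqrt hq.le, one_pow, one_div]
  have h2 : ∀ x : Fin 2 → Fin n → F, ∑ y, ‖((((1 / √(Fintype.card F : ℝ) : ℝ) : ℂ) ^ n) ^ 2 •
      (1 : Matrix (Fin 2 → Fin n → F) (Fin 2 → Fin n → F) ℂ)) x y‖ ^ 2 =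
        (((Fintype.card F : ℝ) ^ n) ^ 2)⁻¹ := by
    intro x
    rw [Finset.sum_eq_single x (fun y _ hy => by simp [Ne.symm hy]) (by simp), Matrix.smul_apply,
      one_apply_eq, smul_eq_mul, mul_one, norm_pow, norm_pow, Complex.norm_real, Real.norm_eq_abs,
      abs_of_nonneg (by positivity), pow_right_comm _ 2 2, pow_right_comm _ n 2, hr, inv_pow, inv_pow]
  rw [stateMat_state, fr_kronecker, h1, mul_one, fr_eq_sum]
  simp only [h2]
  rw [Finset.sum_const, Finset.card_univ, Fintype.card_fun, Fintype.card_fun, Fintype.card_fin,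
    Fintype.card_fin, nsmul_eq_mul]
  push_cast
  exact mul_inv_cancel₀ (by positivity)

theorem zProj_mul_state (T : (Fin 2 → Fin n → F) → Prop) :
    zProj aux T * stateMat S.state = stateMat S.state * zProj aux T := by
  rw [stateMat_state, zProj, ← mul_kronecker_mul, ← mul_kronecker_mul, one_mul, mul_one,
    mul_smul_comm, smul_mul_assoc, one_mul, mul_one]

theorem shiftMat_mul_state (c : Fin 2) :
    shiftMat aux c * stateMat S.state = stateMat S.state * shiftMat aux c := by
  rw [stateMat_state, shiftMat, ← mul_kronecker_mul, ← mul_kronecker_mul, one_mul, mul_one,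
    mul_smul_comm, smul_mul_assoc, one_mul, mul_one]

/-- The part of a measurement with a given answer to the basis queries. -/
theorem part_fst (x : Q) (o : Fin 2 → Option (Fin n → F)) :
    (part (S.M x) fun a => a.1 = o) = tensor (fun i => pauliProj (x.1 i) (o i)) 1 := by
  rw [← S.pauli, part, Fintype.sum_prod_type, Finset.sum_eq_single o]
  · simp
  · intro o' _ ho
    exact Finset.sum_eq_zero fun r _ => if_neg ho
  · simp

theorem tensor_slope (c : Fin 2) (v : Fin n → F) (q : Fin 2 × AuxQuery) :
    tensor (fun i => pauliProj (((place c .bot .Z, q) : Q).1 i)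
      (place c none (some v) i)) (1 : Matrix aux aux ℂ) = zProj aux fun x => x (other c) = v := by
  refine (tensor_pauliProj c .bot .Z none (some v) 1).trans ?_
  rw [place_swap]
  exact tensor_tauZ_one (other c) v

variable {S}

theorem isPVM_M (hS : S.IsProjective) (x : Q) : IsPVM (S.M x) := .of_isProjMeas (hS x)

theorem value_eq (hS : S.IsProjective) : S.value (introIntersect F n d) =
    1 - (∑ s : (introIntersect F n d).Seed,
      bad (S.M ((introIntersect F n d).ask s).1) (fun a => (S.M ((introIntersect F n d).ask s).2 a)ᵀ)
        (stateMat S.state) ((introIntersect F n d).accepts ((introIntersect F n d).ask s).1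
          ((introIntersect F n d).ask s).2)) / 64 := by
  have hc : (Fintype.card (introIntersect F n d).Seed : ℝ) = 64 := by
    have : Fintype.card (Fin 4 × Bool × Fin 4 × Bool) = 64 := by simp
    exact_mod_cast this
  have h : ∀ s : (introIntersect F n d).Seed, (∑ a₀, ∑ a₁,
      if (introIntersect F n d).accepts ((introIntersect F n d).ask s).1
        ((introIntersect F n d).ask s).2 a₀ a₁
      then jointProb S.state (S.M ((introIntersect F n d).ask s).1 a₀)
        (S.M ((introIntersect F n d).ask s).2 a₁) else 0) = 1 -
      bad (S.M ((introIntersect F n d).ask s).1) (fun a => (S.M ((introIntersect F n d).ask s).2 a)ᵀ)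
        (stateMat S.state) ((introIntersect F n d).accepts ((introIntersect F n d).ask s).1
          ((introIntersect F n d).ask s).2) := by
    intro s
    have h0 := isPVM_M hS ((introIntersect F n d).ask s).1
    have h1 := isPVM_M hS ((introIntersect F n d).ask s).2
    rw [← good_eq h0 h1.transpose (fr_state S)]
    simp only [jointProb_eq _ (h0.herm _) (h0.idem _) (h1.herm _) (h1.idem _)]
  rw [RegisterStrategy.value, hc]
  simp only [h, Finset.sum_sub_distrib]
  rw [Finset.sum_const, Finset.card_univ, nsmul_eq_mul, hc, mul_one, sub_div, div_self (by norm_num)]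

/-- Every round is rejected with small probability. -/
theorem bad_check_le (hS : S.IsProjective) {ε : ℝ}
    (hε : 1 - ε ≤ S.value (introIntersect F n d)) (r : Round) :
    bad (S.M r.questions.1) (fun a => (S.M r.questions.2 a)ᵀ) (stateMat S.state) r.check ≤
      64 * ε := by
  rw [value_eq hS] at hε
  -- At least one of the 64 seeds leads to this round with the roles in the given order, so its
  -- rejection weight is at most 64 times the total failure probability.
  obtain ⟨h, b, i, hr⟩ := exists_seed r
  have h1 := Finset.single_le_sum (f := fun s : (introIntersect F n d).Seed =>
      bad (S.M ((introIntersect F n d).ask s).1) (fun a => (S.M ((introIntersect F n d).ask s).2 a)ᵀ)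
        (stateMat S.state) ((introIntersect F n d).accepts ((introIntersect F n d).ask s).1
          ((introIntersect F n d).ask s).2))
    (fun s _ => bad_nonneg _ _ _ _) 
      (Finset.mem_univ (α := (introIntersect F n d).Seed) (h, b, i, true))
  have h2 : (introIntersect F n d).ask (h, b, i, true) = r.questions := by
    simp [introIntersect, hr]
  simp only [h2] at h1
  have h3 : (introIntersect F n d).accepts r.questions.1 r.questions.2 = r.check := by
    funext a a'
    exact propext (accepts_iff r a a')
  rw [h3] at h1
  linarith

/-- The state is symmetric under exchanging the players and both use the same measurements, so
transposing exchanges the roles without using the coin of the verifier. -/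
theorem bad_check_swap_le (hS : S.IsProjective) {ε : ℝ}
    (hε : 1 - ε ≤ S.value (introIntersect F n d)) (r : Round) :
    bad (S.M r.questions.2) (fun a => (S.M r.questions.1 a)ᵀ) (stateMat S.state)
      (fun a b => r.check b a) ≤ 64 * ε := by
  have h := bad_check_le hS hε r
  rw [← bad_transpose, stateMat_transpose] at h
  exact h

/-! ### The shift of a register -/

theorem neg_one_pow_add (x y : ZMod 2) :
    (-1 : ℂ) ^ (x + y).val = (-1) ^ x.val * (-1) ^ y.val := by
  have h : ∀ x y : ZMod 2, (x + y).val % 2 = (x.val + y.val) % 2 := by decide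
  rw [← pow_add, neg_one_pow_eq_pow_mod_two, h, ← neg_one_pow_eq_pow_mod_two]

theorem zmod_two_cases (z : ZMod 2) : z = 0 ∨ z = 1 := by
  revert z
  decide

theorem exists_trace_eq_one {a : F} (ha : a ≠ 0) : ∃ z, Algebra.trace (ZMod 2) F (z * a) = 1 := by
  have : Fact (Nat.Prime 2) := ⟨Nat.prime_two⟩
  by_contra! h
  refine ha ((traceForm_nondegenerate (ZMod 2) F).1 a fun z => ?_)
  rw [Algebra.traceForm_apply, mul_comm]
  exact (zmod_two_cases _).resolve_right (h z)

/-- Orthogonality of characters. For a ≠ 0 the trace form provides a translation of u that flips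
every sign, so the sum equals its own negative. -/
theorem sum_char (a : Fin n → F) :
    ∑ u : Fin n → F, (-1 : ℂ) ^ (Algebra.trace (ZMod 2) F (u ⬝ᵥ a)).val =
      if a = 0 then (Fintype.card F : ℂ) ^ n else 0 := by
  split_ifs with ha
  · subst ha
    simp
  · obtain ⟨j, hj⟩ := Function.ne_iff.1 ha
    obtain ⟨z, hz⟩ := exists_trace_eq_one hj
    have h := Equiv.sum_comp (Equiv.addRight (Pi.single j z : Fin n → F)) fun u =>
      (-1 : ℂ) ^ (Algebra.trace (ZMod 2) F (u ⬝ᵥ a)).val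
    have h1 : ∀ u, (-1 : ℂ) ^ (Algebra.trace (ZMod 2) F
        (Equiv.addRight (Pi.single j z : Fin n → F) u ⬝ᵥ a)).val =
        -(-1 : ℂ) ^ (Algebra.trace (ZMod 2) F (u ⬝ᵥ a)).val := by
      intro u
      rw [Equiv.coe_addRight, add_dotProduct, map_add, neg_one_pow_add, single_dotProduct, hz,
        show (1 : ZMod 2).val = 1 from rfl, pow_one, mul_neg_one]
    simp only [h1, Finset.sum_neg_distrib] at h
    linear_combination -(1 / 2) * h

theorem tauX_apply (u x y : Fin n → F) : tauX u x y =
    ((Fintype.card F : ℂ) ^ n)⁻¹ * (-1) ^ (Algebra.trace (ZMod 2) F (u ⬝ᵥ (x + y))).val := by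
  have hq : (0 : ℝ) ≤ (Fintype.card F : ℝ) ^ n := by positivity
  rw [tauX, vecMulVec_apply, Pi.star_apply, ketX, ketX, dotProduct_add, map_add, neg_one_pow_add,
    star_mul', star_pow, star_neg, star_one, Complex.star_def, Complex.conj_ofReal]
  have h : (((1 / √((Fintype.card F : ℝ) ^ n) : ℝ) : ℂ)) * ((1 / √((Fintype.card F : ℝ) ^ n) : ℝ) : ℂ)
      = ((Fintype.card F : ℂ) ^ n)⁻¹ := by
    rw [← Complex.ofReal_mul, ← sq, div_pow, Real.sq_sqrt hq, one_pow, one_div]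
    push_cast
    rfl
  rw [← h]
  ring

/-- The parity of the dot product of the answers to the basis queries. -/
noncomputable def basisKey (c : Fin 2) (o : Fin 2 → Option (Fin n → F)) : ZMod 2 :=
  Algebra.trace (ZMod 2) F ((o (other c)).getD 0 ⬝ᵥ (o c).getD 0)

/-- The answers to two basis queries, listed by their role in copy `c`. -/
def placeEquiv (T : Type) (c : Fin 2) : T × T ≃ (Fin 2 → T) where
  toFun p := place c p.1 p.2
  invFun o := (o c, o (other c))
  left_inv p := by simp
  right_inv o := (eq_place c).symm

variable (S)

theorem obs_eq_sum (x : Q) (p : (Fin 2 → Option (Fin n → F)) → ZMod 2) :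
    obs (S.M x) (fun a => p a.1) =
      ∑ o, (-1 : ℂ) ^ (p o).val • tensor (fun i => pauliProj (x.1 i) (o i)) 1 := by
  rw [obs, part, part, ← Finset.sum_sub_distrib, Fintype.sum_prod_type]
  refine Finset.sum_congr rfl fun o _ => ?_
  rw [← S.pauli, Finset.smul_sum]
  refine Finset.sum_congr rfl fun r _ => ?_
  rcases zmod_two_cases (p o) with h | h
  · simp [h]
  · simp [h, show (1 : ZMod 2).val = 1 from rfl]

/-- The parity of the dot product of the slope register with the point register, measured in the
`X` basis, is the shift of the point register by the content of the slope register. -/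
theorem obs_basis (c : Fin 2) :
    obs (S.M (basisXQ c)) (fun a => basisKey c a.1) = shiftMat aux c := by
  rw [obs_eq_sum]
  ext ⟨x, a⟩ ⟨y, b⟩
  rw [Matrix.sum_apply, ← (placeEquiv _ c).sum_comp, Fintype.sum_prod_type, Fintype.sum_option]
  simp only [placeEquiv, Equiv.coe_fn_mk, basisKey, place_self, place_other, Matrix.smul_apply,
    tensor, of_apply, prod_place c, basisXQ, pauliProj, Matrix.zero_apply, zero_mul,
    Finset.sum_const_zero, zero_add, Fintype.sum_option, mul_zero, Option.getD_some, tauX_apply,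
    tauZ_apply, smul_eq_mul]
  have key : ∀ u : Fin n → F, ∑ v, (-1 : ℂ) ^ (Algebra.trace (ZMod 2) F (v ⬝ᵥ u)).val *
      (((Fintype.card F : ℂ) ^ n)⁻¹ * (-1) ^ (Algebra.trace (ZMod 2) F (u ⬝ᵥ (x c + y c))).val *
        (if x (other c) = y (other c) ∧ x (other c) = v then 1 else 0) * (1 : Matrix aux aux ℂ) a b) =
      (-1 : ℂ) ^ (Algebra.trace (ZMod 2) F (u ⬝ᵥ (x (other c) + (x c + y c)))).val *
        (((Fintype.card F : ℂ) ^ n)⁻¹ * (if x (other c) = y (other c) then 1 else 0) *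
          (1 : Matrix aux aux ℂ) a b) := by
    intro u
    generalize x c + y c = w
    rw [Finset.sum_eq_single (x (other c))
      (fun v _ hv => by rw [if_neg fun h => hv h.2.symm]; ring) (by simp), dotProduct_add, map_add,
      neg_one_pow_add, dotProduct_comm (x (other c)) u]
    simp only [and_true]
    ring
  -- The sum over v has already selected v = x (other c). What is left is a character sum over u,
  -- which forces y c = x c + x (other c): this is the entry of the permutation matrix.
  simp only [key]
  rw [← Finset.sum_mul, sum_char, shiftMat, kroneckerMap_apply, of_apply]
  have hw : shift c x = y ↔ x (other c) + (x c + y c) = 0 ∧ x (other c) = y (other c) := by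
    rw [eq_iff_place c, shift, place_self, place_other]
    refine and_congr ⟨fun h => ?_, fun h => ?_⟩ Iff.rfl
    · rw [← h, ← add_assoc, add_comm (x (other c)), add_self_eq_zero']
    · have h' : x c + x (other c) = x (other c) + (x c + y c) + y c := by
        rw [add_assoc, add_assoc, add_self_eq_zero', add_zero, add_comm]
      rw [h', h, zero_add]
  have hq : (Fintype.card F : ℂ) ^ n ≠ 0 :=
    pow_ne_zero _ (Nat.cast_ne_zero.2 Fintype.card_ne_zero)
  by_cases h1 : x (other c) + (x c + y c) = 0 <;> by_cases h2 : x (other c) = y (other c) <;>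
    simp [hw, h1, h2, hq]

end Strategy

/-! ### Soundness -/

section Soundness

open Matrix

open scoped Classical

set_option linter.unusedSectionVars false

/-- The line with its function in a reply. -/
def Reply.lineKey {F : Type} [Field F] {n d : ℕ} : Reply F n d → Option (LineFn F n d)
  | .line f => some f
  | .lineDot f _ => some f
  | _ => none

/-- The parity of the dot product in a reply. -/
noncomputable def Reply.dotKey {F : Type} [Field F] [Algebra (ZMod 2) F] {n d : ℕ} :
    Reply F n d → ZMod 2
  | .lineDot _ e => Algebra.trace (ZMod 2) F e
  | .dot e => Algebra.trace (ZMod 2) F e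
  | _ => 0

/-- A reply has the value `ν` at the point `u`. -/
def OptionHasValue {F : Type} [Field F] {n d : ℕ} (f : Option (LineFn F n d)) (u : Fin n → F)
    (ν : F) : Prop :=
  ∃ g, f = some g ∧ g.HasValue u ν

theorem OptionHasValue.unique {F : Type} [Field F] {n d : ℕ} {f : Option (LineFn F n d)}
    {u : Fin n → F} {ν μ : F} (h : OptionHasValue f u ν) (h' : OptionHasValue f u μ) : ν = μ := by
  obtain ⟨g, rfl, _, hν⟩ := h
  obtain ⟨g', hg, _, hμ⟩ := h'
  obtain rfl := Option.some.inj hg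
  exact hν.symm.trans hμ

noncomputable instance {F : Type} [Field F] [Finite F] {n d : ℕ} : Fintype (LineFn F n d) :=
  Fintype.ofFinite _

variable {F : Type} [Field F] [Fintype F] [DecidableEq F] [Algebra (ZMod 2) F] {n d : ℕ}
  {aux : Type} [Fintype aux] [DecidableEq aux]
  (S : RegisterStrategy 2 F n (Fin 2 × AuxQuery) (Reply F n d) aux)

/-- Bob's measurement of a line with a function. -/
noncomputable def bobLines (c : Fin 2) (f : Option (LineFn F n d)) :
    Matrix ((Fin 2 → Fin n → F) × aux) ((Fin 2 → Fin n → F) × aux) ℂ :=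
  part (fun a => (S.M (linesQ c) a)ᵀ) fun a => a.2.lineKey = f

variable {S} (hS : S.IsProjective) {ε : ℝ} (hε : 1 - ε ≤ S.value (introIntersect F n d))

include hS in
theorem isPVM_bobLines (c : Fin 2) : IsPVM (bobLines S c) :=
  (isPVM_M hS _).transpose.coarse _

include hS hε

/-- The measurement of a line approximately commutes with the shift. -/
theorem sum_fr_bobLines_commutator_le (c : Fin 2) :
    ∑ f, fr (shiftMat aux c * stateMat S.state * bobLines S c f -
      stateMat S.state * bobLines S c f * shiftMat aux c) ≤ 144 * (64 * ε) := by
  have hX := isPVM_M hS (linesXQ c)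
  -- Alice's line in `linesXQ` agrees with Bob's line in `linesQ`; the round lists these roles in
  -- the other order, hence the exchanged bound.
  have h1 := (sum_fr_sub_le_bad hX (isPVM_M hS (linesQ c)).transpose
    (fr_state S) (fun a => a.2.lineKey) (fun a => a.2.lineKey)
    (fun a b => (Round.hideAnswer c).check b a) (by
      rintro _ _ ⟨v, f, e, rfl, rfl⟩
      rfl)).trans (mul_le_mul_of_nonneg_left (bad_check_swap_le hS hε (.hideAnswer c)) two_pos.le)
  have h2 := (fr_obs_sub_le (isPVM_M hS (basisXQ c)) (isPVM_M hS (dotXQ c)).transpose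
    (fr_state S) (fun a => basisKey c a.1) (fun a => a.2.dotKey) (Round.hideBasis c).check (by
      rintro _ _ ⟨u, v, rfl, rfl⟩
      simp [basisKey, Reply.dotKey])).trans
        (mul_le_mul_of_nonneg_left (bad_check_le hS hε (.hideBasis c)) (by norm_num))
  have h3 := (fr_obs_sub_le hX (isPVM_M hS (dotXQ c)).transpose
    (fr_state S) (fun a => a.2.dotKey) (fun a => a.2.dotKey) (Round.hideDot c).check (by
      rintro _ _ ⟨v, v', f, e, rfl, rfl⟩
      rfl)).trans (mul_le_mul_of_nonneg_left (bad_check_le hS hε (.hideDot c)) (by norm_num))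
  rw [obs_basis] at h2
  set Ψ := stateMat S.state
  set E := obs (S.M (linesXQ c)) fun a => a.2.dotKey
  set D := obs (fun a => (S.M (dotXQ c) a)ᵀ) fun a => a.2.dotKey
  -- The shift is an exact observable of Alice in `basisXQ`; Bob's dot product D transfers it to
  -- Alice's dot product E in `linesXQ`. Each transfer costs 4·64ε, and combining them doubles the
  -- sum.
  have h4 : fr (shiftMat aux c * Ψ - E * Ψ) ≤ 16 * (64 * ε) := by
    have h := fr_add_le (shiftMat aux c * Ψ - Ψ * D) (Ψ * D - E * Ψ)
    rw [sub_add_sub_cancel, fr_sub_comm (Ψ * D)] at h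
    linarith
  -- E and the line of `linesXQ` come from the same projective measurement and commute exactly. The
  -- constants are 8·2 + 8·16 = 144, in units of 64ε.
  have h5 := sum_fr_commutator_le (isPVM_bobLines hS c) (hX.coarse fun a => a.2.lineKey)
    (shiftMat_herm c) (shiftMat_mul_self c) (shiftMat_mul_state S c) (obs_herm hX _)
    (obs_mul_obs hX _) (fun f => obs_commute_part hX _ _) h1 h4
  linarith

/-- The shift moves Alice's point by the slope but leaves Bob's line and function almost unchanged,
so agreement at one point of the line gives agreement at the next; 288 is twice the commutator bound
144. -/
theorem bad_pointMeas_shift_le {G : (Fin n → F) → F → Matrix aux aux ℂ} (hG : ∀ w, IsPVM (G w))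
    (c : Fin 2) {φ φ' : (Fin 2 → Fin n → F) → Fin n → F} (hφ : ∀ x, φ (shift c x) = φ' x) :
    bad (pointMeas G φ') (bobLines S c) (stateMat S.state)
        (fun k f => OptionHasValue f (φ' k.1) k.2) ≤
      2 * bad (pointMeas G φ) (bobLines S c) (stateMat S.state)
        (fun k f => OptionHasValue f (φ k.1) k.2) + 288 * (64 * ε) := by
  obtain rfl : φ ∘ shift c = φ' := funext hφ
  let e : ((Fin 2 → Fin n → F) × F) ≃ ((Fin 2 → Fin n → F) × F) :=
    (Involutive.toPerm (shift c) (shift_shift c)).prodCongr (Equiv.refl F)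
  have h := bad_shift_le (isPVM_pointMeas hG φ) (shiftMat_herm c) (shiftMat_mul_self c)
    (sum_fr_bobLines_commutator_le hS hε c) fun k f => OptionHasValue f (φ k.1) k.2
  rw [← bad_equiv _ _ _ _ e] at h
  have h1 : (fun k => shiftMat aux c * pointMeas G φ (e k) * shiftMat aux c) =
      pointMeas G (φ ∘ shift c) := funext fun k => shift_conj_pointMeas G φ c k
  rw [h1] at h
  have h2 : 2 * (144 * (64 * ε)) = 288 * (64 * ε) := by ring
  rw [h2] at h
  exact h

theorem bad_cross_le (c : Fin 2) :
    bad (pointsMeas S c) (bobLines S c) (stateMat S.state)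
      (fun k f => OptionHasValue f k.1 k.2) ≤ 64 * ε := by
  have h1 := bad_coarse_right (pointsMeas S c) (isPVM_M hS (linesQ c)).transpose
    (stateMat S.state) (fun a => a.2.lineKey) fun k f => OptionHasValue f k.1 k.2
  let e : (Fin n → F) × F → A F n d := fun k => (place c (some k.1) none, .value k.2)
  have he : Injective e := by
    rintro ⟨u, ν⟩ ⟨u', ν'⟩ h
    simpa [e, place_inj] using h
  refine h1.le.trans ((bad_mono _ _ _ (S := fun k a => (Round.cross c).check a (e k)) ?_).trans
    ((bad_injective_le (S.M (pointsQ c)) _ _ (fun b a => (Round.cross c).check a b) he).trans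
      (bad_check_swap_le hS hε (.cross c))))
  rintro ⟨u, ν⟩ a ⟨u', v, f, ν', rfl, h, hf⟩
  simp only [e, Prod.mk.injEq, place_inj, Option.some.injEq, Reply.value.injEq, and_true] at h
  obtain ⟨rfl, rfl⟩ := h
  exact ⟨f, rfl, hf⟩

/-- Bounding the accepted weight from below is stronger than bounding the rejected weight of
well-formed answers: `pointsMeas` lists only answers of the expected format and is not known to sum
to the identity. This form is needed for the points prover of the second copy, about which nothing
else is known. -/
theorem good_cross_le (c : Fin 2) :
    1 - 64 * ε ≤ ∑ k, ∑ f, if OptionHasValue f k.1 k.2 then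
      fr (pointsMeas S c k * stateMat S.state * bobLines S c f) else 0 := by
  let e : (Fin n → F) × F → A F n d := fun k => (place c (some k.1) none, .value k.2)
  have he : Injective e := by
    rintro ⟨u, ν⟩ ⟨u', ν'⟩ h
    simpa [e, place_inj] using h
  have hN := (isPVM_M hS (linesQ c)).transpose
  have h := good_eq (isPVM_M hS (pointsQ c)) hN (fr_state S) fun b a => (Round.cross c).check a b
  have h1 := bad_check_swap_le hS hε (.cross c)
  change bad (S.M (pointsQ c)) (fun a => (S.M (linesQ c) a)ᵀ) _ _ ≤ _ at h1
  rw [← Fintype.sum_of_injective e he (fun k => ∑ a, if (Round.cross c).check a (e k) then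
    fr (S.M (pointsQ c) (e k) * stateMat S.state * (S.M (linesQ c) a)ᵀ) else 0) _ ?_ fun _ => rfl]
    at h
  · have h2 : 1 - 64 * ε ≤ 1 - bad (S.M (pointsQ c)) (fun a => (S.M (linesQ c) a)ᵀ)
        (stateMat S.state) fun b a => (Round.cross c).check a b := by linarith
    refine (h2.trans h.ge).trans (Finset.sum_le_sum fun k _ => ?_)
    have h3 : ∀ f, (if OptionHasValue f k.1 k.2 then
        fr (pointsMeas S c k * stateMat S.state * bobLines S c f) else 0) =
        ∑ a, if a.2.lineKey = f then (if OptionHasValue a.2.lineKey k.1 k.2 then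
          fr (pointsMeas S c k * stateMat S.state * (S.M (linesQ c) a)ᵀ) else 0) else 0 := by
      intro f
      rw [bobLines, hN.fr_mul_part]
      split_ifs with hf
      · refine Finset.sum_congr rfl fun a _ => ?_
        split_ifs with h4 h5
        · rfl
        · exact absurd (h4 ▸ hf) h5
        · rfl
      · refine (Finset.sum_eq_zero fun a _ => ?_).symm
        split_ifs with h4 h5
        · exact absurd (h4 ▸ h5) hf
        · rfl
        · rfl
    simp only [h3]
    rw [sum_fibers]
    refine Finset.sum_le_sum fun a _ => ?_
    by_cases h4 : (Round.cross c).check a (e k)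
    · rw [if_pos h4, if_pos]
      · rfl
      · obtain ⟨u', v, f, ν', rfl, h, hf⟩ := h4
        simp only [e, Prod.mk.injEq, place_inj, Option.some.injEq, Reply.value.injEq, and_true] at h
        exact ⟨f, rfl, by rw [h.1, h.2]; exact hf⟩
    · rw [if_neg h4]
      split_ifs
      · exact fr_nonneg _
      · exact le_rfl
  · intro b hb
    refine Finset.sum_eq_zero fun a _ => if_neg ?_
    rintro ⟨u, v, f, ν, -, h, -⟩
    exact hb ⟨(u, ν), h.symm⟩

end Soundness

/-! ### Transitivity through the intersecting lines and the conclusion of soundness. -/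

section Soundness

open Matrix

open scoped Classical

set_option linter.unusedSectionVars false

theorem sum_ite_nonneg {K : Type} [Fintype K] (T : K → Prop) [DecidablePred T] {c : ℝ}
    (hc : 0 ≤ c) : 0 ≤ ∑ k, if T k then c else 0 :=
  Finset.sum_nonneg fun _ _ => ite_nonneg hc le_rfl

theorem le_sum_ite {K : Type} [Fintype K] (T : K → Prop) [DecidablePred T] {c : ℝ} (hc : 0 ≤ c)
    (h : ∃ k, T k) : c ≤ ∑ k, if T k then c else 0 := by
  obtain ⟨k, hk⟩ := h
  have h1 := Finset.single_le_sum (f := fun k => if T k then c else 0)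
    (fun k _ => ite_nonneg hc le_rfl) (Finset.mem_univ k)
  rwa [if_pos hk] at h1

section

variable {ι A B C : Type} [Fintype ι] [Fintype A] [Fintype B] [Fintype C]

theorem bad_injective_right_le (M : A → Matrix ι ι ℂ) (N : B → Matrix ι ι ℂ)
    (Ψ : Matrix ι ι ℂ) (S : A → B → Prop) {e : C → B} (he : Injective e) :
    bad M (fun c => N (e c)) Ψ (fun a c => S a (e c)) ≤ bad M N Ψ S := by
  rw [← bad_transpose, ← bad_transpose M]
  exact bad_injective_le (fun b => (N b)ᵀ) _ _ (fun b a => S a b) he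

/-- Transitivity of consistency, for measurements `M` and `J` of Alice and `N` and `J'` of Bob, where
`M` and `N` measure only one of the two functions `g₀` and `g₁` of the outcome of `J`. -/
theorem bad_trans_le [DecidableEq ι] {K U V : Type} [Fintype K] [Fintype U] [Fintype V]
    {M : A → Matrix ι ι ℂ} {N : B → Matrix ι ι ℂ} {J J' : K → Matrix ι ι ℂ}
    {z₀ : U → Matrix ι ι ℂ} {z₁ : V → Matrix ι ι ℂ} (hM : IsPVM M) (hN : IsPVM N) (hJ : IsPVM J)
    (hJ' : IsPVM J') (hz₀ : IsPVM z₀) (hz₁ : IsPVM z₁) {Ψ : Matrix ι ι ℂ} (hΨ : fr Ψ = 1)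
    (hz₀Ψ : ∀ u, z₀ u * Ψ = Ψ * z₀ u) (hz₁Ψ : ∀ v, z₁ v * Ψ = Ψ * z₁ v)
    {S : V → A → Prop} {T : U → B → Prop} (hS : ∀ v, part M (S v) = z₁ v)
    (hT : ∀ u, part N (T u) = z₀ u) (hS' : ∀ v v' a, S v a → S v' a → v = v')
    (hT' : ∀ u u' b, T u b → T u' b → u = u') {g₀ : K → U} {g₁ : K → V}
    (hJz₀ : ∀ k, J k * z₀ (g₀ k) = J k) (hJz₁ : ∀ k, J k * z₁ (g₁ k) = J k)
    (hzJ₀ : ∀ k, z₀ (g₀ k) * J' k = J' k) (hzJ₁ : ∀ k, z₁ (g₁ k) * J' k = J' k)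
    {W : K → A → Prop} {W' : K → B → Prop}
    (hW : ∀ k l a, W k a → W l a → g₀ k = g₀ l → g₁ k = g₁ l → k = l)
    (hW' : ∀ k l b, W' k b → W' l b → g₀ k = g₀ l → g₁ k = g₁ l → k = l)
    {chk : A → B → Prop}
    (hchk : ∀ a b, chk a b → ∃ k, (W k a ∧ S (g₁ k) a) ∧ T (g₀ k) b ∧ W' k b) {α β γ : ℝ}
    (h₁ : bad M N Ψ chk ≤ α) (h₂ : bad M J' Ψ (fun a k => W k a) ≤ β)
    (h₃ : bad J J' Ψ (fun k l => k = l) ≤ γ) :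
    bad J N Ψ W' ≤ 5 * α + 4 * β + 5 * γ := by
  -- `P` and `R` are the parts of the two answers compatible with a joint outcome k. Each sees only
  -- one of the two register contents of k; the other one is supplied below by the honest
  -- measurement of the other player.
  let P : K → Matrix ι ι ℂ := fun k => part M fun a => W k a ∧ S (g₁ k) a
  let R : K → Matrix ι ι ℂ := fun k => part N fun b => T (g₀ k) b ∧ W' k b
  have hP : ∀ k, P k = part M (W k) * z₁ (g₁ k) := fun k => by rw [← hS, hM.part_mul_part]
  have hR : ∀ k, R k = z₀ (g₀ k) * part N (W' k) := fun k => by rw [← hT, hN.part_mul_part]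
  have hPh : ∀ k, (P k)ᴴ = P k := fun k => hM.part_herm _
  have hPi : ∀ k, P k * P k = P k := fun k => hM.part_idem _
  have hRh : ∀ k, (R k)ᴴ = R k := fun k => hN.part_herm _
  have hRi : ∀ k, R k * R k = R k := fun k => hN.part_idem _
  have hPz : ∀ k, P k * z₁ (g₁ k) = P k := fun k => by rw [hP, mul_assoc, hz₁.idem]
  have hzR : ∀ k, z₀ (g₀ k) * R k = R k := fun k => by rw [hR, ← mul_assoc, hz₀.idem]
  -- The inner product of x and y is at least the winning probability of the round, that of x and z
  -- measures the agreement of M with J', and that of z' and z the agreement of J with J'. The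
  -- conclusion bounds the inner product of z' and y, which is the agreement of J with N.
  have key := one_sub_le_sum_ip (a := α) (b := β) (c := γ)
    (x := fun k => P k * Ψ * z₀ (g₀ k)) (y := fun k => z₁ (g₁ k) * Ψ * R k)
    (z := fun k => Ψ * J' k) (z' := fun k => J k * Ψ) ?_ ?_ ?_ ?_ ?_ ?_ ?_
  · have h : ∀ k, ip (J k * Ψ) (z₁ (g₁ k) * Ψ * R k) = fr (J k * Ψ * part N (W' k)) := by
      intro k
      -- J already determines the register content that z₀ measures, and z₀ passes through Ψ, so
      -- inserting it on Bob's side changes nothing.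
      have h1 : J k * Ψ = J k * Ψ * z₀ (g₀ k) := by
        rw [mul_assoc, ← hz₀Ψ, ← mul_assoc, hJz₀]
      rw [h1, ip_eq_fr (hJ.herm k) (hJ.idem k) (hRh k) (hRi k) (hJz₁ k) (hzR k),
        hR k, ← mul_assoc, ← h1]
    simp only [h, hN.fr_mul_part] at key
    rw [good_eq hJ hN hΨ W'] at key
    linarith
  · have h := sum_fr_part_mul_le hM (fun k a => W k a ∧ S (g₁ k) a) g₀ (fun u => Ψ * z₀ u)
      fun a k l h h' hg => hW k l a h.1 h'.1 hg (hS' _ _ a h.2 h'.2)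
    rw [hz₀.sum_fr_mul_right, hΨ] at h
    simpa only [mul_assoc] using h
  · have h := sum_fr_mul_part_le hN (fun k b => T (g₀ k) b ∧ W' k b) g₁ (fun v => z₁ v * Ψ)
      fun b k l h h' hg => hW' k l b h.2 h'.2 (hT' _ _ b h.1 h'.1) hg
    rwa [hz₁.sum_fr_mul, hΨ] at h
  · rw [hJ'.sum_fr_mul_right, hΨ]
  · rw [hJ.sum_fr_mul, hΨ]
  · have h : ∀ k, ip (P k * Ψ * z₀ (g₀ k)) (z₁ (g₁ k) * Ψ * R k) = fr (P k * Ψ * R k) := fun k =>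
      ip_eq_fr (hPh k) (hPi k) (hRh k) (hRi k) (hPz k) (hzR k) _
    simp only [h, P, R, fr_part_mul_part hM hN]
    have h2 := good_eq hM hN hΨ chk
    have h3 : 1 - α ≤ 1 - bad M N Ψ chk := by linarith
    refine (h3.trans h2.ge).trans ?_
    refine le_trans ?_ (Finset.sum_comm.trans (Finset.sum_congr rfl fun a _ => Finset.sum_comm)).ge
    refine Finset.sum_le_sum fun a _ => Finset.sum_le_sum fun b _ => ?_
    split_ifs with h4
    · refine (le_sum_ite (fun k => (W k a ∧ S (g₁ k) a) ∧ T (g₀ k) b ∧ W' k b)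
        (fr_nonneg (M a * Ψ * N b)) (hchk a b h4)).trans (le_of_eq ?_)
      congr!
    · refine (sum_ite_nonneg (fun k => (W k a ∧ S (g₁ k) a) ∧ T (g₀ k) b ∧ W' k b)
        (fr_nonneg (M a * Ψ * N b))).trans (le_of_eq ?_)
      congr!
  · have h : ∀ k, ip (P k * Ψ * z₀ (g₀ k)) (Ψ * J' k) = fr (part M (W k) * Ψ * J' k) := by
      intro k
      have h1 : Ψ * J' k = z₁ (g₁ k) * Ψ * J' k := by rw [hz₁Ψ, mul_assoc, hzJ₁]
      rw [h1, ip_eq_fr (hPh k) (hPi k) (hJ'.herm k) (hJ'.idem k)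
        (hPz k) (hzJ₀ k), hP, mul_assoc, mul_assoc, ← mul_assoc (z₁ _), ← h1, ← mul_assoc]
    have h' : ∀ k, fr (part M (W k) * Ψ * J' k) = ∑ a, if W k a then fr (M a * Ψ * J' k) else 0 := by
      intro k
      rw [mul_assoc, hM.fr_part_mul]
      simp only [mul_assoc]
    simp only [h, h']
    rw [Finset.sum_comm, good_eq hM hJ' hΨ fun a k => W k a]
    linarith
  · have h : ∀ k, ip (J k * Ψ) (Ψ * J' k) = ∑ l, if k = l then fr (J k * Ψ * J' l) else 0 := by
      intro k
      have := ip_eq_fr (hJ.herm k) (hJ.idem k) (hJ'.herm k) (hJ'.idem k)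
        (mul_one _) (one_mul _) Ψ
      rw [mul_one, one_mul] at this
      rw [this]
      simp
    simp only [h]
    rw [good_eq hJ hJ' hΨ]
    linarith

/-- A measurement `T` of Alice that is consistent with a measurement `L` of Bob is close to an operator
that depends on `L` and on a coarser measurement of Alice only. -/
theorem sum_fr_sub_part_le [DecidableEq ι] {K V : Type} [Fintype K] [Fintype V]
    {T : K → Matrix ι ι ℂ} {L : B → Matrix ι ι ℂ} {z : V → Matrix ι ι ℂ} (hL : IsPVM L)
    (hz : IsPVM z) {Ψ : Matrix ι ι ℂ} (hΨ : fr Ψ = 1) {g : K → V} {W : K → B → Prop}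
    (hW : ∀ k l b, W k b → W l b → g k = g l → k = l) (hT : ∀ k, (T k)ᴴ = T k)
    (hT' : ∀ k, T k * T k = T k) (hTz : ∀ k, T k * z (g k) = T k)
    (h1 : ∑ k, fr (T k * Ψ) ≤ 1) {γ : ℝ}
    (hγ : 1 - γ ≤ ∑ k, ∑ b, if W k b then fr (T k * Ψ * L b) else 0) :
    ∑ k, fr (T k * Ψ - z (g k) * Ψ * part L (W k)) ≤ 2 * γ := by
  refine sum_fr_sub_le h1 ?_ ?_
  · refine le_trans (sum_fr_mul_part_le hL W g (fun v => z v * Ψ) ?_) (le_of_eq ?_)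
    · exact fun b k l => hW k l b
    · rw [hz.sum_fr_mul, hΨ]
  · have h : ∀ k, ip (T k * Ψ) (z (g k) * Ψ * part L (W k)) =
        ∑ b, if W k b then fr (T k * Ψ * L b) else 0 := by
      intro k
      have := ip_eq_fr (hT k) (hT' k) (hL.part_herm _) (hL.part_idem (W k)) (hTz k) (one_mul _) Ψ
      rw [mul_one] at this
      rw [this, hL.fr_mul_part]
    simp only [h]
    exact hγ

end

variable {F : Type} [Field F] [Fintype F] [DecidableEq F] [Algebra (ZMod 2) F] {n d : ℕ}
  {aux : Type} [Fintype aux] [DecidableEq aux]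
  {S : RegisterStrategy 2 F n (Fin 2 × AuxQuery) (Reply F n d) aux}
  (hS : S.IsProjective) {ε : ℝ} (hε : 1 - ε ≤ S.value (introIntersect F n d))

theorem part_lines (c : Fin 2) (v : Fin n → F) :
    (part (S.M (linesQ c)) fun a => a.1 = place c none (some v)) =
      zProj aux fun x => x (other c) = v :=
  (part_fst S _ _).trans (tensor_slope c v _)

theorem pointMeas_mul_zProj {G : (Fin n → F) → F → Matrix aux aux ℂ} (hG : ∀ w, IsPVM (G w))
    (φ : (Fin 2 → Fin n → F) → Fin n → F) {T : (Fin 2 → Fin n → F) → Prop}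
    {k : (Fin 2 → Fin n → F) × F} (hk : T k.1) :
    pointMeas G φ k * zProj aux T = pointMeas G φ k := by
  have h := congrArg conjTranspose (zProj_mul_pointMeas G φ hk)
  rwa [conjTranspose_mul, (isPVM_pointMeas hG φ).herm, zProj_herm] at h

/-- The measurement of a point in the two registers is consistent, if the measurement in one of
them is. -/
theorem bad_pointMeas_self_le {G : (Fin n → F) → F → Matrix aux aux ℂ} (hG : ∀ w, IsPVM (G w))
    (c : Fin 2) :
    bad (pointMeas G fun x => x c) (fun k => (pointMeas G (fun x => x c) k)ᵀ) (stateMat S.state)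
        (fun k l => k = l) ≤
      bad (fun k : (Fin n → F) × F => tensor (place c (tauZ k.1) 1) (G k.1 k.2))
        (fun k : (Fin n → F) × F => (tensor (place c (tauZ k.1) 1) (G k.1 k.2))ᵀ) (stateMat S.state)
        (fun k l : (Fin n → F) × F => k.2 = l.2) := by
  have hJ := isPVM_pointMeas hG fun x : Fin 2 → Fin n → F => x c
  have h1 := bad_coarse_left hJ (fun k : (Fin n → F) × F => (tensor (place c (tauZ k.1) 1) (G k.1 k.2))ᵀ)
    (stateMat S.state) (fun l => (l.1 c, l.2)) fun k l : (Fin n → F) × F => k.2 = l.2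
  have h2 := bad_coarse_right (pointMeas G fun x => x c) hJ.transpose
    (stateMat S.state) (fun l => (l.1 c, l.2)) fun k l => k.2 = l.2
  simp only [part_transpose] at h2
  simp only [part_pointMeas] at h1 h2
  rw [h1, h2]
  refine Finset.sum_le_sum fun k _ => Finset.sum_le_sum fun l _ => ?_
  by_cases h : k = l
  · subst h
    simp
  · rw [if_neg h]
    split_ifs with h'
    -- Equal values but k ≠ l means different register contents. Since Ψ is a multiple of the
    -- identity on the registers, the two players never obtain different contents, and the weight is
    -- zero.
    · have h3 : k.1 ≠ l.1 := fun h3 => h (Prod.ext h3 h')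
      have h4 := pointMeas_mul_zProj hG (fun x => x c) (T := fun x => x = k.1) (k := k) rfl
      have h5 := congrArg transpose
        (pointMeas_mul_zProj hG (fun x => x c) (T := fun x => x = l.1) (k := l) rfl)
      rw [transpose_mul, zProj_transpose] at h5
      have h6 : zProj aux (fun x => x = k.1) * zProj aux (fun x => x = l.1) = 0 := by
        rw [zProj_mul_zProj, zProj]
        ext x y
        rw [kroneckerMap_apply, diagonal_apply]
        have h7 : ¬(x.1 = k.1 ∧ x.1 = l.1) := fun h => h3 (h.1.symm.trans h.2)
        simp [h7]
      beta_reduce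
      rw [← h4, ← h5, mul_assoc, mul_assoc, ← mul_assoc (zProj aux _) (stateMat _), zProj_mul_state,
        mul_assoc (stateMat _), ← mul_assoc (zProj aux _) (zProj aux _), h6]
      simp
    · exact le_rfl

/-- If both players apply the shift, it passes through Ψ and cancels. The weights are only permuted,
so self-consistency is preserved without loss. -/
theorem bad_pointMeas_shift_self (S : RegisterStrategy 2 F n (Fin 2 × AuxQuery) (Reply F n d) aux)
    (G : (Fin n → F) → F → Matrix aux aux ℂ) (c : Fin 2)
    {φ φ' : (Fin 2 → Fin n → F) → Fin n → F} (hφ : ∀ x, φ (shift c x) = φ' x) :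
    bad (pointMeas G φ) (fun k => (pointMeas G φ k)ᵀ) (stateMat S.state) (fun k l => k = l) =
      bad (pointMeas G φ') (fun k => (pointMeas G φ' k)ᵀ) (stateMat S.state) (fun k l => k = l) := by
  obtain rfl : φ ∘ shift c = φ' := funext hφ
  let e : ((Fin 2 → Fin n → F) × F) ≃ ((Fin 2 → Fin n → F) × F) :=
    (Involutive.toPerm (shift c) (shift_shift c)).prodCongr (Equiv.refl F)
  refine (Fintype.sum_equiv e _ _ fun k => Fintype.sum_equiv e _ _ fun l => ?_).symm
  beta_reduce
  rw [← shift_conj_pointMeas G φ c k, ← shift_conj_pointMeas G φ c l]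
  by_cases hkl : k = l
  · rw [if_pos hkl, if_pos (congrArg e hkl)]
  rw [if_neg hkl, if_neg (e.injective.ne hkl)]
  change fr (shiftMat aux c * pointMeas G φ (e k) * shiftMat aux c * stateMat S.state *
    (shiftMat aux c * pointMeas G φ (e l) * shiftMat aux c)ᵀ) = _
  have hU : (shiftMat aux c : Matrix ((Fin 2 → Fin n → F) × aux) _ ℂ) * (shiftMat aux c)ᴴ = 1 := by
    rw [shiftMat_herm, shiftMat_mul_self]
  have hU' : (shiftMat aux c : Matrix ((Fin 2 → Fin n → F) × aux) _ ℂ)ᴴ * shiftMat aux c = 1 := by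
    rw [shiftMat_herm, shiftMat_mul_self]
  rw [transpose_mul, transpose_mul, shiftMat_transpose, mul_assoc _ (shiftMat aux c) (stateMat _),
    shiftMat_mul_state, mul_assoc, mul_assoc, mul_assoc, mul_assoc,
    ← mul_assoc (shiftMat aux c) (shiftMat aux c), shiftMat_mul_self, one_mul,
    fr_isometry_mul hU', ← mul_assoc, ← mul_assoc, fr_mul_isometry hU,
    mul_assoc]

include hS hε

/-- The consistency round compares values only. That the points agree as well is automatic on EPR
pairs, as used in `bad_pointMeas_self_le`. -/
theorem bad_points_self_le :
    bad (pointsMeas S 0) (fun k => (pointsMeas S 0 k)ᵀ) (stateMat S.state)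
      (fun k l => k.2 = l.2) ≤ 64 * ε := by
  let e : (Fin n → F) × F → A F n d := fun k => (place 0 (some k.1) none, .value k.2)
  have he : Injective e := by
    rintro ⟨u, ν⟩ ⟨u', ν'⟩ h
    simpa [e, place_inj] using h
  refine (bad_mono _ _ _ (S := fun k l => Round.consistency.check (e k) (e l)) ?_).trans
    ((bad_injective_le (S.M (pointsQ 0)) _ _
      (fun a l => Round.consistency.check a (e l)) he).trans
      ((bad_injective_right_le _ (fun a => (S.M (pointsQ 0) a)ᵀ) _
        (fun a b => Round.consistency.check a b) he).trans (bad_check_le hS hε .consistency)))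
  rintro ⟨u, ν⟩ ⟨u', ν'⟩ ⟨w, w', μ, h1, h2⟩
  simp only [e, Prod.mk.injEq, place_inj, Option.some.injEq, Reply.value.injEq, and_true] at h1 h2
  exact h1.2.trans h2.2.symm

/-- The value of the function of the second copy agrees with the measurement of the point, at the
sum of the contents of the registers. -/
theorem bad_intersect_le {G : (Fin n → F) → F → Matrix aux aux ℂ} (hG : ∀ w, IsPVM (G w))
    {J : (Fin 2 → Fin n → F) × F → Matrix ((Fin 2 → Fin n → F) × aux) _ ℂ}
    (hJd : J = pointMeas G fun x => x 0 + x 1) {b c : ℝ}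
    (h0 : bad J (bobLines S 0) (stateMat S.state)
      (fun k f => OptionHasValue f (k.1 0 + k.1 1) k.2) ≤ b)
    (hc : bad J (fun k => (J k)ᵀ) (stateMat S.state) (fun k l => k = l) ≤ c) :
    bad J (bobLines S 1) (stateMat S.state)
      (fun k f => OptionHasValue f (k.1 0 + k.1 1) k.2) ≤ 5 * (64 * ε) + 4 * b + 5 * c := by
  have hJ : IsPVM J := hJd ▸ isPVM_pointMeas hG _
  have hM := isPVM_M hS (linesQ 0)
  have hN := (isPVM_M hS (linesQ 1)).transpose
  have hJz : ∀ (c : Fin 2) k, J k * zProj aux (fun x => x c = k.1 c) = J k :=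
    fun c k => hJd ▸ pointMeas_mul_zProj hG _ rfl
  have hzJ : ∀ (c : Fin 2) k, zProj aux (fun x => x c = k.1 c) * (J k)ᵀ = (J k)ᵀ := fun c k => by
    have h := congrArg transpose (hJz c k)
    rwa [transpose_mul, zProj_transpose] at h
  have hN0 : ∀ u, (part (fun a => (S.M (linesQ 1) a)ᵀ) fun a => a.1 = place 1 none (some u)) =
      zProj aux fun x => x 0 = u := by
    intro u
    rw [part_transpose, part_lines 1, zProj_transpose]
    rfl
  have hinj : ∀ (k l : (Fin 2 → Fin n → F) × F) (a : A F n d),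
      OptionHasValue a.2.lineKey (k.1 0 + k.1 1) k.2 →
      OptionHasValue a.2.lineKey (l.1 0 + l.1 1) l.2 → k.1 0 = l.1 0 → k.1 1 = l.1 1 → k = l := by
    intro k l a h1 h2 h3 h4
    rw [← h3, ← h4] at h2
    exact Prod.ext ((eq_iff_place 0 _ _).2 ⟨h3, h4⟩) (h1.unique h2)
  have hplace : ∀ (c : Fin 2) (u v : Fin n → F) (a : A F n d), a.1 = place c none (some u) →
      a.1 = place c none (some v) → u = v := fun c u v a h h' => by
    have h := h.symm.trans h'
    simpa [place_inj] using h
  rw [show bobLines S 1 = fun f => part (fun a => (S.M (linesQ 1) a)ᵀ) fun a => a.2.lineKey = f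
    from rfl, bad_coarse_right J hN]
  rw [show bobLines S 0 = fun f => part (fun a => (S.M (linesQ 0) a)ᵀ) fun a => a.2.lineKey = f
    from rfl, bad_coarse_right J hM.transpose, ← bad_transpose, stateMat_transpose] at h0
  refine bad_trans_le hM hN hJ hJ.transpose (isPVM_zProj 0) (isPVM_zProj 1) (fr_state S)
    (fun u => zProj_mul_state S _) (fun u => zProj_mul_state S _) (part_lines 0) hN0 (hplace 0)
    (hplace 1) (hJz 0) (hJz 1) (hzJ 0) (hzJ 1) hinj hinj ?_ (bad_check_le hS hε .intersect) h0 hc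
  rintro _ _ ⟨u, v, f, f', ν, rfl, rfl, h5, h6⟩
  -- The joint outcome is read off both answers: v from Alice's slope register, u from Bob's, and ν
  -- is the common value at u + v.
  exact ⟨(place 0 u v, ν), ⟨⟨f, rfl, h5⟩, rfl⟩, rfl, ⟨f', rfl, h6⟩⟩

/-- Agreement with G is carried from the first copy to the second through the points u, u + v, u +
v, v. Both G at v and the points prover of the second copy then agree with the same line measurement
of Bob, and so are close to each other. -/
theorem stateDist_points_le {G : PolyFn F n d → Matrix aux aux ℂ} (hG : IsProjMeas G)
    (hA : ∀ u ν, pointsMeas S 0 (u, ν) = tensor ![tauZ u, 1] (marginal G (fun g => g.1 u) ν)) :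
    stateDist S.state (pointsMeas S 1)
      (fun o => tensor ![1, tauZ o.1] (marginal G (fun g => g.1 o.1) o.2)) ≤ 10 ^ 6 * ε := by
  let Gm : (Fin n → F) → F → Matrix aux aux ℂ := fun w ν => marginal G (fun g => g.1 w) ν
  have hGm : ∀ w, IsPVM (Gm w) := fun w => (IsPVM.of_isProjMeas hG).coarse fun g => g.1 w
  have hA' : pointsMeas S 0 = fun k => tensor (place 0 (tauZ k.1) 1) (Gm k.1 k.2) := by
    funext k
    rw [hA]
    congr 1
    funext i
    fin_cases i <;> rfl
  have hB : (fun k : (Fin n → F) × F => tensor ![1, tauZ k.1] (marginal G (fun g => g.1 k.1) k.2)) =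
      fun k => tensor (place 1 (tauZ k.1) 1) (Gm k.1 k.2) := by
    funext k
    congr 1
    funext i
    fin_cases i <;> rfl
  have hε0 : 0 ≤ 64 * ε := (bad_nonneg _ _ _ _).trans (bad_check_le hS hε .consistency)
  -- The cross-check of the first copy, rewritten by the assumption on A. The measurement is refined
  -- to read both registers, which does not affect the weight and makes the shift applicable.
  have c0 : bad (pointMeas Gm fun x => x 0) (bobLines S 0) (stateMat S.state)
      (fun k f => OptionHasValue f (k.1 0) k.2) ≤ 64 * ε := by
    have h := bad_cross_le hS hε 0
    rw [hA'] at h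
    simp only [← part_pointMeas Gm 0] at h
    exact (bad_coarse_left (isPVM_pointMeas hGm fun x => x 0) _ _ (fun l => (l.1 0, l.2))
      fun k f => OptionHasValue f k.1 k.2).symm.le.trans h
  -- In units of 64ε the bound is now 2·1 + 288 = 290, at the point u + v.
  have c1 := bad_pointMeas_shift_le hS hε hGm 0 (φ := fun x => x 0) (φ' := fun x => x 0 + x 1)
    fun x => by simp [shift, other]
  have hs := bad_points_self_le hS hε
  rw [hA'] at hs
  have hs0 := (bad_pointMeas_self_le (S := S) hGm 0).trans hs
  have hs1 : bad (pointMeas Gm fun x => x 0 + x 1) (fun k => (pointMeas Gm (fun x => x 0 + x 1) k)ᵀ)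
      (stateMat S.state) (fun k l => k = l) ≤ 64 * ε := by
    rw [← bad_pointMeas_shift_self S Gm 0 (φ := fun x => x 0) fun x => by simp [shift, other]]
    exact hs0
  -- The function of the second copy takes over, at the same point: 5 + 4·290 + 5 = 1170.
  have c2 := bad_intersect_le hS hε hGm rfl c1 hs1
  -- The second copy adds the content of register 0 to register 1, so the point u + v becomes u + (v
  -- + u) = v; the bound is 2·1170 + 288 = 2628.
  have c3 := bad_pointMeas_shift_le hS hε hGm 1 (φ := fun x => x 0 + x 1) (φ' := fun x => x 1)
    fun x => by
      simp only [shift, other, place]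
      simp [add_left_comm (x 0), add_self_eq_zero']
  have hJ := isPVM_pointMeas hGm fun x : Fin 2 → Fin n → F => x 1
  have hT := hJ.coarse fun l : (Fin 2 → Fin n → F) × F => (l.1 1, l.2)
  have c4 := good_eq hT (isPVM_bobLines hS 1) (fr_state S) fun k f => OptionHasValue f k.1 k.2
  rw [bad_coarse_left hJ] at c4
  simp only [part_pointMeas Gm 1] at hT c4
  have hz : ∀ k : (Fin n → F) × F, tensor (place 1 (tauZ k.1) 1) (Gm k.1 k.2) *
      zProj aux (fun x => x 1 = k.1) = tensor (place 1 (tauZ k.1) 1) (Gm k.1 k.2) := by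
    intro k
    rw [tensor_tauZ, zProj, ← mul_kronecker_mul, mul_one, diagonal_mul_diagonal]
    congr 2
    funext x
    by_cases h : x 1 = k.1 <;> simp [h]
  have hM := isPVM_M hS (pointsQ 1)
  have hz' : ∀ k : (Fin n → F) × F, pointsMeas S 1 k * zProj aux (fun x => x 1 = k.1) =
      pointsMeas S 1 k := by
    rintro ⟨v, ν⟩
    rw [← tensor_tauZ_one]
    have h : (part (S.M (pointsQ 1)) fun a => a.1 = place 1 (some v) none) =
        tensor (place 1 (tauZ v) 1) 1 :=
      (part_fst S _ _).trans (tensor_pauliProj 1 .Z .H (some v) none 1)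
    rw [← h, pointsMeas, ← part_eq (S.M (pointsQ 1)), hM.part_mul_part]
    congr 1
    funext a
    refine propext (and_iff_left_of_imp ?_)
    rintro rfl
    rfl
  have hW : ∀ (k l : (Fin n → F) × F) (f : Option (LineFn F n d)), OptionHasValue f k.1 k.2 →
      OptionHasValue f l.1 l.2 → k.1 = l.1 → k = l := by
    intro k l f h1 h2 h3
    rw [← h3] at h2
    exact Prod.ext h3 (h1.unique h2)
  have he : Injective fun k : (Fin n → F) × F =>
      ((place 1 (some k.1) none, .value k.2) : A F n d) := by
    rintro ⟨u, ν⟩ ⟨u', ν'⟩ h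
    simpa [place_inj] using h
  -- Only an inequality: answers of the points prover in a wrong format are left out of the sum.
  have hone : ∑ k, fr (pointsMeas S 1 k * stateMat S.state) ≤ 1 := by
    rw [← fr_state S, ← hM.sum_fr_mul]
    refine le_trans (le_of_eq ?_) (Finset.sum_le_sum_of_subset_of_nonneg (Finset.subset_univ
      (Finset.univ.image fun k : (Fin n → F) × F =>
        ((place 1 (some k.1) none, .value k.2) : A F n d))) fun _ _ _ => fr_nonneg _)
    rw [Finset.sum_image fun _ _ _ _ h => he h]
    rfl
  have d1 := sum_fr_sub_part_le (isPVM_bobLines hS 1) (isPVM_zProj 1) (fr_state S) hW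
    (fun k => hM.herm _) (fun k => hM.idem _) hz' hone (good_cross_le hS hε 1)
  have d2 := sum_fr_sub_part_le (isPVM_bobLines hS 1) (isPVM_zProj 1) (fr_state S) hW
    hT.herm hT.idem hz (by rw [hT.sum_fr_mul, fr_state]) (γ := 2628 * (64 * ε))
    (by rw [c4]; linarith)
  rw [hB, stateDist_eq]
  -- The common reference: Alice measures the point in register 1 honestly, and Bob's line
  -- measurement supplies the value. Both families are close to it.
  set Y : (Fin n → F) × F → Matrix ((Fin 2 → Fin n → F) × aux) ((Fin 2 → Fin n → F) × aux) ℂ :=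
    fun k => zProj aux (fun x => x 1 = k.1) * stateMat S.state *
      part (bobLines S 1) fun f => OptionHasValue f k.1 k.2
  refine (Finset.sum_le_sum fun k _ => ?_).trans (?_ : ∑ k, (2 * fr (pointsMeas S 1 k *
    stateMat S.state - Y k) + 2 * fr (tensor (place 1 (tauZ k.1) 1) (Gm k.1 k.2) *
      stateMat S.state - Y k)) ≤ _)
  · have := fr_add_le (pointsMeas S 1 k * stateMat S.state - Y k)
      (Y k - tensor (place 1 (tauZ k.1) 1) (Gm k.1 k.2) * stateMat S.state)
    rwa [sub_add_sub_cancel, fr_sub_comm (Y k)] at this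
  · rw [Finset.sum_add_distrib, ← Finset.mul_sum, ← Finset.mul_sum]
    have d1' : ∑ k, fr (pointsMeas S 1 k * stateMat S.state - Y k) ≤ 2 * (64 * ε) := d1
    have d2' : ∑ k, fr (tensor (place 1 (tauZ k.1) 1) (Gm k.1 k.2) * stateMat S.state - Y k) ≤
      2 * (2628 * (64 * ε)) := d2
    -- The sum is 2·2 + 2·2·2628 = 10516 in units of 64ε, which is 673024ε.
    linarith

end Soundness

/-! ### Measurements for completeness -/

section Honest

open Matrix

open scoped Classical

set_option linter.unusedSectionVars false

section

variable {ι A B : Type} [Fintype ι] [Fintype A] [Fintype B] [DecidableEq ι]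
  {M : A → Matrix ι ι ℂ} {N : B → Matrix ι ι ℂ}

theorem IsPVM.mul (hM : IsPVM M) (hN : IsPVM N) (h : ∀ a b, M a * N b = N b * M a) :
    IsPVM fun k : A × B => M k.1 * N k.2 where
  herm k := by rw [conjTranspose_mul, hM.herm, hN.herm, h]
  idem k := by
    rw [mul_assoc, ← mul_assoc (N k.2), ← h, mul_assoc (M k.1), hN.idem, ← mul_assoc, hM.idem]
  sum := by
    rw [Fintype.sum_prod_type]
    simp only [← Finset.mul_sum, hN.sum, mul_one, hM.sum]

theorem part_mul_fst (hN : IsPVM N) (S : A → Prop) :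
    (part (fun k : A × B => M k.1 * N k.2) fun k => S k.1) = part M S := by
  rw [part, part, Fintype.sum_prod_type]
  refine Finset.sum_congr rfl fun a _ => ?_
  split_ifs
  · dsimp only
    rw [← Finset.mul_sum, hN.sum, mul_one]
  · simp

theorem part_mul_snd (hM : IsPVM M) (S : B → Prop) :
    (part (fun k : A × B => M k.1 * N k.2) fun k => S k.2) = part N S := by
  rw [part, part, Fintype.sum_prod_type_right]
  refine Finset.sum_congr rfl fun b _ => ?_
  split_ifs
  · dsimp only
    rw [← Finset.sum_mul, hM.sum, one_mul]
  · simp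

theorem IsPVM.part_const (hM : IsPVM M) (p : Prop) :
    (part M fun _ => p) = if p then 1 else 0 := by
  split_ifs with h <;> simp [part, h, hM.sum]

theorem exists_of_part_ne_zero {S : A → Prop} (h : part M S ≠ 0) : ∃ a, S a := by
  by_contra! h'
  exact h (Finset.sum_eq_zero fun a _ => if_neg (h' a))

theorem isProjMeas_of_isPVM (hM : IsPVM M) : IsProjMeas M := by
  refine ⟨⟨fun a => ?_, hM.sum⟩, hM.idem⟩
  have h := posSemidef_conjTranspose_mul_self (M a)
  rwa [hM.herm, hM.idem] at h

theorem commute_of_isDiag {X Y : Matrix ι ι ℂ} (hX : X.IsDiag) (hY : Y.IsDiag) : Commute X Y := by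
  rw [← hX.diagonal_diag, ← hY.diagonal_diag]
  exact commute_diagonal _ _

theorem isDiag_part (hM : ∀ a, (M a).IsDiag) (S : A → Prop) : (part M S).IsDiag := by
  intro i j hij
  rw [part, Matrix.sum_apply]
  refine Finset.sum_eq_zero fun a _ => ?_
  split_ifs
  · exact hM a hij
  · rfl

end

variable {F : Type} [Field F] [Fintype F] [DecidableEq F] [Algebra (ZMod 2) F] {n d : ℕ}

theorem isDiag_tauZ (u : Fin n → F) : (tauZ u).IsDiag := fun x y hxy =>
  (tauZ_apply u x y).trans (if_neg fun h => hxy h.1)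

theorem isPVM_tauZ : IsPVM (tauZ : (Fin n → F) → _) where
  herm u := by
    ext x y
    rw [conjTranspose_apply, tauZ_apply, tauZ_apply]
    by_cases h : x = y
    · subst h; split_ifs <;> simp
    · simp [h, Ne.symm h]
  idem u := by
    ext x y
    rw [mul_apply]
    simp only [tauZ_apply]
    by_cases h : x = y
    · subst h
      by_cases h1 : x = u
      · subst h1; simp
      · simp [h1]
    · rw [if_neg fun h' => h h'.1]
      refine Finset.sum_eq_zero fun z _ => ?_
      by_cases h1 : x = z
      · subst h1; simp [h]
      · simp [h1]
  sum := by
    ext x y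
    rw [Matrix.sum_apply]
    simp only [tauZ_apply, one_apply]
    by_cases h : x = y
    · subst h; simp
    · simp [h]

theorem tauZ_transpose (u : Fin n → F) : (tauZ u)ᵀ = tauZ u := (isDiag_tauZ u).isSymm

theorem tauX_transpose (u : Fin n → F) : (tauX u)ᵀ = tauX u := by
  ext x y
  rw [transpose_apply, tauX_apply, tauX_apply, add_comm]

theorem add_eq_zero_iff_eq' (x y : Fin n → F) : x + y = 0 ↔ x = y := by
  have h := add_self_eq_zero' y
  constructor
  · intro h'
    exact add_right_cancel (h'.trans h.symm)
  · rintro rfl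
    exact h

theorem isPVM_tauX : IsPVM (tauX : (Fin n → F) → _) where
  herm u := by
    ext x y
    rw [conjTranspose_apply, tauX_apply, tauX_apply, add_comm]
    simp
  idem u := by
    have hq : (Fintype.card F : ℂ) ^ n ≠ 0 :=
      pow_ne_zero _ (Nat.cast_ne_zero.2 Fintype.card_ne_zero)
    ext x y
    rw [mul_apply]
    have h : ∀ z, tauX u x z * tauX u z y = ((Fintype.card F : ℂ) ^ n)⁻¹ * tauX u x y := by
      intro z
      simp only [tauX_apply]
      have h1 : x + y = (x + z) + (z + y) := by
        rw [add_assoc, ← add_assoc z, add_self_eq_zero', zero_add]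
      rw [h1, dotProduct_add u (x + z), map_add, neg_one_pow_add]
      ring
    simp only [h]
    rw [Finset.sum_const, Finset.card_univ, Fintype.card_fun, Fintype.card_fin, nsmul_eq_mul]
    push_cast
    rw [← mul_assoc, mul_inv_cancel₀ hq, one_mul]
  sum := by
    have hq : (Fintype.card F : ℂ) ^ n ≠ 0 :=
      pow_ne_zero _ (Nat.cast_ne_zero.2 Fintype.card_ne_zero)
    ext x y
    rw [Matrix.sum_apply]
    simp only [tauX_apply]
    rw [← Finset.mul_sum, sum_char, one_apply]
    simp only [add_eq_zero_iff_eq']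
    split_ifs
    · exact inv_mul_cancel₀ hq
    · exact mul_zero _

/-- A vector that is orthogonal to every vector orthogonal to `v` is a multiple of `v`. -/
theorem exists_smul_eq {v w : Fin n → F} (h : ∀ z, v ⬝ᵥ z = 0 → z ⬝ᵥ w = 0) :
    ∃ c : F, w = c • v := by
  by_cases hv : v = 0
  · refine ⟨0, ?_⟩
    rw [zero_smul]
    funext i
    have := h (Pi.single i 1) (by simp [hv])
    simpa using this
  · obtain ⟨j, hj⟩ := Function.ne_iff.1 hv
    refine ⟨w j / v j, ?_⟩
    funext i
    -- The test vector has v j at place i and -v i at place j, hence is orthogonal to v; with j a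
    -- place where v is nonzero, it determines each w i.
    have h1 := h (Pi.single i (v j) - Pi.single j (v i)) (by
      rw [dotProduct_sub, dotProduct_single, dotProduct_single]
      ring)
    rw [sub_dotProduct, single_dotProduct, single_dotProduct] at h1
    have hj : v j ≠ 0 := hj
    rw [Pi.smul_apply, smul_eq_mul]
    field_simp
    linear_combination h1

/-- The measurement of the dot product with `v` in the `X` basis only mixes points on a line in
direction `v`. -/
theorem part_tauX_apply (v x y : Fin n → F) (e : F) (hxy : ∀ c : F, y ≠ x + c • v) :
    (part tauX fun u => v ⬝ᵥ u = e) x y = 0 := by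
  have hw : ∀ c : F, x + y ≠ c • v := fun c hc => hxy c <| by
    rw [← hc, ← add_assoc, add_self_eq_zero', zero_add]
  -- If x + y is not a multiple of v, some z is orthogonal to v but not to x + y.
  obtain ⟨z, hz, hzw⟩ : ∃ z, v ⬝ᵥ z = 0 ∧ z ⬝ᵥ (x + y) ≠ 0 := by
    by_contra! h
    obtain ⟨c, hc⟩ := exists_smul_eq h
    exact hw c hc
  -- Translating u by a suitable multiple b • z preserves the condition on v ⬝ᵥ u and flips the sign
  -- of the matrix entry, so the sum is its own negative.
  obtain ⟨b, hb⟩ := exists_trace_eq_one hzw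
  rw [part, Matrix.sum_apply]
  have h := Equiv.sum_comp (Equiv.addRight (b • z)) fun u =>
    (if v ⬝ᵥ u = e then tauX u else 0 : Matrix _ _ ℂ) x y
  have h1 : ∀ u, (if v ⬝ᵥ (Equiv.addRight (b • z) u) = e then tauX (Equiv.addRight (b • z) u) else 0 :
      Matrix _ _ ℂ) x y = -(if v ⬝ᵥ u = e then tauX u else 0 : Matrix _ _ ℂ) x y := by
    intro u
    rw [Equiv.coe_addRight, dotProduct_add, dotProduct_smul, hz, smul_zero, add_zero]
    split_ifs
    · rw [tauX_apply, tauX_apply, add_dotProduct, map_add, neg_one_pow_add, smul_dotProduct,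
        smul_eq_mul, hb, show (1 : ZMod 2).val = 1 from rfl, pow_one]
      ring
    · simp
  simp only [h1, Finset.sum_neg_distrib] at h
  refine Eq.trans (Finset.sum_congr rfl fun u _ => ?_) (self_eq_neg.1 h.symm)
  congr!

/-! ### Polynomials on lines -/

theorem exists_eval_line (g : PolyFn F n d) (u v : Fin n → F) :
    ∃ p : Polynomial F, p.natDegree ≤ d ∧ ∀ c, g.1 (u + c • v) = p.eval c := by
  obtain ⟨P, hP, hg⟩ := g.2
  let q : Fin n → Polynomial F := fun i => Polynomial.C (u i) + Polynomial.X * Polynomial.C (v i)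
  have hq : ∀ i, (q i).natDegree ≤ 1 := fun i => by
    refine (Polynomial.natDegree_add_le _ _).trans (max_le (by simp) ?_)
    exact (Polynomial.natDegree_mul_C_le _ _).trans Polynomial.natDegree_X_le
  refine ⟨MvPolynomial.aeval q P, ?_, fun c => ?_⟩
  · refine (MvPolynomial.aeval_natDegree_le P hP q hq).trans (by simp)
  · rw [← hg, MvPolynomial.aeval_def, MvPolynomial.polynomial_eval_eval₂]
    have h1 : (Polynomial.evalRingHom c).comp (algebraMap F (Polynomial F)) = RingHom.id F := by
      ext
      simp
    rw [h1, MvPolynomial.eval₂_id]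
    congr 2
    funext i
    simp [q, mul_comm c]

/-- The restriction of a polynomial to a line. -/
def restrictLine (g : PolyFn F n d) (s : {s : Set (Fin n → F) // ∃ u v, s = lineThrough u v}) :
    LineFn F n d :=
  ⟨⟨s.1, fun x => g.1 x⟩, by
    obtain ⟨s, u, v, rfl⟩ := s
    obtain ⟨p, hp, h⟩ := exists_eval_line g u v
    exact ⟨u, v, p, hp, rfl, fun x c hx => by rw [← h, ← hx]⟩⟩

/-- The restriction of a polynomial to the line through `u` in direction `v`. -/
def polyLine (g : PolyFn F n d) (u v : Fin n → F) : LineFn F n d :=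
  restrictLine g ⟨lineThrough u v, u, v, rfl⟩

/-- The line and the restriction of g depend on the base point only up to multiples of v; this is
the invariance that makes the line compatible with measuring the dot product. -/
theorem polyLine_shift (g : PolyFn F n d) (u v : Fin n → F) (c : F) :
    polyLine g (u + c • v) v = polyLine g u v := by
  unfold polyLine
  congr 2
  ext x
  constructor
  · rintro ⟨b, rfl⟩
    exact ⟨c + b, by simp only [add_smul, add_assoc]⟩
  · rintro ⟨b, rfl⟩
    exact ⟨b - c, by simp only [sub_smul]; abel⟩

theorem hasValue_polyLine (g : PolyFn F n d) (u v : Fin n → F) (c : F) :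
    (polyLine g u v).HasValue (u + c • v) (g.1 (u + c • v)) :=
  ⟨⟨c, rfl⟩, rfl⟩

end Honest

/-! ### The honest strategy -/

section Honest

open Matrix

open scoped Classical

set_option linter.unusedSectionVars false

variable {F : Type} [Field F] [Fintype F] [DecidableEq F] [Algebra (ZMod 2) F] {n d : ℕ}
  {aux : Type} [Fintype aux] [DecidableEq aux]

theorem isPVM_pauliProj (W : PauliQuery) :
    IsPVM (pauliProj W : Option (Fin n → F) → Matrix (Fin n → F) (Fin n → F) ℂ) := by
  have h0 : ((0 : Matrix (Fin n → F) (Fin n → F) ℂ))ᴴ = 0 := conjTranspose_zero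
  cases W
  · exact ⟨fun o => by cases o; exacts [h0, isPVM_tauX.herm _],
      fun o => by cases o; exacts [mul_zero _, isPVM_tauX.idem _],
      by rw [Fintype.sum_option]; exact (zero_add _).trans isPVM_tauX.sum⟩
  · exact ⟨fun o => by cases o; exacts [h0, isPVM_tauZ.herm _],
      fun o => by cases o; exacts [mul_zero _, isPVM_tauZ.idem _],
      by rw [Fintype.sum_option]; exact (zero_add _).trans isPVM_tauZ.sum⟩
  · exact ⟨fun o => by cases o; exacts [conjTranspose_one, h0],
      fun o => by cases o; exacts [mul_one _, mul_zero _],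
      by rw [Fintype.sum_option]; simp [pauliProj]⟩
  · exact ⟨fun o => by cases o; exacts [conjTranspose_one, h0],
      fun o => by cases o; exacts [mul_one _, mul_zero _],
      by rw [Fintype.sum_option]; simp [pauliProj]⟩

theorem pauliProj_transpose (W : PauliQuery) (o : Option (Fin n → F)) :
    (pauliProj W o)ᵀ = pauliProj W o := by
  cases W <;> cases o <;> simp [pauliProj, tauX_transpose, tauZ_transpose]

/-- The measurement of the line through the point in a register in direction `v`, with the
restriction of `g` to it. -/
noncomputable def lineMeas (g : PolyFn F n d) (v : Fin n → F) (f : LineFn F n d) :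
    Matrix (Fin n → F) (Fin n → F) ℂ :=
  part tauZ fun u => polyLine g u v = f

/-- The measurement of the dot product with `v` in the `X` basis. -/
noncomputable def dotMeas (v : Fin n → F) (e : F) : Matrix (Fin n → F) (Fin n → F) ℂ :=
  part tauX fun u => v ⬝ᵥ u = e

/-- The joint measurement of the line and of the dot product. -/
noncomputable def lineDot (g : PolyFn F n d) (v : Fin n → F) (k : LineFn F n d × F) :
    Matrix (Fin n → F) (Fin n → F) ℂ :=
  lineMeas g v k.1 * dotMeas v k.2

theorem isPVM_lineMeas (g : PolyFn F n d) (v : Fin n → F) : IsPVM (lineMeas g v) :=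
  isPVM_tauZ.coarse fun u => polyLine g u v

theorem isPVM_dotMeas (v : Fin n → F) : IsPVM (dotMeas v) := isPVM_tauX.coarse fun u => v ⬝ᵥ u

theorem part_tauZ (T : (Fin n → F) → Prop) :
    part tauZ T = diagonal fun u => if T u then 1 else 0 := by
  ext x y
  rw [part, Matrix.sum_apply, Finset.sum_eq_single x, diagonal_apply]
  · by_cases h' : x = y
    · subst h'
      by_cases h : T x <;> simp [h, tauZ_apply]
    · by_cases h : T x <;> simp [h, h', tauZ_apply]
  · intro u _ hu
    by_cases h : T u
    · rw [if_pos h, tauZ_apply, if_neg fun h' => hu h'.2.symm]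
    · rw [if_neg h]
      rfl
  · simp

/-- The line measurement is diagonal and constant along direction v, while the dot measurement has
nonzero entries only between points that differ by a multiple of v. So on every entry that matters
the diagonal factors on both sides are equal. -/
theorem lineMeas_commute (g : PolyFn F n d) (v : Fin n → F) (f : LineFn F n d) (e : F) :
    lineMeas g v f * dotMeas v e = dotMeas v e * lineMeas g v f := by
  ext x y
  rw [lineMeas, part_tauZ, diagonal_mul, mul_diagonal, mul_comm]
  by_cases h : ∃ c : F, y = x + c • v
  · obtain ⟨c, rfl⟩ := h
    rw [polyLine_shift]
  · rw [dotMeas, part_tauX_apply v x y e fun c hc => h ⟨c, hc⟩, zero_mul, zero_mul]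

theorem isPVM_lineDot (g : PolyFn F n d) (v : Fin n → F) : IsPVM (lineDot g v) :=
  (isPVM_lineMeas g v).mul (isPVM_dotMeas v) (lineMeas_commute g v)

theorem part_lineDot_fst (g : PolyFn F n d) (v : Fin n → F) (f : LineFn F n d) :
    (part (lineDot g v) fun k => k.1 = f) = lineMeas g v f :=
  (part_mul_fst (isPVM_dotMeas v) fun f' => f' = f).trans (part_eq (lineMeas g v) f)

theorem part_lineDot_snd (g : PolyFn F n d) (v : Fin n → F) (e : F) :
    (part (lineDot g v) fun k => k.2 = e) = dotMeas v e :=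
  (part_mul_snd (isPVM_lineMeas g v) fun e' => e' = e).trans (part_eq (dotMeas v) e)

theorem lineMeas_transpose (g : PolyFn F n d) (v : Fin n → F) (f : LineFn F n d) :
    (lineMeas g v f)ᵀ = lineMeas g v f := by
  rw [lineMeas, ← part_transpose]
  simp only [tauZ_transpose]

theorem dotMeas_transpose (v : Fin n → F) (e : F) : (dotMeas v e)ᵀ = dotMeas v e := by
  rw [dotMeas, ← part_transpose]
  simp only [tauX_transpose]

theorem part_lineDot_transpose (g : PolyFn F n d) (v : Fin n → F) (T : LineFn F n d × F → Prop) :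
    (part (lineDot g v) T)ᵀ = part (lineDot g v) T := by
  rw [← part_transpose]
  congr 1
  funext k
  rw [lineDot, transpose_mul, lineMeas_transpose, dotMeas_transpose, lineMeas_commute]

/-- The second block of the honest answer, as a function of the answers to the basis queries and of
the result of `lineDot`. -/
def honestReply (g : PolyFn F n d) (x : Q) (o : Fin 2 → Option (Fin n → F))
    (k : LineFn F n d × F) : Reply F n d :=
  match x.1 x.2.1, x.2.2 with
  | .bot, .surface => .line k.1
  | .bot, .surfaceX => .lineDot k.1 k.2
  | .bot, .botX => .dot k.2
  | .Z, .surface => .line (polyLine g ((o x.2.1).getD 0) ((o (other x.2.1)).getD 0))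
  | .Z, .point => .value (g.1 ((o x.2.1).getD 0))
  | _, _ => .empty

/-- The action of the honest measurements on a register. -/
noncomputable def factor (g : PolyFn F n d) (x : Q) (a : A F n d) (i : Fin 2) :
    Matrix (Fin n → F) (Fin n → F) ℂ :=
  pauliProj (x.1 i) (a.1 i) * if i = x.2.1
    -- The direction defaults to 0 if the other register returns no vector. This keeps the
    -- measurement defined for every question; where the queried register is measured or hidden, the
    -- outcome of `lineDot` does not enter the reply.
    then part (lineDot g ((a.1 (other i)).getD 0)) fun k => honestReply g x a.1 k = a.2 else 1

theorem honestReply_const (g : PolyFn F n d) {x : Q} (hx : x.1 x.2.1 ≠ .bot)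
    (o : Fin 2 → Option (Fin n → F)) (k k' : LineFn F n d × F) :
    honestReply g x o k = honestReply g x o k' := by
  unfold honestReply
  split <;> first | rfl | (exact absurd (by assumption) hx)

/-- The part of the second block of the answer in a measurement of a register is trivial, if the
register is queried. -/
theorem factor_trivial (g : PolyFn F n d) (x : Q) (a : A F n d) {i : Fin 2} (hi : x.1 i ≠ .bot) :
    factor g x a i = pauliProj (x.1 i) (a.1 i) ∨ factor g x a i = 0 := by
  rw [factor]
  split_ifs with h
  · subst h
    let k₀ : LineFn F n d × F := (polyLine g 0 0, 0)
    have : (fun k => honestReply g x a.1 k = a.2) = fun _ => honestReply g x a.1 k₀ = a.2 := by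
      funext k
      rw [honestReply_const g hi a.1 k k₀]
    rw [this, (isPVM_lineDot g _).part_const]
    split_ifs
    · exact .inl (mul_one _)
    · exact .inr (mul_zero _)
  · exact .inl (mul_one _)

/-- Hermitian and symmetric together give real entries, and symmetry also removes the transposes on
Bob's side. -/
theorem factor_spec (g : PolyFn F n d) (x : Q) (a : A F n d) (i : Fin 2) :
    (factor g x a i)ᴴ = factor g x a i ∧ (factor g x a i)ᵀ = factor g x a i ∧
      factor g x a i * factor g x a i = factor g x a i := by
  by_cases hi : x.1 i = .bot
  · rw [factor]
    split_ifs
    · rw [hi]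
      cases a.1 i with
      | none =>
        rw [pauliProj, one_mul]
        exact ⟨(isPVM_lineDot g _).part_herm _, part_lineDot_transpose g _ _,
          (isPVM_lineDot g _).part_idem _⟩
      | some u => simp [pauliProj]
    · rw [mul_one]
      exact ⟨(isPVM_pauliProj _).herm _, pauliProj_transpose _ _, (isPVM_pauliProj _).idem _⟩
  · rcases factor_trivial g x a hi with h | h <;> rw [h]
    · exact ⟨(isPVM_pauliProj _).herm _, pauliProj_transpose _ _, (isPVM_pauliProj _).idem _⟩
    · simp

theorem tensor_mul_tensor (P R : Fin 2 → Matrix (Fin n → F) (Fin n → F) ℂ) :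
    tensor P (1 : Matrix aux aux ℂ) * tensor R 1 = tensor (fun i => P i * R i) 1 := by
  ext ⟨x, a⟩ ⟨y, b⟩
  simp only [mul_apply, tensor, of_apply]
  rw [Finset.prod_univ_sum, Fintype.piFinset_univ, Fintype.sum_prod_type, Finset.sum_mul]
  refine Finset.sum_congr rfl fun z _ => ?_
  rw [Finset.prod_mul_distrib, Finset.sum_eq_single a]
  · rw [one_apply_eq]
    ring
  · intro b _ hb
    rw [one_apply_ne hb.symm]
    ring
  · simp

theorem sum_tensor {O : Type} [Fintype O] (P : Fin 2 → O → Matrix (Fin n → F) (Fin n → F) ℂ) :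
    ∑ o : Fin 2 → O, tensor (fun i => P i (o i)) (1 : Matrix aux aux ℂ) =
      tensor (fun i => ∑ s, P i s) 1 := by
  ext ⟨x, a⟩ ⟨y, b⟩
  simp only [Matrix.sum_apply, tensor, of_apply]
  rw [Finset.prod_univ_sum, Fintype.piFinset_univ, Finset.sum_mul]

theorem tensor_one : tensor (fun _ => 1) 1 =
    (1 : Matrix ((Fin 2 → Fin n → F) × aux) ((Fin 2 → Fin n → F) × aux) ℂ) := by
  ext ⟨x, a⟩ ⟨y, b⟩
  simp only [tensor, of_apply, one_apply, Prod.mk.injEq, Fin.prod_univ_two]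
  have h : x = y ↔ x 0 = y 0 ∧ x 1 = y 1 := eq_iff_place 0 x y
  by_cases h0 : x 0 = y 0 <;> by_cases h1 : x 1 = y 1 <;> by_cases h2 : a = b <;>
    simp [h, h0, h1, h2]

theorem tensor_eq_zero {P : Fin 2 → Matrix (Fin n → F) (Fin n → F) ℂ} {i : Fin 2} (h : P i = 0) :
    tensor P (1 : Matrix aux aux ℂ) = 0 := by
  ext x y
  rw [tensor, of_apply, Finset.prod_eq_zero (Finset.mem_univ i) (by rw [h]; rfl), zero_mul]
  rfl

theorem tensor_transpose (P : Fin 2 → Matrix (Fin n → F) (Fin n → F) ℂ) :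
    (tensor P (1 : Matrix aux aux ℂ))ᵀ = tensor (fun i => (P i)ᵀ) 1 := by
  ext x y
  rw [transpose_apply, tensor, of_apply, tensor, of_apply, ← transpose_apply 1, transpose_one]
  rfl

theorem tensor_conjTranspose (P : Fin 2 → Matrix (Fin n → F) (Fin n → F) ℂ) :
    (tensor P (1 : Matrix aux aux ℂ))ᴴ = tensor (fun i => (P i)ᴴ) 1 := by
  ext x y
  rw [conjTranspose_apply, tensor, of_apply, tensor, of_apply, star_mul', star_prod,
    ← conjTranspose_apply 1, conjTranspose_one]
  rfl

theorem hidesRegisters_tensor {P : Fin 2 → Matrix (Fin n → F) (Fin n → F) ℂ} {T : Fin 2 → Prop}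
    (h : ∀ i, T i → ∃ s : ℂ, P i = s • 1) : HidesRegisters T (tensor P (1 : Matrix aux aux ℂ)) := by
  choose! s hs using h
  refine ⟨Matrix.of fun x y => ((∏ i : {i // T i}, s i) *
    ∏ i : {i // ¬T i}, P i (x.1 i) (y.1 i)) * (1 : Matrix aux aux ℂ) x.2 y.2, fun x y => ?_⟩
  rw [tensor, of_apply, of_apply, ← Fintype.prod_subtype_mul_prod_subtype T]
  have h1 : ∀ i : {i // T i}, P i (x.1 i) (y.1 i) = if x.1 i = y.1 i then s i else 0 := by
    rintro ⟨i, hi⟩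
    rw [hs i hi, Matrix.smul_apply, one_apply, smul_eq_mul, mul_ite, mul_one, mul_zero]
  simp only [h1]
  split_ifs with h2
  · congr 2
    exact Finset.prod_congr rfl fun i _ => if_pos (h2 i i.2)
  · push Not at h2
    obtain ⟨i, hi, hxy⟩ := h2
    rw [Finset.prod_eq_zero (Finset.mem_univ ⟨i, hi⟩) (if_neg hxy), zero_mul, zero_mul]

theorem sum_tensor_factor (g : PolyFn F n d) (x : Q) (o : Fin 2 → Option (Fin n → F)) :
    ∑ r, tensor (factor g x (o, r)) (1 : Matrix aux aux ℂ) =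
      tensor (fun i => pauliProj (x.1 i) (o i)) 1 := by
  ext ⟨y, a⟩ ⟨z, b⟩
  have h := ((isPVM_lineDot g ((o (other x.2.1)).getD 0)).coarse fun k => honestReply g x o k).sum
  have h1 : ∑ r, factor g x (o, r) x.2.1 = pauliProj (x.1 x.2.1) (o x.2.1) := by
    simp only [factor, if_true]
    rw [← Finset.mul_sum, h, mul_one]
  have h2 : ∀ r, factor g x (o, r) (other x.2.1) =
      pauliProj (x.1 (other x.2.1)) (o (other x.2.1)) := by
    intro r
    have hne : other x.2.1 ≠ x.2.1 := by
      generalize x.2.1 = c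
      fin_cases c <;> decide
    rw [factor, if_neg hne, mul_one]
  simp only [Matrix.sum_apply, tensor, of_apply, prod_place x.2.1, h2]
  rw [← Finset.sum_mul, ← Finset.sum_mul, ← Matrix.sum_apply, h1]

theorem isPVM_tensor_factor (g : PolyFn F n d) (x : Q) :
    IsPVM fun a => tensor (factor g x a) (1 : Matrix aux aux ℂ) where
  herm a := by
    rw [tensor_conjTranspose]
    congr 1
    funext i
    exact (factor_spec g x a i).1
  idem a := by
    rw [tensor_mul_tensor]
    congr 1
    funext i
    exact (factor_spec g x a i).2.2
  sum := by
    rw [Fintype.sum_prod_type]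
    simp only [sum_tensor_factor]
    rw [sum_tensor fun i => pauliProj (x.1 i)]
    simp only [(isPVM_pauliProj _).sum]
    exact tensor_one

/-- The honest strategy for a polynomial `g`. -/
noncomputable def honestStrategy (g : PolyFn F n d) (auxState : aux × aux → ℂ)
    (h : ∀ a b, auxState (a, b) = auxState (b, a)) (h' : ∑ p, ‖auxState p‖ ^ 2 = 1) :
    RegisterStrategy 2 F n (Fin 2 × AuxQuery) (Reply F n d) aux where
  auxState := auxState
  auxState_symm := h
  auxState_norm := h'
  M x a := tensor (factor g x a) 1
  povm x := (isProjMeas_of_isPVM (isPVM_tensor_factor g x)).1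
  pauli := sum_tensor_factor g
  hidden x a := hidesRegisters_tensor fun i hi => by
    rcases factor_trivial g x a (i := i) (by rw [hi]; decide) with h | h <;> rw [h]
    · rw [hi]
      cases a.1 i
      · exact ⟨1, (one_smul _ _).symm⟩
      · exact ⟨0, (zero_smul _ _).symm⟩
    · exact ⟨0, (zero_smul _ _).symm⟩

end Honest

/-! ### The honest strategy commutes and wins every round. -/

section Honest

open Matrix

open scoped Classical

set_option linter.unusedSectionVars false

variable {F : Type} [Field F] [Fintype F] [DecidableEq F] [Algebra (ZMod 2) F] {n d : ℕ}
  {aux : Type} [Fintype aux] [DecidableEq aux] (g : PolyFn F n d) (c : Fin 2) (a : A F n d)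

/-- A nonzero operator forces an answer that the honest procedure can produce. Each question
therefore has one explicit shape of answer, listed in the lemmas below, and all other answers can be
ignored. -/
theorem honest_cases (x : Q) : (∃ i, factor g x a i = 0) ∨
    (∀ i, pauliProj (x.1 i) (a.1 i) ≠ 0) ∧ ∃ k, honestReply g x a.1 k = a.2 := by
  by_cases h : ∃ i, factor g x a i = 0
  · exact .inl h
  · push Not at h
    refine .inr ⟨fun i => left_ne_zero_of_mul (h i), ?_⟩
    have h1 := right_ne_zero_of_mul (h x.2.1)
    rw [if_pos rfl] at h1
    exact exists_of_part_ne_zero h1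

theorem pauliProj_X_ne_zero {o : Option (Fin n → F)} (h : pauliProj .X o ≠ 0) : ∃ u, o = some u := by
  cases o
  · exact absurd rfl h
  · exact ⟨_, rfl⟩

theorem pauliProj_Z_ne_zero {o : Option (Fin n → F)} (h : pauliProj .Z o ≠ 0) : ∃ u, o = some u := by
  cases o
  · exact absurd rfl h
  · exact ⟨_, rfl⟩

theorem pauliProj_H_ne_zero {o : Option (Fin n → F)} (h : pauliProj .H o ≠ 0) : o = none := by
  cases o
  · rfl
  · exact absurd rfl h

theorem pauliProj_bot_ne_zero {o : Option (Fin n → F)} (h : pauliProj .bot o ≠ 0) : o = none := by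
  cases o
  · rfl
  · exact absurd rfl h

theorem answer_eq {a : A F n d} {p s : Option (Fin n → F)} {r : Reply F n d} (hp : a.1 c = p)
    (hs : a.1 (other c) = s) (hr : a.2 = r) : a = (place c p s, r) := by
  subst hp hs hr
  exact Prod.ext (eq_place c) rfl

theorem factor_eq {x : Q} {P P' : Matrix (Fin n → F) (Fin n → F) ℂ} (h : factor g x a c = P)
    (h' : factor g x a (other c) = P') : factor g x a = place c P P' := by
  subst h h'
  exact eq_place c

theorem other_ne : other c ≠ c := by
  fin_cases c <;> decide

theorem honest_lines : (∃ i, factor g (linesQ c) a i = 0) ∨ ∃ v f,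
    a = (place c none (some v), .line f) ∧
      factor g (linesQ c) a = place c (lineMeas g v f) (tauZ v) := by
  refine (honest_cases g a (linesQ c)).imp id ?_
  rintro ⟨hp, k, hk⟩
  have h1 := hp c
  have h2 := hp (other c)
  simp only [linesQ, place_self, place_other, honestReply] at h1 h2 hk
  obtain ⟨v, hv⟩ := pauliProj_Z_ne_zero h2
  obtain rfl := answer_eq c (pauliProj_bot_ne_zero h1) hv hk.symm
  refine ⟨v, k.1, rfl, factor_eq g c _ ?_ ?_⟩
  · simp only [factor, linesQ, place_self, place_other, honestReply, if_true, pauliProj, one_mul,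
      Option.getD_some, Reply.line.injEq, part_lineDot_fst]
  · simp [factor, linesQ, other_ne, pauliProj]

theorem honest_linesZ : (∃ i, factor g (linesZQ c) a i = 0) ∨ ∃ u v,
    a = (place c (some u) (some v), .line (polyLine g u v)) ∧
      factor g (linesZQ c) a = place c (tauZ u) (tauZ v) := by
  refine (honest_cases g a (linesZQ c)).imp id ?_
  rintro ⟨hp, k, hk⟩
  have h1 := hp c
  have h2 := hp (other c)
  simp only [linesZQ, place_self, place_other, honestReply] at h1 h2 hk
  obtain ⟨u, hu⟩ := pauliProj_Z_ne_zero h1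
  obtain ⟨v, hv⟩ := pauliProj_Z_ne_zero h2
  rw [hu, hv, Option.getD_some, Option.getD_some] at hk
  obtain rfl := answer_eq c hu hv hk.symm
  refine ⟨u, v, rfl, factor_eq g c _ ?_ ?_⟩
  · simp [factor, linesZQ, honestReply, pauliProj, (isPVM_lineDot g v).part_const]
  · simp [factor, linesZQ, other_ne, pauliProj]

theorem honest_linesX : (∃ i, factor g (linesXQ c) a i = 0) ∨ ∃ v k,
    a = (place c none (some v), .lineDot k.1 k.2) ∧
      factor g (linesXQ c) a = place c (lineDot g v k) (tauZ v) := by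
  refine (honest_cases g a (linesXQ c)).imp id ?_
  rintro ⟨hp, k, hk⟩
  have h1 := hp c
  have h2 := hp (other c)
  simp only [linesXQ, place_self, place_other, honestReply] at h1 h2 hk
  obtain ⟨v, hv⟩ := pauliProj_Z_ne_zero h2
  obtain rfl := answer_eq c (pauliProj_bot_ne_zero h1) hv hk.symm
  refine ⟨v, k, rfl, factor_eq g c _ ?_ ?_⟩
  · simp only [factor, linesXQ, place_self, place_other, honestReply, if_true, pauliProj, one_mul,
      Option.getD_some, Reply.lineDot.injEq, ← Prod.ext_iff, part_eq]
  · simp [factor, linesXQ, other_ne, pauliProj]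

theorem honest_basis : (∃ i, factor g (basisXQ c) a i = 0) ∨ ∃ u v,
    a = (place c (some u) (some v), .empty) ∧
      factor g (basisXQ c) a = place c (tauX u) (tauZ v) := by
  refine (honest_cases g a (basisXQ c)).imp id ?_
  rintro ⟨hp, k, hk⟩
  have h1 := hp c
  have h2 := hp (other c)
  simp only [basisXQ, place_self, place_other, honestReply] at h1 h2 hk
  obtain ⟨u, hu⟩ := pauliProj_X_ne_zero h1
  obtain ⟨v, hv⟩ := pauliProj_Z_ne_zero h2
  obtain rfl := answer_eq c hu hv hk.symm
  refine ⟨u, v, rfl, factor_eq g c _ ?_ ?_⟩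
  · simp [factor, basisXQ, honestReply, pauliProj, (isPVM_lineDot g v).part_const]
  · simp [factor, basisXQ, other_ne, pauliProj]

theorem honest_dot : (∃ i, factor g (dotXQ c) a i = 0) ∨ ∃ v e,
    a = (place c none (some v), .dot e) ∧
      factor g (dotXQ c) a = place c (dotMeas v e) (tauZ v) := by
  refine (honest_cases g a (dotXQ c)).imp id ?_
  rintro ⟨hp, k, hk⟩
  have h1 := hp c
  have h2 := hp (other c)
  simp only [dotXQ, place_self, place_other, honestReply] at h1 h2 hk
  obtain ⟨v, hv⟩ := pauliProj_Z_ne_zero h2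
  obtain rfl := answer_eq c (pauliProj_bot_ne_zero h1) hv hk.symm
  refine ⟨v, k.2, rfl, factor_eq g c _ ?_ ?_⟩
  · simp only [factor, dotXQ, place_self, place_other, honestReply, if_true, pauliProj, one_mul,
      Option.getD_some, Reply.dot.injEq, part_lineDot_snd]
  · simp [factor, dotXQ, other_ne, pauliProj]

theorem factor_points (u : Fin n → F) (ν : F) :
    factor g (pointsQ c) (place c (some u) none, .value ν) =
      place c (if ν = g.1 u then tauZ u else 0) 1 := by
  refine factor_eq g c _ ?_ ?_
  · simp [factor, pointsQ, honestReply, pauliProj, (isPVM_lineDot g _).part_const, eq_comm]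
  · simp [factor, pointsQ, other_ne, pauliProj]

theorem honest_points : (∃ i, factor g (pointsQ c) a i = 0) ∨ ∃ u,
    a = (place c (some u) none, .value (g.1 u)) ∧ factor g (pointsQ c) a = place c (tauZ u) 1 := by
  refine (honest_cases g a (pointsQ c)).imp id ?_
  rintro ⟨hp, k, hk⟩
  have h1 := hp c
  have h2 := hp (other c)
  simp only [pointsQ, place_self, place_other, honestReply] at h1 h2 hk
  obtain ⟨u, hu⟩ := pauliProj_Z_ne_zero h1
  rw [hu, Option.getD_some] at hk
  obtain rfl := answer_eq c hu (pauliProj_H_ne_zero h2) hk.symm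
  refine ⟨u, rfl, ?_⟩
  rw [factor_points, if_pos rfl]

theorem lineMeas_mul_tauZ {f : LineFn F n d} {u v : Fin n → F} (h : lineMeas g v f * tauZ u ≠ 0) :
    f = polyLine g u v := by
  by_contra h'
  refine h ?_
  rw [lineMeas, ← part_eq tauZ u, isPVM_tauZ.part_mul_part]
  by_contra h1
  obtain ⟨w, hw, rfl⟩ := exists_of_part_ne_zero h1
  exact h' hw.symm

theorem tauX_mul_dotMeas {u v : Fin n → F} {e : F} (h : tauX u * dotMeas v e ≠ 0) :
    e = v ⬝ᵥ u := by
  by_contra h'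
  refine h ?_
  rw [dotMeas, ← part_eq tauX u, isPVM_tauX.part_mul_part]
  by_contra h1
  obtain ⟨w, rfl, hw⟩ := exists_of_part_ne_zero h1
  exact h' hw.symm

theorem tauZ_mul_tauZ {u v : Fin n → F} (h : tauZ u * tauZ v ≠ 0) : u = v := by
  by_contra h'
  exact h (isPVM_tauZ.mul_of_ne h')

theorem isDiag_lineMeas (v : Fin n → F) (f : LineFn F n d) : (lineMeas g v f).IsDiag :=
  isDiag_part isDiag_tauZ _

theorem commute_place {P P' R R' : Matrix (Fin n → F) (Fin n → F) ℂ} (h : Commute P R)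
    (h' : Commute P' R') : Commute (tensor (place c P P') (1 : Matrix aux aux ℂ))
      (tensor (place c R R') 1) := by
  rw [commute_iff_eq, tensor_mul_tensor, tensor_mul_tensor]
  congr 1
  funext i
  simp only [place]
  split_ifs
  · exact h
  · exact h'

/-- Measurements with different results on the slope register commute, because both products
vanish. -/
theorem commute_place_tauZ {P R : Matrix (Fin n → F) (Fin n → F) ℂ} {v w : Fin n → F}
    (h : v = w → Commute P R) : Commute (tensor (place c P (tauZ v)) (1 : Matrix aux aux ℂ))
      (tensor (place c R (tauZ w)) 1) := by
  by_cases hv : v = w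
  · exact commute_place c (h hv) (commute_of_isDiag (isDiag_tauZ _) (isDiag_tauZ _))
  · rw [commute_iff_eq, tensor_mul_tensor, tensor_mul_tensor, tensor_eq_zero (i := other c),
      tensor_eq_zero (i := other c)]
    · rw [place_other, place_other, isPVM_tauZ.mul_of_ne (Ne.symm hv)]
    · rw [place_other, place_other, isPVM_tauZ.mul_of_ne hv]

/-- In each round the factors on a register are diagonal in the `Z` basis, or parts of one
projective measurement once the slopes agree, or one of them is the identity. If the slopes differ,
both products vanish (`commute_place_tauZ`). -/
theorem honest_commute (r : Round) (a b : A F n d) :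
    Commute (tensor (factor g r.questions.1 a) (1 : Matrix aux aux ℂ))
      (tensor (factor g r.questions.2 b) 1) := by
  have hl : ∀ {P : Fin 2 → Matrix (Fin n → F) (Fin n → F) ℂ} {X}, (∃ i, P i = 0) →
      Commute (tensor P (1 : Matrix aux aux ℂ)) X := by
    rintro P X ⟨i, hi⟩
    rw [tensor_eq_zero hi]
    exact Commute.zero_left _
  have hr : ∀ {P : Fin 2 → Matrix (Fin n → F) (Fin n → F) ℂ} {X}, (∃ i, P i = 0) →
      Commute X (tensor P (1 : Matrix aux aux ℂ)) := fun h => (hl h).symm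
  cases r with
  | hideSurface c =>
    rcases honest_lines g c a with h | ⟨v, f, -, ha⟩
    · exact hl h
    rcases honest_linesZ g c b with h | ⟨u, w, -, hb⟩
    · exact hr h
    simp only [Round.questions, ha, hb]
    exact commute_place_tauZ c fun _ => commute_of_isDiag (isDiag_lineMeas g v f) (isDiag_tauZ u)
  | hideAnswer c =>
    rcases honest_lines g c a with h | ⟨v, f, -, ha⟩
    · exact hl h
    rcases honest_linesX g c b with h | ⟨w, k, -, hb⟩
    · exact hr h
    simp only [Round.questions, ha, hb]
    refine commute_place_tauZ c fun h => ?_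
    subst h
    rw [← part_lineDot_fst, ← part_eq (lineDot g v) k]
    exact (isPVM_lineDot g v).part_commute _ _
  | hideBasis c =>
    rcases honest_basis g c a with h | ⟨u, v, -, ha⟩
    · exact hl h
    rcases honest_dot g c b with h | ⟨w, e, -, hb⟩
    · exact hr h
    simp only [Round.questions, ha, hb]
    refine commute_place_tauZ c fun h => ?_
    rw [dotMeas, ← part_eq tauX u]
    exact isPVM_tauX.part_commute _ _
  | hideDot c =>
    rcases honest_linesX g c a with h | ⟨v, k, -, ha⟩
    · exact hl h
    rcases honest_dot g c b with h | ⟨w, e, -, hb⟩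
    · exact hr h
    simp only [Round.questions, ha, hb]
    refine commute_place_tauZ c fun h => ?_
    subst h
    rw [← part_lineDot_snd g, ← part_eq (lineDot g v) k]
    exact (isPVM_lineDot g v).part_commute _ _
  | cross c =>
    rcases honest_lines g c a with h | ⟨v, f, -, ha⟩
    · exact hl h
    rcases honest_points g c b with h | ⟨u, -, hb⟩
    · exact hr h
    simp only [Round.questions, ha, hb]
    exact commute_place c (commute_of_isDiag (isDiag_lineMeas g v f) (isDiag_tauZ u))
      (Commute.one_right _)
  | intersect =>
    rcases honest_lines g 0 a with h | ⟨v, f, -, ha⟩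
    · exact hl h
    rcases honest_lines g 1 b with h | ⟨u, f', -, hb⟩
    · exact hr h
    simp only [Round.questions, ha, hb]
    rw [place_swap 1]
    exact commute_place 0 (commute_of_isDiag (isDiag_lineMeas g v f) (isDiag_tauZ u))
      (commute_of_isDiag (isDiag_tauZ v) (isDiag_lineMeas g u f'))
  | consistency =>
    rcases honest_points g 0 a with h | ⟨u, -, ha⟩
    · exact hl h
    rcases honest_points g 0 b with h | ⟨w, -, hb⟩
    · exact hr h
    simp only [Round.questions, ha, hb]
    exact commute_place 0 (commute_of_isDiag (isDiag_tauZ u) (isDiag_tauZ w)) (Commute.one_right _)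

/-- A pair of answers matters only if the product of the two operators is nonzero on each register.
On a common register this forces equal outcomes of the same measurement, and the winning conditions
then become properties of the restriction of g to lines. -/
theorem honest_check (r : Round) (a b : A F n d)
    (h : ∀ i, factor g r.questions.1 a i * factor g r.questions.2 b i ≠ 0) : r.check a b := by
  have hl : ∀ i, factor g r.questions.1 a i ≠ 0 := fun i => left_ne_zero_of_mul (h i)
  have hr : ∀ i, factor g r.questions.2 b i ≠ 0 := fun i => right_ne_zero_of_mul (h i)
  cases r with
  | hideSurface c =>
    obtain ⟨v, f, rfl, ha⟩ := (honest_lines g c a).resolve_left fun ⟨i, hi⟩ => hl i hi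
    obtain ⟨u, w, rfl, hb⟩ := (honest_linesZ g c b).resolve_left fun ⟨i, hi⟩ => hr i hi
    simp only [Round.questions, ha, hb] at h
    have hp := h c
    have hs := h (other c)
    simp only [place_self, place_other] at hp hs
    obtain rfl := tauZ_mul_tauZ hs
    obtain rfl := lineMeas_mul_tauZ g hp
    exact ⟨u, v, _, rfl, rfl, rfl⟩
  | hideAnswer c =>
    obtain ⟨v, f, rfl, ha⟩ := (honest_lines g c a).resolve_left fun ⟨i, hi⟩ => hl i hi
    obtain ⟨w, k, rfl, hb⟩ := (honest_linesX g c b).resolve_left fun ⟨i, hi⟩ => hr i hi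
    simp only [Round.questions, ha, hb] at h
    have hp := h c
    have hs := h (other c)
    simp only [place_self, place_other] at hp hs
    obtain rfl := tauZ_mul_tauZ hs
    rw [← part_lineDot_fst, ← part_eq (lineDot g v) k, (isPVM_lineDot g v).part_mul_part] at hp
    obtain ⟨_, rfl, rfl⟩ := exists_of_part_ne_zero hp
    exact ⟨v, _, _, rfl, rfl⟩
  | hideBasis c =>
    obtain ⟨u, v, rfl, ha⟩ := (honest_basis g c a).resolve_left fun ⟨i, hi⟩ => hl i hi
    obtain ⟨w, e, rfl, hb⟩ := (honest_dot g c b).resolve_left fun ⟨i, hi⟩ => hr i hi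
    simp only [Round.questions, ha, hb] at h
    have hp := h c
    have hs := h (other c)
    simp only [place_self, place_other] at hp hs
    obtain rfl := tauZ_mul_tauZ hs
    obtain rfl := tauX_mul_dotMeas hp
    exact ⟨u, v, rfl, rfl⟩
  | hideDot c =>
    obtain ⟨v, k, rfl, ha⟩ := (honest_linesX g c a).resolve_left fun ⟨i, hi⟩ => hl i hi
    obtain ⟨w, e, rfl, hb⟩ := (honest_dot g c b).resolve_left fun ⟨i, hi⟩ => hr i hi
    simp only [Round.questions, ha, hb] at h
    have hp := h c
    have hs := h (other c)
    simp only [place_self, place_other] at hp hs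
    obtain rfl := tauZ_mul_tauZ hs
    rw [← part_lineDot_snd g, ← part_eq (lineDot g v) k, (isPVM_lineDot g v).part_mul_part] at hp
    obtain ⟨_, rfl, rfl⟩ := exists_of_part_ne_zero hp
    exact ⟨v, v, _, _, rfl, rfl⟩
  | cross c =>
    obtain ⟨v, f, rfl, ha⟩ := (honest_lines g c a).resolve_left fun ⟨i, hi⟩ => hl i hi
    obtain ⟨u, rfl, hb⟩ := (honest_points g c b).resolve_left fun ⟨i, hi⟩ => hr i hi
    simp only [Round.questions, ha, hb] at h
    have hp := h c
    simp only [place_self] at hp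
    obtain rfl := lineMeas_mul_tauZ g hp
    have h0 := hasValue_polyLine g u v 0
    rw [zero_smul, add_zero] at h0
    exact ⟨u, v, _, _, rfl, rfl, h0⟩
  | intersect =>
    obtain ⟨v, f, rfl, ha⟩ := (honest_lines g 0 a).resolve_left fun ⟨i, hi⟩ => hl i hi
    obtain ⟨u, f', rfl, hb⟩ := (honest_lines g 1 b).resolve_left fun ⟨i, hi⟩ => hr i hi
    simp only [Round.questions, ha, hb] at h
    have h0 : lineMeas g v f * tauZ u ≠ 0 := h 0
    have h1 : tauZ v * lineMeas g u f' ≠ 0 := h 1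
    rw [(commute_of_isDiag (isDiag_tauZ v) (isDiag_lineMeas g u f')).eq] at h1
    obtain rfl := lineMeas_mul_tauZ g h0
    obtain rfl := lineMeas_mul_tauZ g h1
    -- The point u + v is reached with parameter 1 both from u in direction v and from v in
    -- direction u, and both functions restrict the same g.
    have h2 := hasValue_polyLine g u v 1
    have h3 := hasValue_polyLine g v u 1
    rw [one_smul] at h2 h3
    rw [add_comm] at h3
    exact ⟨u, v, _, _, _, rfl, rfl, h2, h3⟩
  | consistency =>
    obtain ⟨u, rfl, ha⟩ := (honest_points g 0 a).resolve_left fun ⟨i, hi⟩ => hl i hi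
    obtain ⟨w, rfl, hb⟩ := (honest_points g 0 b).resolve_left fun ⟨i, hi⟩ => hr i hi
    simp only [Round.questions, ha, hb] at h
    obtain rfl := tauZ_mul_tauZ (h 0)
    exact ⟨u, u, _, rfl, rfl⟩

end Honest

section Honest

open Matrix

open scoped Classical

set_option linter.unusedSectionVars false

/-! ### Products of maximally entangled states -/

theorem isEPRState_of_fintype {ι κ : Type} [Fintype κ] {ψ : ι × ι → ℂ} (t : κ → ℕ)
    (e : ι ≃ ((i : κ) → Fin (2 ^ t i)))
    (h : ∀ a b, ψ (a, b) = ∏ i, if e a i = e b i then ((1 / √(2 ^ t i) : ℝ) : ℂ) else 0) :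
    IsEPRState ψ := by
  let σ := Fintype.equivFin κ
  refine ⟨Fintype.card κ, fun j => t (σ.symm j),
    e.trans (Equiv.piCongrLeft' (fun i => Fin (2 ^ t i)) σ), fun a b => ?_⟩
  rw [h]
  refine (Equiv.prod_comp σ.symm fun i =>
    if e a i = e b i then ((1 / √(2 ^ t i) : ℝ) : ℂ) else 0).symm.trans ?_
  rfl

theorem prod_ite_eq {ι κ : Type} [Fintype κ] (t : κ → ℕ) (e : ι ≃ ((i : κ) → Fin (2 ^ t i)))
    (a b : ι) : (∏ i, if e a i = e b i then ((1 / √(2 ^ t i) : ℝ) : ℂ) else 0) =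
      if a = b then ((∏ i, (1 / √(2 ^ t i)) : ℝ) : ℂ) else 0 := by
  by_cases h : a = b
  · subst h
    simp
  · rw [if_neg h]
    obtain ⟨i, hi⟩ := Function.ne_iff.1 (e.injective.ne h)
    exact Finset.prod_eq_zero (Finset.mem_univ i) (if_neg hi)

theorem IsEPRState.symm {ι : Type} {ψ : ι × ι → ℂ} (h : IsEPRState ψ) (a b : ι) :
    ψ (a, b) = ψ (b, a) := by
  obtain ⟨k, t, e, h⟩ := h
  rw [h, h]
  simp only [eq_comm]

theorem IsEPRState.norm {ι : Type} [Fintype ι] {ψ : ι × ι → ℂ} (h : IsEPRState ψ) :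
    ∑ p, ‖ψ p‖ ^ 2 = 1 := by
  obtain ⟨k, t, e, h⟩ := h
  have hc : (Fintype.card ι : ℝ) = ∏ i, (2 : ℝ) ^ t i := by
    rw [Fintype.card_congr e, Fintype.card_pi]
    simp
  have h1 : (∏ i, (1 / √(2 ^ t i) : ℝ)) ^ 2 = (Fintype.card ι : ℝ)⁻¹ := by
    rw [hc, ← Finset.prod_pow, ← Finset.prod_inv_distrib]
    refine Finset.prod_congr rfl fun i _ => ?_
    rw [div_pow, Real.sq_sqrt (by positivity), one_pow, one_div]
  have h2 : ∀ a, ∑ b, ‖ψ (a, b)‖ ^ 2 = (Fintype.card ι : ℝ)⁻¹ := by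
    intro a
    simp only [h, prod_ite_eq]
    rw [Finset.sum_eq_single a (fun b _ hb => by simp [hb.symm]) (by simp), if_pos rfl,
      Complex.norm_real, Real.norm_eq_abs, sq_abs, h1]
  have h3 : (Fintype.card ι : ℝ) ≠ 0 := by
    rw [hc]
    positivity
  rw [Fintype.sum_prod_type]
  simp only [h2]
  rw [Finset.sum_const, Finset.card_univ, nsmul_eq_mul, mul_inv_cancel₀ h3]

variable {F : Type} [Field F] [Fintype F] [DecidableEq F] [Algebra (ZMod 2) F] {n d : ℕ}
  {aux : Type} [Fintype aux] [DecidableEq aux]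

theorem isEPRState_state (S : RegisterStrategy 2 F n (Fin 2 × AuxQuery) (Reply F n d) aux)
    (h : IsEPRState S.auxState) : IsEPRState S.state := by
  have : Fact (Nat.Prime 2) := ⟨Nat.prime_two⟩
  obtain ⟨k, t, e, h⟩ := h
  -- A field containing `ZMod 2` has 2 ^ m elements, so each of the 2n qudits is an EPR pair of
  -- dimension 2 ^ m; the naming of its basis is irrelevant.
  let m := Module.finrank (ZMod 2) F
  have hF : Fintype.card F = 2 ^ m := by
    rw [Module.card_eq_pow_finrank (K := ZMod 2), ZMod.card]
  let ε : F ≃ Fin (2 ^ m) := Fintype.equivFinOfCardEq hF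
  let τ : (Fin 2 × Fin n) ⊕ Fin k → ℕ := Sum.elim (fun _ => m) t
  let e₀ : (Fin 2 → Fin n → F) ≃ ((i : Fin 2 × Fin n) → Fin (2 ^ τ (.inl i))) :=
    (Equiv.curry (Fin 2) (Fin n) F).symm.trans (Equiv.piCongrRight fun _ => ε)
  refine isEPRState_of_fintype τ ((e₀.prodCongr e).trans
    (Equiv.sumPiEquivProdPi fun i => Fin (2 ^ τ i)).symm) ?_
  rintro ⟨x, a⟩ ⟨y, b⟩
  rw [RegisterStrategy.state, h, Fintype.prod_sum_type, Fintype.prod_prod_type]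
  congr 1
  refine Finset.prod_congr rfl fun i _ => Finset.prod_congr rfl fun j _ => ?_
  have h1 : (√(Fintype.card F : ℝ)) = √(2 ^ m) := by
    rw [hF]
    push_cast
    rfl
  rw [h1]
  exact if_congr ε.injective.eq_iff.symm rfl rfl

/-! ### Completeness -/

theorem tensor_factor_transpose (g : PolyFn F n d) (x : Q) (a : A F n d) :
    (tensor (factor g x a) (1 : Matrix aux aux ℂ))ᵀ = tensor (factor g x a) 1 := by
  rw [tensor_transpose]
  congr 1
  funext i
  exact (factor_spec g x a i).2.1

theorem tensor_mul_stateMat (S : RegisterStrategy 2 F n (Fin 2 × AuxQuery) (Reply F n d) aux)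
    (P : Fin 2 → Matrix (Fin n → F) (Fin n → F) ℂ) :
    tensor P 1 * stateMat S.state = stateMat S.state * tensor P 1 := by
  have h : tensor P (1 : Matrix aux aux ℂ) =
      (Matrix.of fun x y => ∏ i, P i (x i) (y i)) ⊗ₖ (1 : Matrix aux aux ℂ) := rfl
  rw [stateMat_state, h, ← mul_kronecker_mul, ← mul_kronecker_mul, one_mul, mul_one,
    mul_smul_comm, smul_mul_assoc, one_mul, mul_one]

theorem ask_cases (s : (introIntersect F n d).Seed) : ∃ r : Round,
    (introIntersect F n d).ask s = r.questions ∨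
      (introIntersect F n d).ask s = r.questions.swap := by
  refine ⟨drawRound s.1 s.2.1 s.2.2.1, ?_⟩
  change (if s.2.2.2 then _ else _) = _ ∨ (if s.2.2.2 then _ else _) = _
  cases s.2.2.2
  · exact .inr rfl
  · exact .inl rfl

variable (g : PolyFn F n d) {auxState : aux × aux → ℂ} (h : IsEPRState auxState)

theorem isProjective_honest : (honestStrategy g auxState h.symm h.norm).IsProjective :=
  fun x => isProjMeas_of_isPVM (isPVM_tensor_factor g x)

/-- The honest operators commute with Ψ and are symmetric, so the weight of a pair of answers
contains the product of the two operators as a factor, and this product vanishes for every rejected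
pair. -/
theorem value_honest :
    (honestStrategy g auxState h.symm h.norm).value (introIntersect F n d) = 1 := by
  rw [value_eq (isProjective_honest g h), Finset.sum_eq_zero, zero_div, sub_zero]
  intro s _
  have key : ∀ (r : Round) (a b : A F n d), ¬r.check a b →
      tensor (factor g r.questions.1 a) (1 : Matrix aux aux ℂ) *
        tensor (factor g r.questions.2 b) 1 = 0 := by
    intro r a b hab
    rw [tensor_mul_tensor]
    by_contra h1
    exact hab (honest_check g r a b fun i hi => h1 (tensor_eq_zero hi))
  refine Finset.sum_eq_zero fun a _ => Finset.sum_eq_zero fun b _ => ?_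
  split_ifs with hab
  · rfl
  change fr (tensor (factor g ((introIntersect F n d).ask s).1 a) 1 * stateMat _ *
    (tensor (factor g ((introIntersect F n d).ask s).2 b) 1)ᵀ) = 0
  rw [tensor_factor_transpose, mul_assoc, ← tensor_mul_stateMat, ← mul_assoc]
  have h0 : tensor (factor g ((introIntersect F n d).ask s).1 a) (1 : Matrix aux aux ℂ) *
      tensor (factor g ((introIntersect F n d).ask s).2 b) 1 = 0 := by
    obtain ⟨r, hr | hr⟩ := ask_cases s
    · rw [hr] at hab ⊢
      exact key r a b fun hc => hab ((accepts_iff r a b).2 hc)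
    · rw [hr] at hab ⊢
      -- With the roles exchanged, the product appears in the other order; transposing the symmetric
      -- operators restores it.
      have h1 := key r b a fun hc => hab ⟨r, .inr ⟨rfl, hc⟩⟩
      have h2 := congrArg transpose h1
      rwa [transpose_mul, tensor_factor_transpose, tensor_factor_transpose, transpose_zero] at h2
  rw [h0, zero_mul, fr_zero]

theorem isRealCommutingEPR_honest :
    (honestStrategy g auxState h.symm h.norm).IsRealCommutingEPR (introIntersect F n d) := by
  refine ⟨isEPRState_state _ h, isProjective_honest g h, fun x a i j => ?_, fun s a b => ?_⟩
  -- A matrix that equals both its conjugate transpose and its transpose is real.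
  · have h1 := congrFun (congrFun ((isPVM_tensor_factor (aux := aux) g x).herm a) i) j
    have h2 := congrFun (congrFun (tensor_factor_transpose (aux := aux) g x a) i) j
    rw [conjTranspose_apply, ← transpose_apply (tensor _ _), h2] at h1
    exact Complex.conj_eq_iff_im.1 h1
  · change Commute (tensor (factor g ((introIntersect F n d).ask s).1 a) 1)
      (tensor (factor g ((introIntersect F n d).ask s).2 b) 1)
    obtain ⟨r, hr | hr⟩ := ask_cases s <;> rw [hr]
    · exact honest_commute g r a b
    · exact (honest_commute g r b a).symm

theorem pointsMeas_honest (c : Fin 2) (u : Fin n → F) (ν : F) :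
    pointsMeas (honestStrategy g auxState h.symm h.norm) c (u, ν) =
      if ν = g.1 u then tensor (place c (tauZ u) 1) 1 else 0 := by
  refine (congrArg (tensor · (1 : Matrix aux aux ℂ)) (factor_points g c u ν)).trans ?_
  split_ifs
  · rfl
  · exact tensor_eq_zero (place_self c _ _)

theorem exists_honest (h : IsEPRState auxState) : ∃ S : RegisterStrategy 2 F n (Fin 2 × AuxQuery) (Reply F n d) aux,
    S.auxState = auxState ∧ S.IsRealCommutingEPR (introIntersect F n d) ∧
      S.value (introIntersect F n d) = 1 ∧
      (∀ u ν, pointsMeas S 0 (u, ν) = if ν = g.1 u then tensor ![tauZ u, 1] 1 else 0) ∧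
      (∀ v ν, pointsMeas S 1 (v, ν) = if ν = g.1 v then tensor ![1, tauZ v] 1 else 0) := by
  have h0 : ∀ P P' : Matrix (Fin n → F) (Fin n → F) ℂ, place 0 P P' = ![P, P'] := by
    intro P P'
    funext i
    fin_cases i <;> rfl
  have h1 : ∀ P P' : Matrix (Fin n → F) (Fin n → F) ℂ, place 1 P P' = ![P', P] := by
    intro P P'
    funext i
    fin_cases i <;> rfl
  refine ⟨honestStrategy g auxState h.symm h.norm, rfl, isRealCommutingEPR_honest g h,
    value_honest g h, fun u ν => ?_, fun v ν => ?_⟩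
  · rw [pointsMeas_honest g h, h0]
  · rw [pointsMeas_honest g h, h1]

end Honest

end IntroLines

open IntroLines in
theorem mainTheorem11 :
    -- completeness
    (∀ (F : Type) [Field F] [Fintype F] [DecidableEq F] [Algebra (ZMod 2) F] (n d : ℕ),
      0 < n → 0 < d → ∀ (g : PolyFn F n d)
      (aux : Type) [Fintype aux] [DecidableEq aux] (auxState : aux × aux → ℂ),
      IsEPRState auxState →
      ∃ S : RegisterStrategy 2 F n (Fin 2 × AuxQuery) (Reply F n d) aux,
        S.auxState = auxState ∧
        S.IsRealCommutingEPR (introIntersect F n d) ∧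
        S.value (introIntersect F n d) = 1 ∧
        (∀ u ν, pointsMeas S 0 (u, ν) = if ν = g.1 u then tensor ![tauZ u, 1] 1 else 0) ∧
        (∀ v ν, pointsMeas S 1 (v, ν) = if ν = g.1 v then tensor ![1, tauZ v] 1 else 0)) ∧
    -- soundness
    (∃ δ : ℝ → ℝ → ℝ, IsPolySmall δ ∧
      ∀ (F : Type) [Field F] [Fintype F] [DecidableEq F] [Algebra (ZMod 2) F] (n d : ℕ),
      0 < n → 0 < d → ∀ (aux : Type) [Fintype aux] [DecidableEq aux]
      (S : RegisterStrategy 2 F n (Fin 2 × AuxQuery) (Reply F n d) aux) (ε : ℝ),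
      S.IsProjective → 0 ≤ ε → 1 - ε ≤ S.value (introIntersect F n d) →
      ∀ G : PolyFn F n d → Matrix aux aux ℂ, IsProjMeas G →
      (∀ u ν, pointsMeas S 0 (u, ν) = tensor ![tauZ u, 1] (marginal G (fun g => g.1 u) ν)) →
      stateDist S.state (pointsMeas S 1)
        (fun o => tensor ![1, tauZ o.1] (marginal G (fun g => g.1 o.1) o.2))
        ≤ δ ε (d / Fintype.card F)) ∧
    -- question length and answer length
    (∃ C : ℕ, (∀ x : Q, (questionBits x).length ≤ C) ∧
      ∀ (F : Type) [Field F] [Algebra (ZMod 2) F] (t n d : ℕ)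
      (b : Module.Basis (Fin t) (ZMod 2) F), 0 < n → 0 < d →
      ∀ a : A F n d, (answerBits b a).length ≤ C * (n * t + d * t)) ∧
    -- running time for the questions
    (∃ (R : CoinMachine (Option Bool) (Option Bool)) (T : ℕ),
      ∀ (F : Type) [Field F] [Algebra (ZMod 2) F] (t n d : ℕ)
      (b : Module.Basis (Fin t) (ZMod 2) F), 0 < n → 0 < d →
      R.Samples (joinStrings (inputStrings b n d)) T (introIntersect F n d)) ∧
    -- running time for the decision
    (∃ (D : Turing.TM2ComputableAux (Option Bool) Bool) (C : ℕ),
      ∀ (F : Type) [Field F] [Algebra (ZMod 2) F] (t n d : ℕ)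
      (b : Module.Basis (Fin t) (ZMod 2) F), 0 < n → 0 < d →
      Decides D b (C * (n * t + d * t) ^ C) (introIntersect F n d)) := by
  refine ⟨fun F _ _ _ _ n d _ _ g aux _ _ auxState h => exists_honest g h,
    -- The bound obtained is linear in ε and has no d/q term, so the exponent 1 works.
    ⟨fun ε _ => 10 ^ 6 * ε, ⟨10 ^ 6, 1, by norm_num, one_pos, fun x y hx hy => ?_⟩,
    fun F _ _ _ _ n d _ _ aux _ _ S ε hS _ hε G hG hA => stateDist_points_le hS hε hG hA⟩,
    ⟨12, fun x => by rw [length_questionBits]; norm_num,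
    fun F _ _ t n d b hn _ a => length_answerBits_le b hn a⟩, exists_samples, exists_decides⟩
  rw [Real.rpow_one, Real.rpow_one]
  linarith
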